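/- **Theorem 2.** Let $N\ge 1$, $\Delta\in\mathbb{R}$, let $\mathcal{X}_N$ be the set of $X=\{x_1<\dots<x_N\}\subset\mathbb{Z}$ and $\mathcal{H}_N=\ell^2(\mathcal{X}_N)$ with orthonormal basis $(e_X)$, where $e_X$ is the state with up-spins exactly at the sites of $X$. Let $H=\sum_{j\in\mathbb{Z}}\big[\sigma_j^+\sigma_{j+1}^-+\sigma_j^-\sigma_{j+1}^++\tfrac{\Delta}{2}(\sigma^3_j\sigma^3_{j+1}-1)\big]$ be the XXZ Hamiltonian on $\mathcal{H}_N$, where $\sigma_j^+$, $\sigma_j^-$ raise, respectively lower, the spin at $j$ (and give $0$ if this is impossible) and $\sigma_j^3=\pm1$ if the spin at $j$ is up, respectively down. For $Y=\{y_1<\dots<y_N\}\in\mathcal{X}_N$ and $t\in\mathbb{R}$ write $e^{-\mathrm{i}tH}e_Y=\sum_X\psi_N(X;t)\,e_X$, and let $$\mathbb{P}_Y(X_1(t)\ge x)=\sum_{n=x}^{\infty}\ \sum_{X\in\mathcal{X}_N,\ x_1=n}|\psi_N(X;t)|^2,\qquad x\in\mathbb{Z}.$$ Put $\varepsilon(\xi)=\xi+\xi^{-1}-2\Delta$,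 $\ \Delta_N(\xi)=\prod_{j<k}(\xi_k-\xi_j)$ and $$D_N(\xi,\zeta)=\det\left(\frac{1}{(1-\xi_i\zeta_j)(\xi_i+\zeta_j-2\Delta\xi_i\zeta_j)}\right)_{1\le i,j\le N}.$$ Then there is a polynomial $Q_N(\xi,\zeta)$ in $\xi_1,\dots,\xi_N,\zeta_1,\dots,\zeta_N$, depending only on $N$ and $\Delta$, of degree $N-1$ in each variable, separately symmetric in the $\xi_j$ and in the $\zeta_j$, and determined by $$\prod_{j,k}(\xi_j+\zeta_k-2\Delta\xi_j\zeta_k)\,D_N(\xi,\zeta)=\frac{\Delta_N(\xi)\Delta_N(\zeta)}{\prod_{j,k}(1-\xi_j\zeta_k)}\,Q_N(\xi,\zeta),$$ such that for all $Y\in\mathcal{X}_N$, $x\in\mathbb{Z}$, $t\in\mathbb{R}$ $$\mathbb{P}_Y(X_1(t)\ge x)=\int_{\mathcal{C}_R}\!\!\cdots\int_{\mathcal{C}_r}\frac{\prod_{j,k}(\xi_j+\zeta_k-2\Delta\xi_j\zeta_k)}{\prod_{j<k}(1+\xi_j\xi_k-2\Delta\xi_j)(1+\zeta_j\zeta_k-2\Delta\zeta_j)}\,D_N(\xi,\zeta)\prod_j(\xi_j\zeta_j)^{x-y_j-1}e^{-\mathrm{i}t(\varepsilon(\xi_j)-\varepsilon(\zeta_j))}\,d^N\zeta\,d^N\xi$$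 $$=\int_{\mathcal{C}_R}\!\!\cdots\int_{\mathcal{C}_r}\frac{\Delta_N(\xi)\Delta_N(\zeta)}{\prod_{j<k}(1+\xi_j\xi_k-2\Delta\xi_j)(1+\zeta_j\zeta_k-2\Delta\zeta_j)}\,\frac{Q_N(\xi,\zeta)}{\prod_{j,k}(1-\xi_j\zeta_k)}\prod_j(\xi_j\zeta_j)^{x-y_j-1}e^{-\mathrm{i}t(\varepsilon(\xi_j)-\varepsilon(\zeta_j))}\,d^N\zeta\,d^N\xi .$$ Here every differential $d\xi_j$, $d\zeta_j$ includes the factor $(2\pi\mathrm{i})^{-1}$, each $\zeta_j$ runs over $\mathcal{C}_r=\{|\zeta|=r\}$ and each $\xi_j$ over $\mathcal{C}_R=\{|\xi|=R\}$ (positively oriented), where $r>0$ is so small that no factor $1+\zeta_j\zeta_k-2\Delta\zeta_j$, $j<k$, vanishes when all $|\zeta_i|\le r$, $R>0$ is so large that no factor $1+\xi_j\xi_k-2\Delta\xi_j$, $j<k$, vanishes when all $|\xi_i|\ge R$, and $Rr<1$. -/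

import Mathlib

open scoped ENNReal

noncomputable section

namespace XXZ

/-! ### Spin configurations and the Hamiltonian -/

/-- A complex amplitude for every finite set of up-spins on `ℤ`: the (formal) vector
`∑_X φ(X) e_X`. -/
abbrev Amplitude : Type := Finset ℤ → ℂ

/-- `σ_j^+`: `e_X ↦ e_{X ∪ {j}}` if `j ∉ X`, and `e_X ↦ 0` if `j ∈ X`. -/
def sigmaPlus (j : ℤ) : Module.End ℂ Amplitude where
  toFun φ X := if j ∈ X then φ (X.erase j) else 0
  map_add' φ χ := by ext X; by_cases h : j ∈ X <;> simp [h]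
  map_smul' c φ := by ext X; by_cases h : j ∈ X <;> simp [h]

/-- `σ_j^-`: `e_X ↦ e_{X \ {j}}` if `j ∈ X`, and `e_X ↦ 0` if `j ∉ X`. -/
def sigmaMinus (j : ℤ) : Module.End ℂ Amplitude where
  toFun φ X := if j ∈ X then 0 else φ (insert j X)
  map_add' φ χ := by ext X; by_cases h : j ∈ X <;> simp [h]
  map_smul' c φ := by ext X; by_cases h : j ∈ X <;> simp [h]

/-- `σ_j^3`: `e_X ↦ e_X` if `j ∈ X`, and `e_X ↦ -e_X` if `j ∉ X`. -/
def sigmaThree (j : ℤ) : Module.End ℂ Amplitude where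
  toFun φ X := if j ∈ X then φ X else -φ X
  map_add' φ χ := by ext X; by_cases h : j ∈ X <;> simp [h, add_comm]
  map_smul' c φ := by ext X; by_cases h : j ∈ X <;> simp [h]

/-- The nearest-neighbour interaction
`h_{j,j+1} = σ_j^+ σ_{j+1}^- + σ_j^- σ_{j+1}^+ + (Δ/2) (σ_j^3 σ_{j+1}^3 - 1)`. -/
def bond (Δ : ℝ) (j : ℤ) : Module.End ℂ Amplitude :=
  sigmaPlus j * sigmaMinus (j + 1) + sigmaMinus j * sigmaPlus (j + 1)
    + ((Δ : ℂ) / 2) • (sigmaThree j * sigmaThree (j + 1) - 1)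

/-- Moving the up-spins along the transposition of the sites `j` and `j + 1`. -/
def flip (j : ℤ) : Finset ℤ ≃ Finset ℤ := (Equiv.swap j (j + 1)).finsetCongr

theorem mem_flip (j i : ℤ) (X : Finset ℤ) : i ∈ flip j X ↔ Equiv.swap j (j + 1) i ∈ X := by
  simp [flip, Finset.mem_map_equiv]

theorem card_flip (j : ℤ) (X : Finset ℤ) : (flip j X).card = X.card := by
  simp [flip]

theorem flip_eq_right (j : ℤ) (X : Finset ℤ) (h : j ∈ X) (h' : j + 1 ∉ X) :
    flip j X = insert (j + 1) (X.erase j) := by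
  ext i
  rw [mem_flip, Equiv.swap_apply_def]
  by_cases h1 : i = j
  · subst h1; simp [h']
  · by_cases h2 : i = j + 1
    · subst h2; simp [h]
    · simp [h1, h2]

theorem flip_eq_left (j : ℤ) (X : Finset ℤ) (h : j ∉ X) (h' : j + 1 ∈ X) :
    flip j X = (insert j X).erase (j + 1) := by
  ext i
  rw [mem_flip, Equiv.swap_apply_def]
  by_cases h1 : i = j
  · subst h1; simp [h']
  · by_cases h2 : i = j + 1
    · subst h2; simp [h]
    · simp [h1, h2]

/-- The bond `(j, j+1)` is active in `X` if its two spins differ. -/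
def Active (X : Finset ℤ) (j : ℤ) : Prop := ¬ (j ∈ X ↔ j + 1 ∈ X)

theorem bond_apply_of_not_active (Δ : ℝ) (j : ℤ) (φ : Amplitude) (X : Finset ℤ)
    (h : ¬ Active X j) : bond Δ j φ X = 0 := by
  by_cases h1 : j ∈ X <;> by_cases h2 : j + 1 ∈ X <;>
    simp_all [Active, bond, sigmaPlus, sigmaMinus, sigmaThree]

theorem bond_apply_of_active (Δ : ℝ) (j : ℤ) (φ : Amplitude) (X : Finset ℤ)
    (h : Active X j) : bond Δ j φ X = φ (flip j X) - Δ * φ X := by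
  by_cases h1 : j ∈ X <;> by_cases h2 : j + 1 ∈ X
  · simp_all [Active]
  · rw [flip_eq_right j X h1 h2]
    simp [bond, sigmaPlus, sigmaMinus, sigmaThree, h1, h2]
    ring
  · rw [flip_eq_left j X h1 h2]
    simp [bond, sigmaPlus, sigmaMinus, sigmaThree, h1, h2]
    ring
  · simp_all [Active]

/-- A finite set of bonds that contains all active ones. -/
def bonds (X : Finset ℤ) : Finset ℤ := X ∪ X.image (fun i => i - 1)

theorem mem_bonds_of_active (X : Finset ℤ) (j : ℤ) (h : Active X j) : j ∈ bonds X := by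
  by_cases h1 : j ∈ X
  · simp [bonds, h1]
  · have h2 : j + 1 ∈ X := by
      by_contra h2
      exact h (by simp [h1, h2])
    simp only [bonds, Finset.mem_union, Finset.mem_image]
    exact Or.inr ⟨j + 1, h2, by ring⟩

theorem card_bonds_le (X : Finset ℤ) : (bonds X).card ≤ 2 * X.card := by
  have h1 := Finset.card_union_le X (X.image (fun i => i - 1))
  have h2 := Finset.card_image_le (s := X) (f := fun i : ℤ => i - 1)
  unfold bonds
  omega

/-- `(H φ)(X) = ∑_j (h_{j,j+1} φ)(X)`; only finitely many terms do not vanish. -/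
def action (Δ : ℝ) (φ : Amplitude) : Amplitude := fun X => ∑ᶠ j : ℤ, bond Δ j φ X

theorem action_eq_sum (Δ : ℝ) (φ : Amplitude) (X : Finset ℤ) :
    action Δ φ X = ∑ j ∈ bonds X, bond Δ j φ X := by
  refine finsum_eq_sum_of_support_subset _ fun j hj => ?_
  by_contra h
  exact hj (bond_apply_of_not_active Δ j φ X fun ha => h (mem_bonds_of_active X j ha))

/-- The `N`-particle configurations `{x_1 < ⋯ < x_N}`. -/
abbrev Config (N : ℕ) : Type := {X : Finset ℤ // X.card = N}

/-- The position of the `j`-th particle from the left (`j` counted from `0`). -/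
def Config.pos {N : ℕ} (X : Config N) (j : Fin N) : ℤ := X.1.orderEmbOfFin X.2 j

/-- The `N`-particle Hilbert space `ℓ²` over the `N`-particle configurations. -/
abbrev Sector (N : ℕ) : Type := lp (fun _ : Config N => ℂ) 2

/-- The amplitude of a function on `N`-particle configurations, zero on all others. -/
def extend {N : ℕ} (ψ : Config N → ℂ) : Amplitude :=
  fun X => if h : X.card = N then ψ ⟨X, h⟩ else 0

theorem norm_action_sq_le (Δ : ℝ) (φ : Amplitude) (X : Finset ℤ) :
    ‖action Δ φ X‖ ^ 2 ≤ 2 * X.card *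
      ∑ j ∈ bonds X, (open Classical in if Active X j then
        2 * (‖φ (flip j X)‖ ^ 2 + Δ ^ 2 * ‖φ X‖ ^ 2) else 0) := by
  classical
  have h1 : ‖action Δ φ X‖ ≤ ∑ j ∈ bonds X, ‖bond Δ j φ X‖ := by
    rw [action_eq_sum]; exact norm_sum_le _ _
  have h2 : ‖action Δ φ X‖ ^ 2 ≤ (∑ j ∈ bonds X, ‖bond Δ j φ X‖) ^ 2 := by gcongr
  have h3 := sq_sum_le_card_mul_sum_sq (s := bonds X) (f := fun j => ‖bond Δ j φ X‖)
  have h4 : ((bonds X).card : ℝ) ≤ 2 * X.card := by exact_mod_cast card_bonds_le X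
  refine (h2.trans h3).trans ?_
  gcongr with j hj
  split_ifs with ha
  · rw [bond_apply_of_active Δ j φ X ha]
    have h5 : ‖φ (flip j X) - Δ * φ X‖ ≤ ‖φ (flip j X)‖ + |Δ| * ‖φ X‖ := by
      refine (norm_sub_le _ _).trans ?_
      simp
    have h6 : ‖φ (flip j X) - Δ * φ X‖ ^ 2 ≤ (‖φ (flip j X)‖ + |Δ| * ‖φ X‖) ^ 2 := by gcongr
    have h7 : |Δ| ^ 2 = Δ ^ 2 := sq_abs Δ
    nlinarith [sq_nonneg (‖φ (flip j X)‖ - |Δ| * ‖φ X‖)]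
  · rw [bond_apply_of_not_active Δ j φ X ha]; simp

theorem active_flip (X : Finset ℤ) (j : ℤ) : Active (flip j X) j ↔ Active X j := by
  simp only [Active, mem_flip, Equiv.swap_apply_left, Equiv.swap_apply_right]
  tauto

theorem tsum_active_le (N : ℕ) (g : Finset ℤ → ℝ≥0∞) (hg : ∀ X, X.card ≠ N → g X = 0) :
    ∑' X : Finset ℤ, ∑' j : ℤ, (open Classical in if Active X j then g X else 0)
      ≤ 2 * N * ∑' X, g X := by
  classical
  rw [← ENNReal.tsum_mul_left]
  refine ENNReal.tsum_le_tsum fun X => ?_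
  rw [tsum_eq_sum (s := bonds X)]
  · by_cases hX : X.card = N
    · calc ∑ j ∈ bonds X, (if Active X j then g X else 0)
          ≤ ∑ _j ∈ bonds X, g X := by
            refine Finset.sum_le_sum fun j _ => ?_
            split_ifs <;> simp
        _ = (bonds X).card * g X := by simp
        _ ≤ 2 * N * g X := by
            gcongr
            have := card_bonds_le X
            rw [hX] at this
            exact_mod_cast this
    · simp [hg X hX]
  · intro j hj
    rw [if_neg fun ha => hj (mem_bonds_of_active X j ha)]

theorem tsum_active_flip (g : Finset ℤ → ℝ≥0∞) :
    ∑' X : Finset ℤ, ∑' j : ℤ, (open Classical in if Active X j then g (flip j X) else 0)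
      = ∑' X : Finset ℤ, ∑' j : ℤ, (open Classical in if Active X j then g X else 0) := by
  classical
  rw [ENNReal.tsum_comm, ENNReal.tsum_comm (f := fun X j => if Active X j then g X else 0)]
  refine tsum_congr fun j => ?_
  rw [← (flip j).tsum_eq (fun X => if Active X j then g X else 0)]
  refine tsum_congr fun X => ?_
  simp only [active_flip]

theorem tsum_action_le (N : ℕ) (Δ : ℝ) (ψ : Config N → ℂ) :
    ∑' X : Config N, ENNReal.ofReal (‖action Δ (extend ψ) X.1‖ ^ 2)
      ≤ ENNReal.ofReal (8 * N ^ 2 * (1 + Δ ^ 2)) * ∑' X : Config N, ENNReal.ofReal (‖ψ X‖ ^ 2) := by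
  classical
  set g : Finset ℤ → ℝ≥0∞ := fun X => ENNReal.ofReal (‖extend ψ X‖ ^ 2) with hgdef
  have hg : ∀ X, X.card ≠ N → g X = 0 := by
    intro X hX
    simp [hgdef, extend, hX]
  have hsum : ∑' X, g X = ∑' X : Config N, ENNReal.ofReal (‖ψ X‖ ^ 2) := by
    have h1 : ∑' X : {X : Finset ℤ // X.card = N}, g X.1 = ∑' X, g X := by
      refine tsum_subtype_eq_of_support_subset (s := {X : Finset ℤ | X.card = N}) ?_
      intro X hX
      by_contra h
      exact hX (hg X h)
    rw [← h1]
    refine tsum_congr fun X => ?_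
    have : extend ψ X.1 = ψ X := by simp [extend, X.2]
    simp only [hgdef, this]
  have hpt : ∀ X : Config N, ENNReal.ofReal (‖action Δ (extend ψ) X.1‖ ^ 2) ≤
      4 * N * ∑' j : ℤ, ((if Active X.1 j then g (flip j X.1) else 0)
        + ENNReal.ofReal (Δ ^ 2) * (if Active X.1 j then g X.1 else 0)) := by
    intro X
    have h := norm_action_sq_le Δ (extend ψ) X.1
    have hc : X.1.card = N := X.2
    rw [hc] at h
    refine (ENNReal.ofReal_le_ofReal h).trans ?_
    have hle : ∑ j ∈ bonds X.1, ((if Active X.1 j then g (flip j X.1) else 0)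
        + ENNReal.ofReal (Δ ^ 2) * (if Active X.1 j then g X.1 else 0)) ≤
        ∑' j : ℤ, ((if Active X.1 j then g (flip j X.1) else 0)
        + ENNReal.ofReal (Δ ^ 2) * (if Active X.1 j then g X.1 else 0)) :=
      ENNReal.sum_le_tsum _
    refine le_trans (le_of_eq ?_) (mul_le_mul_right hle (4 * (N : ℝ≥0∞)))
    rw [ENNReal.ofReal_mul (by positivity), ENNReal.ofReal_sum_of_nonneg
      (fun j _ => by split_ifs <;> positivity), Finset.mul_sum, Finset.mul_sum]
    refine Finset.sum_congr rfl fun j _ => ?_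
    have h2N : ENNReal.ofReal (2 * (N : ℝ)) = 2 * N := by
      rw [ENNReal.ofReal_mul (by norm_num)]; simp
    rw [h2N]
    split_ifs
    · rw [ENNReal.ofReal_mul (by norm_num), ENNReal.ofReal_add (by positivity) (by positivity),
        ENNReal.ofReal_mul (p := Δ ^ 2) (by positivity)]
      simp only [hgdef, ENNReal.ofReal_ofNat]
      ring
    · simp
  calc ∑' X : Config N, ENNReal.ofReal (‖action Δ (extend ψ) X.1‖ ^ 2)
      ≤ ∑' X : Config N, 4 * N * ∑' j : ℤ, ((if Active X.1 j then g (flip j X.1) else 0)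
        + ENNReal.ofReal (Δ ^ 2) * (if Active X.1 j then g X.1 else 0)) :=
        ENNReal.tsum_le_tsum hpt
    _ ≤ ∑' X : Finset ℤ, 4 * N * ∑' j : ℤ, ((if Active X j then g (flip j X) else 0)
        + ENNReal.ofReal (Δ ^ 2) * (if Active X j then g X else 0)) :=
        ENNReal.tsum_comp_le_tsum_of_injective
          (f := (Subtype.val : {X : Finset ℤ // X.card = N} → Finset ℤ)) Subtype.val_injective
          (fun X : Finset ℤ => 4 * N * ∑' j : ℤ, ((if Active X j then g (flip j X) else 0)
            + ENNReal.ofReal (Δ ^ 2) * (if Active X j then g X else 0)))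
    _ = 4 * N * ((1 + ENNReal.ofReal (Δ ^ 2)) *
          ∑' X : Finset ℤ, ∑' j : ℤ, (if Active X j then g X else 0)) := by
        rw [ENNReal.tsum_mul_left]
        simp only [ENNReal.tsum_add, ENNReal.tsum_mul_left]
        rw [tsum_active_flip g, add_mul, one_mul]
    _ ≤ 4 * N * ((1 + ENNReal.ofReal (Δ ^ 2)) * (2 * N * ∑' X, g X)) := by
        gcongr
        exact tsum_active_le N g hg
    _ = ENNReal.ofReal (8 * N ^ 2 * (1 + Δ ^ 2)) *
          ∑' X : Config N, ENNReal.ofReal (‖ψ X‖ ^ 2) := by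
        rw [hsum, ENNReal.ofReal_mul (by positivity), ENNReal.ofReal_mul (by norm_num),
          ENNReal.ofReal_add (by norm_num) (by positivity),
          ENNReal.ofReal_pow (p := (N : ℝ)) (by positivity)]
        simp only [ENNReal.ofReal_natCast, ENNReal.ofReal_ofNat, ENNReal.ofReal_one]
        ring

theorem sum_action_le (N : ℕ) (Δ : ℝ) (ψ : Sector N) (s : Finset (Config N)) :
    ∑ X ∈ s, ‖action Δ (extend ψ) X.1‖ ^ 2 ≤ 8 * N ^ 2 * (1 + Δ ^ 2) * ‖ψ‖ ^ 2 := by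
  have hψ : HasSum (fun X : Config N => ‖ψ X‖ ^ 2) (‖ψ‖ ^ 2) := by
    have := lp.hasSum_norm (p := 2) (by norm_num) ψ
    simpa using this
  have h1 : ∑' X : Config N, ENNReal.ofReal (‖ψ X‖ ^ 2) = ENNReal.ofReal (‖ψ‖ ^ 2) := by
    rw [← hψ.tsum_eq, ENNReal.ofReal_tsum_of_nonneg (fun X => by positivity) hψ.summable]
  have h2 := tsum_action_le N Δ ψ
  rw [h1, ← ENNReal.ofReal_mul (by positivity)] at h2
  have h3 : ENNReal.ofReal (∑ X ∈ s, ‖action Δ (extend ψ) X.1‖ ^ 2) ≤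
      ENNReal.ofReal (8 * N ^ 2 * (1 + Δ ^ 2) * ‖ψ‖ ^ 2) := by
    rw [ENNReal.ofReal_sum_of_nonneg (fun X _ => by positivity)]
    exact (ENNReal.sum_le_tsum s).trans h2
  exact (ENNReal.ofReal_le_ofReal_iff (by positivity)).1 h3

theorem memlp_action (N : ℕ) (Δ : ℝ) (ψ : Sector N) :
    Memℓp (fun X : Config N => action Δ (extend ψ) X.1) 2 := by
  refine memℓp_gen' (C := 8 * N ^ 2 * (1 + Δ ^ 2) * ‖ψ‖ ^ 2) fun s => ?_
  simpa using sum_action_le N Δ ψ s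

theorem extend_add {N : ℕ} (ψ χ : Config N → ℂ) : extend (ψ + χ) = extend ψ + extend χ := by
  ext X; by_cases h : X.card = N
  · simp only [extend, h, dif_pos, Pi.add_apply]
  · simp [extend, h]

theorem extend_smul {N : ℕ} (c : ℂ) (ψ : Config N → ℂ) : extend (c • ψ) = c • extend ψ := by
  ext X; by_cases h : X.card = N
  · simp only [extend, h, dif_pos, Pi.smul_apply]
  · simp [extend, h]

theorem action_add (Δ : ℝ) (φ χ : Amplitude) : action Δ (φ + χ) = action Δ φ + action Δ χ := by
  ext X; simp [action_eq_sum, Finset.sum_add_distrib]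

theorem action_smul (Δ : ℝ) (c : ℂ) (φ : Amplitude) : action Δ (c • φ) = c • action Δ φ := by
  ext X; simp [action_eq_sum, Finset.mul_sum]

/-- The Hamiltonian `H_XXZ = ∑_j h_{j,j+1}` on the `N`-particle Hilbert space. -/
def hamiltonian (N : ℕ) (Δ : ℝ) : Sector N →L[ℂ] Sector N :=
  LinearMap.mkContinuous
    { toFun := fun ψ => ⟨fun X : Config N => action Δ (extend ψ) X.1, memlp_action N Δ ψ⟩
      map_add' := fun ψ χ => by
        ext X
        change action Δ (extend (⇑ψ + ⇑χ)) X.1 = action Δ (extend ψ) X.1 + action Δ (extend χ) X.1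
        rw [extend_add, action_add, Pi.add_apply]
      map_smul' := fun c ψ => by
        ext X
        change action Δ (extend (c • ⇑ψ)) X.1 = c • action Δ (extend ψ) X.1
        rw [extend_smul, action_smul, Pi.smul_apply] }
    (Real.sqrt (8 * N ^ 2 * (1 + Δ ^ 2))) (fun ψ => by
      refine lp.norm_le_of_forall_sum_le (by norm_num) (by positivity) fun s => ?_
      have h := sum_action_le N Δ ψ s
      have h2 : (Real.sqrt (8 * N ^ 2 * (1 + Δ ^ 2)) * ‖ψ‖) ^ 2
          = 8 * N ^ 2 * (1 + Δ ^ 2) * ‖ψ‖ ^ 2 := by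
        rw [mul_pow, Real.sq_sqrt (by positivity)]
      rw [← h2] at h
      simpa using h)

/-! ### The evolution and the left-most particle -/

/-- The state `Ψ_N(t) = exp(-i t H_XXZ) e_Y`. -/
def state {N : ℕ} (Δ : ℝ) (Y : Config N) (t : ℝ) : Sector N :=
  NormedSpace.exp ((-(Complex.I * (t : ℂ))) • hamiltonian N Δ) (lp.single 2 Y (1 : ℂ))

/-- The probability that, at time `t`, the `m`-th particle from the left is at `n`:
the sum of `|ψ_N(X;t)|²` over the configurations `X` with `x_m = n` (summable, as the state is
in `ℓ²`). -/
def probAt {N : ℕ} (Δ : ℝ) (Y : Config N) (m : Fin N) (n : ℤ) (t : ℝ) : ℝ :=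
  ∑' X : {X : Config N // X.pos m = n}, ‖state Δ Y t X.1‖ ^ 2

/-- `P_Y(X_1(t) ≥ x)`, the sum over `n ≥ x` of the probabilities that the left-most particle
is at `n`. -/
def probFirstGE {N : ℕ} (hN : 0 < N) (Δ : ℝ) (Y : Config N) (x : ℤ) (t : ℝ) : ℝ :=
  ∑' n : {n : ℤ // x ≤ n}, probAt Δ Y ⟨0, hN⟩ n.1 t

/-! ### The integrands -/

/-- `ε(ξ) = ξ + 1/ξ - 2Δ`. -/
def energy (Δ : ℝ) (ξ : ℂ) : ℂ := ξ + ξ⁻¹ - 2 * Δ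

/-- `∏_{j<k} (1 + ξ_j ξ_k - 2Δ ξ_j)`. -/
def betheDenom {N : ℕ} (Δ : ℝ) (ξ : Fin N → ℂ) : ℂ :=
  ∏ j : Fin N, ∏ k ∈ Finset.Ioi j, (1 + ξ j * ξ k - 2 * Δ * ξ j)

/-- `∏_{j,k} (ξ_j + ζ_k - 2Δ ξ_j ζ_k)`. -/
def mixedProd {N : ℕ} (Δ : ℝ) (ξ ζ : Fin N → ℂ) : ℂ :=
  ∏ j : Fin N, ∏ k : Fin N, (ξ j + ζ k - 2 * Δ * ξ j * ζ k)

/-- `∏_{j,k} (1 - ξ_j ζ_k)`. -/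
def cauchyDenom {N : ℕ} (ξ ζ : Fin N → ℂ) : ℂ :=
  ∏ j : Fin N, ∏ k : Fin N, (1 - ξ j * ζ k)

/-- The Vandermonde product `∏_{j<k} (ξ_k - ξ_j)`. -/
def vandermonde {N : ℕ} (ξ : Fin N → ℂ) : ℂ :=
  ∏ j : Fin N, ∏ k ∈ Finset.Ioi j, (ξ k - ξ j)

/-- `D_N(ξ,ζ) = det (1 / ((1 - ξ_i ζ_j)(ξ_i + ζ_j - 2Δ ξ_i ζ_j)))`. -/
def detD {N : ℕ} (Δ : ℝ) (ξ ζ : Fin N → ℂ) : ℂ :=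
  Matrix.det (Matrix.of fun i j : Fin N =>
    1 / ((1 - ξ i * ζ j) * (ξ i + ζ j - 2 * Δ * ξ i * ζ j)))

/-- `∏_j (ξ_j ζ_j)^{x - y_j - 1} exp(-i t (ε(ξ_j) - ε(ζ_j)))`. -/
def timeFactor {N : ℕ} (Δ : ℝ) (Y : Config N) (x : ℤ) (t : ℝ) (ξ ζ : Fin N → ℂ) : ℂ :=
  ∏ j : Fin N, (ξ j * ζ j) ^ (x - Y.pos j - 1) *
    Complex.exp (-(Complex.I * (t : ℂ) * (energy Δ (ξ j) - energy Δ (ζ j))))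

/-- The integrand with the determinant `D_N`. -/
def integrandD {N : ℕ} (Δ : ℝ) (Y : Config N) (x : ℤ) (t : ℝ) (ξ ζ : Fin N → ℂ) : ℂ :=
  mixedProd Δ ξ ζ / (betheDenom Δ ξ * betheDenom Δ ζ) * detD Δ ξ ζ * timeFactor Δ Y x t ξ ζ

/-- The value `Q(ξ,ζ)` of a polynomial in the `2N` variables `ξ_1,…,ξ_N` (left summand) and
`ζ_1,…,ζ_N` (right summand). -/
def evalQ {N : ℕ} (Q : MvPolynomial (Fin N ⊕ Fin N) ℂ) (ξ ζ : Fin N → ℂ) : ℂ :=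
  MvPolynomial.eval (Sum.elim ξ ζ) Q

/-- The integrand with the polynomial `Q_N`. -/
def integrandQ {N : ℕ} (Δ : ℝ) (Q : MvPolynomial (Fin N ⊕ Fin N) ℂ) (Y : Config N) (x : ℤ) (t : ℝ)
    (ξ ζ : Fin N → ℂ) : ℂ :=
  vandermonde ξ * vandermonde ζ / (betheDenom Δ ξ * betheDenom Δ ζ) *
    (evalQ Q ξ ζ / cauchyDenom ξ ζ) * timeFactor Δ Y x t ξ ζ

/-- `Q` is the polynomial `Q_N`: it satisfies, wherever no denominator vanishes,
`∏_{j,k} (ξ_j + ζ_k - 2Δ ξ_j ζ_k) D_N(ξ,ζ) = Δ_N(ξ) Δ_N(ζ) / ∏_{j,k} (1 - ξ_j ζ_k) Q(ξ,ζ)`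
(which determines it), has degree `N - 1` in each variable, and is separately symmetric in the
`ξ_j` and in the `ζ_j`. -/
structure IsQ {N : ℕ} (Δ : ℝ) (Q : MvPolynomial (Fin N ⊕ Fin N) ℂ) : Prop where
  identity : ∀ ξ ζ : Fin N → ℂ, (∀ j k, 1 - ξ j * ζ k ≠ 0) →
    (∀ j k, ξ j + ζ k - 2 * Δ * ξ j * ζ k ≠ 0) →
    mixedProd Δ ξ ζ * detD Δ ξ ζ = vandermonde ξ * vandermonde ζ / cauchyDenom ξ ζ * evalQ Q ξ ζ
  degree : ∀ v : Fin N ⊕ Fin N, Q.degreeOf v = N - 1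
  symmetric : ∀ σ μ : Equiv.Perm (Fin N), MvPolynomial.rename (Equiv.sumCongr σ μ) Q = Q

/-! ### The contours -/

/-- The circle of radius `r` is so small that the zero loci of the factors
`1 + ζ_j ζ_k - 2Δ ζ_j`, `j < k`, lie outside it. -/
def SmallRadius (N : ℕ) (Δ : ℝ) (r : ℝ) : Prop :=
  0 < r ∧ ∀ ζ : Fin N → ℂ, (∀ j, ‖ζ j‖ ≤ r) → ∀ j k, j < k → 1 + ζ j * ζ k - 2 * Δ * ζ j ≠ 0

/-- The circle of radius `R` is so large that the zero loci of the factors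
`1 + ξ_j ξ_k - 2Δ ξ_j`, `j < k`, lie inside it. -/
def LargeRadius (N : ℕ) (Δ : ℝ) (R : ℝ) : Prop :=
  0 < R ∧ ∀ ξ : Fin N → ℂ, (∀ j, R ≤ ‖ξ j‖) → ∀ j k, j < k → 1 + ξ j * ξ k - 2 * Δ * ξ j ≠ 0

/-- The radii of the `2N` circles: `R` for `ξ_1,…,ξ_N` and `r` for `ζ_1,…,ζ_N`. -/
def radii (N : ℕ) (R r : ℝ) : Fin (N + N) → ℝ := Fin.append (fun _ => R) (fun _ => r)

/-- A function of `(ξ,ζ)` as a function of `2N` variables. -/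
def joint {N : ℕ} (f : (Fin N → ℂ) → (Fin N → ℂ) → ℂ) (z : Fin (N + N) → ℂ) : ℂ :=
  f (fun j => z (Fin.castAdd N j)) (fun j => z (Fin.natAdd N j))

/-- `f` is integrable over the product of the `2N` circles. -/
def ContourIntegrable {N : ℕ} (R r : ℝ) (f : (Fin N → ℂ) → (Fin N → ℂ) → ℂ) : Prop :=
  TorusIntegrable (joint f) 0 (radii N R r)

/-- The `2N`-fold integral of `f` over `|ξ_j| = R`, `|ζ_j| = r`, where each differential
carries the factor `1/(2πi)`. -/
def contourIntegral {N : ℕ} (R r : ℝ) (f : (Fin N → ℂ) → (Fin N → ℂ) → ℂ) : ℂ :=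
  ((2 * (Real.pi : ℂ) * Complex.I) ^ (2 * N))⁻¹ * torusIntegral (joint f) 0 (radii N R r)

end XXZ

end

/-! The amplitude `ψ_N(X;t)` is a torus mean of Bethe wave functions. As a function of the
positions, `bethe` is an eigenfunction of the Hamiltonian with eigenvalue `∑ ε(ξ_j)`: each particle
hops freely (`bethe_free`), and the coefficients of the permutations are such that the corrections
from neighbouring up-spins cancel (`bethe_contact`). The mean of `waveWeight` over the torus is the
Kronecker delta of `X` and `Y`. Hence the coordinates of `H^n e_Y`, and by the exponential series
those of `exp(-itH) e_Y`, are torus means (`OrthoRadius.state_eq`).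

The orthogonality is proved on small circles of distinct radii by induction on the number of
particles (`integral_waveWeight_of_injective`). The last variable is integrated by residues. The
residue at infinity reproduces the problem with one particle fewer. The other residues, as functions
of one remaining variable, have mean zero, because their only poles in the disc are cancelled by the
antisymmetry of `bethe`. Cauchy's theorem then makes the radii equal, and inverting all variables
while reversing their order exchanges small and large circles.

The Hamiltonian is real, so conjugation reverses time and `|ψ(t)|² = ψ(t) ψ(-t)`. With the first
factor on the circles of radius `R` and the second on those of radius `r`, the condition `R r < 1`
makes the sum over configurations converge absolutely, and `hasSum_bethe_mul_bethe` evaluates it in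
closed form. If `S_m` denotes the sum over configurations at or to the right of `m`, and `p = ∏ ξ_j
ζ_j`, then `S_{m+1} = p S_m`, while `S_m - S_{m+1}` has its first particle fixed at `m` and reduces
by induction to minors of the matrix of `D_N`. The determinant identity needed there,
`sum_minor_mixedProd_mul_detD`, comes from partial fractions.

For `Q_N`, the numerator of `D_N` over the common denominator is antisymmetric in each group of
variables, hence divisible by both Vandermonde products; `Q_N` is the quotient. The integrand with
`D_N` is problematic only where some `ξ_j + ζ_k - 2Δ ξ_j ζ_k` vanishes. This is a null set of the
torus, and off it the integrand equals the continuous one with `Q_N`. -/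

noncomputable section

namespace XXZ

open MeasureTheory

/-! ### Permutations of `Fin (n + 1)` with one prescribed value -/

/-- The permutation that sends `p` to `q` and acts as `σ` between the complements. -/
def insertPerm {n : ℕ} (p q : Fin (n + 1)) (σ : Equiv.Perm (Fin n)) : Equiv.Perm (Fin (n + 1)) :=
  q.cycleRange⁻¹ * Equiv.Perm.decomposeFin.symm (0, σ) * p.cycleRange

theorem insertPerm_apply_self {n : ℕ} (p q : Fin (n + 1)) (σ : Equiv.Perm (Fin n)) :
    insertPerm p q σ p = q := by
  rw [insertPerm, Equiv.Perm.mul_apply, Equiv.Perm.mul_apply, Equiv.Perm.inv_eq_iff_eq]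
  simp

theorem insertPerm_apply_succAbove {n : ℕ} (p q : Fin (n + 1)) (σ : Equiv.Perm (Fin n))
    (j : Fin n) : insertPerm p q σ (p.succAbove j) = q.succAbove (σ j) := by
  rw [insertPerm, Equiv.Perm.mul_apply, Equiv.Perm.mul_apply, Equiv.Perm.inv_eq_iff_eq]
  simp

theorem sign_insertPerm {n : ℕ} (p q : Fin (n + 1)) (σ : Equiv.Perm (Fin n)) :
    Equiv.Perm.sign (insertPerm p q σ) = (-1) ^ (p + q : ℕ) * Equiv.Perm.sign σ := by
  rw [insertPerm, Equiv.Perm.sign_mul, Equiv.Perm.sign_mul, Equiv.Perm.sign_inv,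
    Fin.sign_cycleRange, Fin.sign_cycleRange, Equiv.Perm.decomposeFin.symm_sign, pow_add]
  simp only [if_true, one_mul]
  rw [mul_comm, ← mul_assoc]

/-- The preimage of `q` recovers `p`, and the action between the complements recovers `σ`;
surjectivity is the count `(n + 1) · n! = (n + 1)!`. -/
theorem insertPerm_bijective_left {n : ℕ} (q : Fin (n + 1)) :
    Function.Bijective fun x : Fin (n + 1) × Equiv.Perm (Fin n) => insertPerm x.1 q x.2 := by
  rw [Fintype.bijective_iff_injective_and_card]
  constructor
  · rintro ⟨p, σ⟩ ⟨p', σ'⟩ h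
    dsimp only at h
    have hp : p = p' := by
      have h1 := insertPerm_apply_self p q σ
      rw [h] at h1
      exact (insertPerm p' q σ').injective (h1.trans (insertPerm_apply_self p' q σ').symm)
    subst hp
    have hσ : σ = σ' := by
      ext1 j
      have h1 := insertPerm_apply_succAbove p q σ j
      rw [h, insertPerm_apply_succAbove] at h1
      exact (Fin.succAbove_right_injective h1).symm
    rw [hσ]
  · simp [Fintype.card_perm, Nat.factorial_succ]

theorem insertPerm_bijective_right {n : ℕ} (p : Fin (n + 1)) :
    Function.Bijective fun x : Fin (n + 1) × Equiv.Perm (Fin n) => insertPerm p x.1 x.2 := by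
  rw [Fintype.bijective_iff_injective_and_card]
  constructor
  · rintro ⟨q, σ⟩ ⟨q', σ'⟩ h
    dsimp only at h
    have hq : q = q' := by
      have h1 := insertPerm_apply_self p q σ
      rwa [h, insertPerm_apply_self, eq_comm] at h1
    subst hq
    have hσ : σ = σ' := by
      ext1 j
      have h1 := insertPerm_apply_succAbove p q σ j
      rw [h, insertPerm_apply_succAbove] at h1
      exact (Fin.succAbove_right_injective h1).symm
    rw [hσ]
  · simp [Fintype.card_perm, Nat.factorial_succ]

theorem sum_perm_eq_sum_insertPerm_left {n : ℕ} {M : Type*} [AddCommMonoid M] (q : Fin (n + 1))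
    (f : Equiv.Perm (Fin (n + 1)) → M) :
    ∑ σ, f σ = ∑ p, ∑ σ, f (insertPerm p q σ) := by
  rw [← Fintype.sum_prod_type']
  exact ((insertPerm_bijective_left q).sum_comp f).symm

theorem sum_perm_eq_sum_insertPerm_right {n : ℕ} {M : Type*} [AddCommMonoid M] (p : Fin (n + 1))
    (f : Equiv.Perm (Fin (n + 1)) → M) :
    ∑ σ, f σ = ∑ q, ∑ σ, f (insertPerm p q σ) := by
  rw [← Fintype.sum_prod_type']
  exact ((insertPerm_bijective_right p).sum_comp f).symm

/-! ### Products over pairs -/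

theorem prod_Ioi_eq_prod_ite {n : ℕ} {M : Type*} [CommMonoid M] (f : Fin n → Fin n → M) :
    ∏ i, ∏ j ∈ Finset.Ioi i, f i j = ∏ i, ∏ j, if i < j then f i j else 1 := by
  refine Finset.prod_congr rfl fun i _ => ?_
  rw [← Finset.prod_filter]
  congr 1
  ext j
  simp

/-- The pairs are split according to whether they contain `p`; in a pair that does, the side on
which the other index lies decides the order of the arguments. -/
theorem prod_Ioi_succAbove {n : ℕ} {M : Type*} [CommMonoid M] (p : Fin (n + 1))
    (f : Fin (n + 1) → Fin (n + 1) → M) :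
    ∏ i, ∏ j ∈ Finset.Ioi i, f i j =
      (∏ i, ∏ j ∈ Finset.Ioi i, f (p.succAbove i) (p.succAbove j)) *
        ∏ j, if j.castSucc < p then f (p.succAbove j) p else f p (p.succAbove j) := by
  simp only [prod_Ioi_eq_prod_ite]
  rw [Fin.prod_univ_succAbove _ p, Fin.prod_univ_succAbove _ p]
  simp only [lt_self_iff_false, if_false, one_mul]
  simp_rw [Fin.prod_univ_succAbove (fun j => if p.succAbove _ < j then _ else _) p]
  rw [Finset.prod_mul_distrib, mul_comm, mul_assoc, mul_comm, mul_assoc,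
    ← Finset.prod_mul_distrib]
  congr 1
  · simp only [Fin.succAbove_lt_succAbove_iff]
  · refine Finset.prod_congr rfl fun j _ => ?_
    by_cases h : j.castSucc < p
    · have h2 : p.succAbove j < p := by rwa [Fin.succAbove_lt_iff_castSucc_lt]
      simp [h, h2, h2.not_gt]
    · have h2 : p < p.succAbove j := by
        rw [Fin.lt_succAbove_iff_le_castSucc]; exact not_lt.1 h
      simp [h, h2, h2.not_gt]

/-! ### The Bethe wave function -/

/-- The two-body factor `1 + a b - 2Δ a`. -/
def scat (Δ : ℝ) (a b : ℂ) : ℂ := 1 + a * b - 2 * Δ * a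

theorem betheDenom_eq {n : ℕ} (Δ : ℝ) (ξ : Fin n → ℂ) :
    betheDenom Δ ξ = ∏ j, ∏ k ∈ Finset.Ioi j, scat Δ (ξ j) (ξ k) := rfl

theorem betheDenom_succAbove {n : ℕ} (Δ : ℝ) (p : Fin (n + 1)) (ξ : Fin (n + 1) → ℂ) :
    betheDenom Δ ξ = betheDenom Δ (fun j => ξ (p.succAbove j)) *
      ∏ j, if j.castSucc < p then scat Δ (ξ (p.succAbove j)) (ξ p)
        else scat Δ (ξ p) (ξ (p.succAbove j)) := by
  rw [betheDenom_eq, prod_Ioi_succAbove p, betheDenom_eq]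

/-- The Bethe wave function
`∑_σ sgn(σ) ∏_{i<j} (1 + ξ_{σ(i)} ξ_{σ(j)} - 2Δ ξ_{σ(i)}) ∏_j ξ_{σ(j)}^{x_j}`. -/
def bethe {n : ℕ} (Δ : ℝ) (x : Fin n → ℤ) (ξ : Fin n → ℂ) : ℂ :=
  ∑ σ : Equiv.Perm (Fin n), ((Equiv.Perm.sign σ : ℤ) : ℂ) * betheDenom Δ (fun j => ξ (σ j)) *
    ∏ j, ξ (σ j) ^ x j

theorem bethe_comp_perm {n : ℕ} (Δ : ℝ) (x : Fin n → ℤ) (ξ : Fin n → ℂ)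
    (τ : Equiv.Perm (Fin n)) :
    bethe Δ x (fun j => ξ (τ j)) = ((Equiv.Perm.sign τ : ℤ) : ℂ) * bethe Δ x ξ := by
  rw [bethe, bethe, Finset.mul_sum]
  refine Fintype.sum_equiv (Equiv.mulLeft τ) _ _ fun σ => ?_
  simp only [Equiv.coe_mulLeft, Equiv.Perm.mul_apply, Equiv.Perm.sign_mul, Units.val_mul,
    Int.cast_mul]
  have h : ((Equiv.Perm.sign τ : ℤ) : ℂ) * ((Equiv.Perm.sign τ : ℤ) : ℂ) = 1 := by
    rcases Int.units_eq_one_or (Equiv.Perm.sign τ) with h | h <;> simp [h]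
  linear_combination (-((Equiv.Perm.sign σ : ℤ) : ℂ) * betheDenom Δ (fun j => ξ (τ (σ j))) *
    ∏ j, ξ (τ (σ j)) ^ x j) * h

/-- A consequence of antisymmetry. This zero later cancels the apparent poles at coinciding
variables. -/
theorem bethe_eq_zero_of_eq {n : ℕ} (Δ : ℝ) (x : Fin n → ℤ) (ξ : Fin n → ℂ) {i j : Fin n}
    (hij : i ≠ j) (h : ξ i = ξ j) : bethe Δ x ξ = 0 := by
  have h1 := bethe_comp_perm Δ x ξ (Equiv.swap i j)
  have h2 : (fun k => ξ (Equiv.swap i j k)) = ξ := by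
    ext k
    rw [Equiv.swap_apply_def]
    split_ifs with h3 h4
    · rw [h3, h]
    · rw [h4, h]
    · rfl
  rw [h2, Equiv.Perm.sign_swap hij] at h1
  simp only [Units.val_neg, Units.val_one, Int.cast_neg, Int.cast_one, neg_mul, one_mul] at h1
  exact self_eq_neg.1 h1

/-- Expansion of the Bethe wave function along the first particle. -/
theorem bethe_succ {n : ℕ} (Δ : ℝ) (x : Fin (n + 1) → ℤ) (ξ : Fin (n + 1) → ℂ) :
    bethe Δ x ξ = ∑ a : Fin (n + 1), (-1) ^ (a : ℕ) *
      (∏ j, scat Δ (ξ a) (ξ (a.succAbove j))) * ξ a ^ x 0 *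
        bethe Δ (fun j => x j.succ) (fun j => ξ (a.succAbove j)) := by
  rw [bethe, sum_perm_eq_sum_insertPerm_right 0]
  refine Finset.sum_congr rfl fun a _ => ?_
  rw [bethe, Finset.mul_sum]
  refine Finset.sum_congr rfl fun σ _ => ?_
  have h := fun j : Fin n => insertPerm_apply_succAbove 0 a σ j
  simp only [Fin.zero_succAbove] at h
  rw [betheDenom_succAbove Δ 0, Fin.prod_univ_succ, sign_insertPerm]
  simp only [Fin.not_lt_zero, if_false, Fin.zero_succAbove, h, insertPerm_apply_self]
  rw [Equiv.prod_comp σ (fun j => scat Δ (ξ a) (ξ (a.succAbove j)))]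
  push_cast
  simp only [Fin.val_zero, zero_add]
  ring

/-! ### A recursion for the determinant -/

/-- Partial fractions at simple poles `w j`. -/
theorem exists_partialFraction {m : ℕ} (w : Fin m → ℂ) (hw : Function.Injective w) :
    ∃ c : Fin m → ℂ, ∀ p : Polynomial ℂ, p.degree < m → ∀ z, (∀ j, w j ≠ z) →
      p.eval z / ∏ j, (w j - z) = ∑ j, c j * p.eval (w j) / (w j - z) := by
  -- The nodal weights are the residues of `1 / ∏ (z - w_j)`. Writing the factors as `w_j - z` costs
  -- `(-1)^m` for the product and one more sign for the single factor on the right.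
  refine ⟨fun j => -(-1) ^ m * Lagrange.nodalWeight Finset.univ w j, fun p hp z hz => ?_⟩
  have h1 : p = Lagrange.interpolate Finset.univ w fun j => p.eval (w j) :=
    Lagrange.eq_interpolate hw.injOn (by simpa using hp)
  have h2 : p.eval z = _ := (congrArg (Polynomial.eval z) h1).trans
    (Lagrange.eval_interpolate_not_at_node _ fun j _ => (hz j).symm)
  have h3 : ∏ j, (w j - z) = (-1) ^ m * ∏ j, (z - w j) := by
    rw [← Fin.prod_const, ← Finset.prod_mul_distrib]
    exact Finset.prod_congr rfl fun j _ => by ring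
  have h4 : ∏ j, (z - w j) ≠ 0 :=
    Finset.prod_ne_zero_iff.2 fun j _ => sub_ne_zero.2 (hz j).symm
  have h5 : ((-1 : ℂ) ^ m) * (-1) ^ m = 1 := by rw [← mul_pow]; simp
  have h6 : ((-1 : ℂ) ^ m) ≠ 0 := by simp
  rw [h2, h3, Lagrange.eval_nodal, div_eq_iff (mul_ne_zero h6 h4), mul_comm, Finset.sum_mul,
    Finset.sum_mul]
  refine Finset.sum_congr rfl fun j _ => ?_
  have h7 : w j - z ≠ 0 := sub_ne_zero.2 (hz j)
  have h8 : z - w j ≠ 0 := sub_ne_zero.2 (hz j).symm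
  have h9 : (w j - z)⁻¹ = -(z - w j)⁻¹ := by rw [← neg_sub, inv_neg]
  rw [div_eq_mul_inv, h9]
  linear_combination (-Lagrange.nodalWeight Finset.univ w j * (z - w j)⁻¹ *
    Polynomial.eval (w j) p * ∏ j, (z - w j)) * h5

/-- The entries of the matrix of `detD`. -/
def kern (Δ : ℝ) (a b : ℂ) : ℂ := 1 / ((1 - a * b) * (a + b - 2 * Δ * a * b))

theorem kern_comm (Δ : ℝ) (a b : ℂ) : kern Δ a b = kern Δ b a := by
  unfold kern; congr 1; ring

theorem detD_eq {n : ℕ} (Δ : ℝ) (ξ ζ : Fin n → ℂ) :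
    detD Δ ξ ζ = (Matrix.of fun i j => kern Δ (ξ i) (ζ j)).det := rfl

/-- The vector that is paired with the inverse of the matrix of `detD`. -/
def dualVec {m : ℕ} (Δ : ℝ) (ξ ζ : Fin m → ℂ) (b : Fin m) : ℂ :=
  (∏ k ∈ Finset.univ.erase b, scat Δ (ζ b) (ζ k) * ζ k) /
    ∏ j, (ξ j + ζ b - 2 * Δ * ξ j * ζ b)

/-- All three identities come from one rational function, `φ(z) = ∏ (ζ_k - z) / ∏ (ξ_j⁻¹ - z) = 1 +
∑ r_j / (ξ_j⁻¹ - z)`. The value at `0` is the last identity. The point `2Δ - ζ_b⁻¹` is the value of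
`ξ_j⁻¹` at which `ξ_j + ζ_b - 2Δ ξ_j ζ_b` vanishes; evaluation there, with the factor of `ζ_b`
removed, yields combinations of the rows of the matrix of `detD`. The middle identity uses `φ(ζ_b) =
0` in addition. -/
theorem exists_dualVec_eq {m : ℕ} (Δ : ℝ) (ξ ζ : Fin m → ℂ) (hξ : Function.Injective ξ)
    (hξ0 : ∀ j, ξ j ≠ 0) (hζ0 : ∀ j, ζ j ≠ 0)
    (ha : ∀ j k, 1 - ξ j * ζ k ≠ 0) (hb : ∀ j k, ξ j + ζ k - 2 * Δ * ξ j * ζ k ≠ 0) :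
    ∃ r : Fin m → ℂ,
      (∀ b, dualVec Δ ξ ζ b * ζ b =
        -((∏ k, ζ k) / ∏ j, ξ j) * ∑ j, r j * ξ j ^ 2 * kern Δ (ξ j) (ζ b)) ∧
      (∀ b, dualVec Δ ξ ζ b * (1 - 2 * Δ * ζ b) =
        ((∏ k, ζ k) / ∏ j, ξ j) * ((ζ b)⁻¹ + ∑ j, r j * ξ j * kern Δ (ξ j) (ζ b))) ∧
      (∏ j, ξ j) * ∏ k, ζ k = 1 + ∑ j, r j * ξ j := by
  obtain ⟨c, hc⟩ := exists_partialFraction (fun j => (ξ j)⁻¹) (inv_injective.comp hξ)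
  have hP : ∏ j, ξ j ≠ 0 := Finset.prod_ne_zero_iff.2 fun j _ => hξ0 j
  set r : Fin m → ℂ := fun j => c j * ∏ k, (ζ k - (ξ j)⁻¹) with hr
  have hwz : ∀ j b, (ξ j)⁻¹ - ζ b ≠ 0 := fun j b h => ha j b (by
    have := hξ0 j
    field_simp at h
    linear_combination h)
  have hφ : ∀ z, (∀ j, (ξ j)⁻¹ ≠ z) →
      (∏ k, (ζ k - z)) / ∏ j, ((ξ j)⁻¹ - z) = 1 + ∑ j, r j / ((ξ j)⁻¹ - z) := by
    intro z hz
    have hz0 : ∏ j, ((ξ j)⁻¹ - z) ≠ 0 := Finset.prod_ne_zero_iff.2 fun j _ => sub_ne_zero.2 (hz j)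
    -- Numerator and denominator have the same degree and the same leading coefficient `(-1)^m`, so
    -- subtracting `1` makes the fraction proper.
    have hdeg : (∏ k, (Polynomial.C (ζ k) - Polynomial.X) -
        ∏ j, (Polynomial.C (ξ j)⁻¹ - Polynomial.X)).degree < (m : WithBot ℕ) := by
      have hd : ∀ f : Fin m → ℂ, (∏ k, (Polynomial.C (f k) - Polynomial.X)).degree = (m : WithBot ℕ) ∧
          (∏ k, (Polynomial.C (f k) - Polynomial.X)).leadingCoeff = (-1) ^ m := by
        intro f
        have h1 : ∀ k, (Polynomial.C (f k) - Polynomial.X) =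
            Polynomial.C (-1) * (Polynomial.X - Polynomial.C (f k)) := fun k => by
          simp
        constructor
        · rw [Polynomial.degree_prod]
          have : ∀ k, (Polynomial.C (f k) - Polynomial.X).degree = 1 := fun k => by
            rw [h1, Polynomial.degree_C_mul (by norm_num), Polynomial.degree_X_sub_C]
          simp [this]
        · rw [Polynomial.leadingCoeff_prod]
          have : ∀ k, (Polynomial.C (f k) - Polynomial.X).leadingCoeff = -1 := fun k => by
            rw [h1, Polynomial.leadingCoeff_mul]; simp
          simp [this]
      have h2 := Polynomial.degree_sub_lt_left ((hd ζ).1.trans (hd fun j => (ξ j)⁻¹).1.symm)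
        (fun h => by
          have := (hd ζ).2
          rw [h] at this
          simp at this
          exact absurd this.symm (by simp)) ((hd ζ).2.trans (hd fun j => (ξ j)⁻¹).2.symm)
      rwa [(hd ζ).1] at h2
    have h := hc _ hdeg z hz
    simp only [Polynomial.eval_sub, Polynomial.eval_prod, Polynomial.eval_C,
      Polynomial.eval_X] at h
    rw [sub_div, div_self hz0, sub_eq_iff_eq_add] at h
    rw [h, add_comm]
    congr 1
    refine Finset.sum_congr rfl fun j _ => ?_
    have h0 : ∏ i, ((ξ i)⁻¹ - (ξ j)⁻¹) = 0 :=
      Finset.prod_eq_zero (Finset.mem_univ j) (sub_self _)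
    rw [h0, sub_zero]
  -- Without the factor `ζ_b - z` the numerator has degree below `m`; at the node `ξ_j⁻¹` the
  -- missing factor reappears as a denominator next to `r_j`.
  have hφb : ∀ b, (∏ k ∈ Finset.univ.erase b, (ζ k - (2 * Δ - (ζ b)⁻¹))) /
      ∏ j, ((ξ j)⁻¹ - (2 * Δ - (ζ b)⁻¹)) =
        ∑ j, r j / ((ζ b - (ξ j)⁻¹) * ((ξ j)⁻¹ - (2 * Δ - (ζ b)⁻¹))) := by
    intro b
    have hdeg : (∏ k ∈ Finset.univ.erase b, (Polynomial.C (ζ k) - Polynomial.X)).degree <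
        (m : WithBot ℕ) := by
      rw [Polynomial.degree_prod]
      have : ∀ k, (Polynomial.C (ζ k) - Polynomial.X).degree = 1 := fun k => by
        rw [← Polynomial.degree_neg, neg_sub, Polynomial.degree_X_sub_C]
      simp only [this, Finset.sum_const, Finset.card_erase_of_mem (Finset.mem_univ b),
        Finset.card_univ, Fintype.card_fin, nsmul_eq_mul, mul_one]
      have := b.pos
      exact_mod_cast Nat.sub_lt this one_pos
    have h := hc _ hdeg (2 * Δ - (ζ b)⁻¹) (fun j h => hb j b (by
      have h1 := hξ0 j
      have h2 := hζ0 b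
      field_simp at h
      linear_combination h))
    simp only [Polynomial.eval_sub, Polynomial.eval_prod, Polynomial.eval_C,
      Polynomial.eval_X] at h
    rw [h]
    refine Finset.sum_congr rfl fun j _ => ?_
    have h3 : ζ b - (ξ j)⁻¹ ≠ 0 := by
      rw [← neg_sub]; exact neg_ne_zero.2 (hwz j b)
    rw [hr]
    dsimp only
    rw [← Finset.mul_prod_erase _ _ (Finset.mem_univ b)]
    rw [mul_left_comm, mul_div_mul_left _ _ h3]
  have hbb : ∀ j b, ξ j + ζ b - 2 * Δ * ξ j * ζ b =
      ξ j * ζ b * ((ξ j)⁻¹ - (2 * Δ - (ζ b)⁻¹)) := fun j b => by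
    have h1 := hξ0 j
    have h2 := hζ0 b
    field_simp
    ring
  have hK : ∀ j b, kern Δ (ξ j) (ζ b) =
      -((ξ j ^ 2 * ζ b)⁻¹ * ((ζ b - (ξ j)⁻¹) * ((ξ j)⁻¹ - (2 * Δ - (ζ b)⁻¹)))⁻¹) := fun j b => by
    have h1 := hξ0 j
    have h2 := hζ0 b
    have h3 : 1 - ξ j * ζ b = -(ξ j * (ζ b - (ξ j)⁻¹)) := by field_simp; ring
    rw [kern, h3, hbb, ← mul_inv, one_div, ← inv_neg]
    congr 1
    ring
  have hv : ∀ b, dualVec Δ ξ ζ b * ζ b = ((∏ k, ζ k) / ∏ j, ξ j) * ((ζ b)⁻¹ *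
      ∑ j, r j / ((ζ b - (ξ j)⁻¹) * ((ξ j)⁻¹ - (2 * Δ - (ζ b)⁻¹)))) := by
    intro b
    rw [← hφb, dualVec]
    have h2 := hζ0 b
    have h4 : ∏ k ∈ Finset.univ.erase b, scat Δ (ζ b) (ζ k) * ζ k =
        (∏ k ∈ Finset.univ.erase b, (ζ k - (2 * Δ - (ζ b)⁻¹))) * ζ b ^ (m - 1) *
          ∏ k ∈ Finset.univ.erase b, ζ k := by
      have : ζ b ^ (m - 1) = ∏ k ∈ Finset.univ.erase b, ζ b := by simp
      rw [this, ← Finset.prod_mul_distrib, ← Finset.prod_mul_distrib]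
      refine Finset.prod_congr rfl fun k _ => ?_
      rw [scat]
      field_simp
      ring
    have h5 : ∏ j, (ξ j + ζ b - 2 * Δ * ξ j * ζ b) = (∏ j, ξ j) * (ζ b ^ (m - 1) * ζ b) *
        ∏ j, ((ξ j)⁻¹ - (2 * Δ - (ζ b)⁻¹)) := by
      have h6 : ζ b ^ (m - 1) * ζ b = ∏ _j : Fin m, ζ b := by
        rw [← pow_succ, Nat.sub_add_cancel b.pos]; simp
      rw [h6, ← Finset.prod_mul_distrib, ← Finset.prod_mul_distrib]
      exact Finset.prod_congr rfl fun j _ => hbb j b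
    have h7 : ∏ k, ζ k = ζ b * ∏ k ∈ Finset.univ.erase b, ζ k :=
      (Finset.mul_prod_erase _ _ (Finset.mem_univ b)).symm
    have h8 : ∏ j, ((ξ j)⁻¹ - (2 * Δ - (ζ b)⁻¹)) ≠ 0 := fun h => by
      rw [h, mul_zero] at h5
      exact Finset.prod_ne_zero_iff.2 (fun j _ => hb j b) h5
    have h9 : ζ b ^ (m - 1) ≠ 0 := pow_ne_zero _ h2
    rw [h4, h5, h7]
    generalize (∏ j, ((ξ j)⁻¹ - (2 * (Δ : ℂ) - (ζ b)⁻¹))) = A at h8 ⊢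
    generalize (∏ k ∈ Finset.univ.erase b, (ζ k - (2 * (Δ : ℂ) - (ζ b)⁻¹))) = B
    field_simp
  refine ⟨r, fun b => ?_, fun b => ?_, ?_⟩
  · rw [hv b, Finset.mul_sum, neg_mul, ← mul_neg, ← Finset.sum_neg_distrib]
    congr 1
    refine Finset.sum_congr rfl fun j _ => ?_
    have h1 := hξ0 j
    rw [hK]
    field_simp
  · have h2 := hζ0 b
    have h0 := hφ (ζ b) (fun j => sub_ne_zero.1 (hwz j b))
    rw [Finset.prod_eq_zero (Finset.mem_univ b) (sub_self _), zero_div] at h0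
    have h3 : dualVec Δ ξ ζ b * (1 - 2 * Δ * ζ b) =
        -(dualVec Δ ξ ζ b * ζ b) * (2 * Δ - (ζ b)⁻¹) := by field_simp; ring
    rw [h3, hv, neg_mul, mul_assoc, ← mul_neg]
    congr 1
    have h4 : (ζ b)⁻¹ = -((ζ b)⁻¹ * ∑ j, r j / ((ξ j)⁻¹ - ζ b)) := by
      linear_combination -(ζ b)⁻¹ * h0
    conv_rhs => rw [h4]
    rw [Finset.mul_sum, Finset.mul_sum, Finset.sum_mul, ← Finset.sum_neg_distrib,
      ← Finset.sum_neg_distrib, ← Finset.sum_add_distrib]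
    refine Finset.sum_congr rfl fun j _ => ?_
    have h1 := hξ0 j
    rw [hK]
    have h5 : (ζ b - (ξ j)⁻¹) ≠ 0 := by
      rw [← neg_sub]; exact neg_ne_zero.2 (hwz j b)
    have h6 : ((ξ j)⁻¹ - (2 * Δ - (ζ b)⁻¹)) ≠ 0 := fun h => hb j b (by rw [hbb, h, mul_zero])
    have h7 : ((ξ j)⁻¹ - ζ b)⁻¹ = -(ζ b - (ξ j)⁻¹)⁻¹ := by rw [← neg_sub, inv_neg]
    rw [div_eq_mul_inv _ ((ξ j)⁻¹ - ζ b), h7]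
    set A := ζ b - (ξ j)⁻¹
    generalize hY : (2 * (Δ : ℂ) - (ζ b)⁻¹) = y at *
    -- This splits the term in two: one part cancels the second denominator and matches the
    -- expansion of `φ(ζ_b) = 0`, the other is the kernel.
    have h8 : y = (ξ j)⁻¹ - ((ξ j)⁻¹ - y) := by ring
    set B := (ξ j)⁻¹ - y
    rw [h8]
    field_simp
    ring
  · have h0 := hφ 0 fun j => inv_ne_zero (hξ0 j)
    simp only [sub_zero, div_inv_eq_mul] at h0
    rw [← h0, Finset.prod_inv_distrib, div_inv_eq_mul, mul_comm]

/-- Deleting one row and one column in the determinant `detD`, summed against the Bethe factors,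
produces `1 - ∏ ξ_j ζ_j`. -/
theorem sum_minor_mixedProd_mul_detD {n : ℕ} (Δ : ℝ) (ξ ζ : Fin (n + 1) → ℂ)
    (hξ : Function.Injective ξ) (hζ : Function.Injective ζ)
    (hξ0 : ∀ j, ξ j ≠ 0) (hζ0 : ∀ j, ζ j ≠ 0)
    (ha : ∀ j k, 1 - ξ j * ζ k ≠ 0) (hb : ∀ j k, ξ j + ζ k - 2 * Δ * ξ j * ζ k ≠ 0) :
    ∑ a : Fin (n + 1), ∑ b : Fin (n + 1), (-1) ^ (a + b : ℕ) *
      (∏ j, scat Δ (ξ a) (ξ (a.succAbove j)) * ξ (a.succAbove j)) *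
      (∏ k, scat Δ (ζ b) (ζ (b.succAbove k)) * ζ (b.succAbove k)) *
      (mixedProd Δ (fun j => ξ (a.succAbove j)) (fun k => ζ (b.succAbove k)) *
        detD Δ (fun j => ξ (a.succAbove j)) (fun k => ζ (b.succAbove k))) =
      (1 - (∏ j, ξ j) * ∏ k, ζ k) * (mixedProd Δ ξ ζ * detD Δ ξ ζ) := by
  have hb' : ∀ j k, ζ j + ξ k - 2 * Δ * ζ j * ξ k ≠ 0 := fun j k h => hb k j (by
    linear_combination h)
  have ha' : ∀ j k, 1 - ζ j * ξ k ≠ 0 := fun j k h => ha k j (by linear_combination h)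
  obtain ⟨r, hr1, hr2, -⟩ := exists_dualVec_eq Δ ξ ζ hξ hξ0 hζ0 ha hb
  obtain ⟨s, hs1, -, hs3⟩ := exists_dualVec_eq Δ ζ ξ hζ hζ0 hξ0 ha' hb'
  set K : Matrix (Fin (n + 1)) (Fin (n + 1)) ℂ := Matrix.of fun i j => kern Δ (ξ i) (ζ j) with hK
  have hPξ : ∏ j, ξ j ≠ 0 := Finset.prod_ne_zero_iff.2 fun j _ => hξ0 j
  have hPζ : ∏ j, ζ j ≠ 0 := Finset.prod_ne_zero_iff.2 fun j _ => hζ0 j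
  -- A signed minor is an entry of the adjugate. Passing to the minor removes from `mixedProd` the
  -- factors of row `a` and of column `b`; the factor at `(a, b)` lies in both and is restored once,
  -- as `ξ_a (1 - 2Δ ζ_b) + ζ_b`.
  have hterm : ∀ a b : Fin (n + 1), (-1) ^ (a + b : ℕ) *
      (∏ j, scat Δ (ξ a) (ξ (a.succAbove j)) * ξ (a.succAbove j)) *
      (∏ k, scat Δ (ζ b) (ζ (b.succAbove k)) * ζ (b.succAbove k)) *
      (mixedProd Δ (fun j => ξ (a.succAbove j)) (fun k => ζ (b.succAbove k)) *
        detD Δ (fun j => ξ (a.succAbove j)) (fun k => ζ (b.succAbove k))) =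
      mixedProd Δ ξ ζ * (dualVec Δ ζ ξ a * K.adjugate b a *
        (dualVec Δ ξ ζ b * (ξ a * (1 - 2 * Δ * ζ b) + ζ b))) := by
    intro a b
    have hsub : detD Δ (fun j => ξ (a.succAbove j)) (fun k => ζ (b.succAbove k)) =
        (K.submatrix a.succAbove b.succAbove).det := rfl
    have herase : ∀ (f : Fin (n + 1) → ℂ) (a : Fin (n + 1)),
        ∏ k ∈ Finset.univ.erase a, f k = ∏ k, f (a.succAbove k) := by
      intro f a
      rw [← Finset.compl_singleton, ← Fin.image_succAbove_univ,
        Finset.prod_image fun _ _ _ _ h => Fin.succAbove_right_injective h]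
    have hM : mixedProd Δ ξ ζ * (ξ a + ζ b - 2 * Δ * ξ a * ζ b) =
        mixedProd Δ (fun j => ξ (a.succAbove j)) (fun k => ζ (b.succAbove k)) *
          (∏ k, (ζ k + ξ a - 2 * Δ * ζ k * ξ a)) * ∏ j, (ξ j + ζ b - 2 * Δ * ξ j * ζ b) := by
      have h1 : ∏ k, (ζ k + ξ a - 2 * Δ * ζ k * ξ a) =
          ∏ k, (ξ a + ζ k - 2 * Δ * ξ a * ζ k) :=
        Finset.prod_congr rfl fun k _ => by ring
      rw [h1, mixedProd, mixedProd, Fin.prod_univ_succAbove _ a,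
        Fin.prod_univ_succAbove (fun j => ξ j + ζ b - 2 * Δ * ξ j * ζ b) a]
      simp_rw [fun j : Fin n => Fin.prod_univ_succAbove
        (fun k => ξ (a.succAbove j) + ζ k - 2 * Δ * ξ (a.succAbove j) * ζ k) b]
      rw [Finset.prod_mul_distrib]
      ring
    have h1 : ∏ k, (ζ k + ξ a - 2 * Δ * ζ k * ξ a) ≠ 0 :=
      Finset.prod_ne_zero_iff.2 fun k _ => hb' k a
    have h2 : ∏ j, (ξ j + ζ b - 2 * Δ * ξ j * ζ b) ≠ 0 :=
      Finset.prod_ne_zero_iff.2 fun k _ => hb k b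
    rw [hsub, Matrix.adjugate_fin_succ_eq_det_submatrix, dualVec, dualVec, herase, herase]
    generalize (∏ k, (ζ k + ξ a - 2 * Δ * ζ k * ξ a)) = A at h1 hM ⊢
    generalize (∏ j, (ξ j + ζ b - 2 * Δ * ξ j * ζ b)) = B at h2 hM ⊢
    field_simp
    linear_combination (-
      (∏ j, scat Δ (ξ a) (ξ (a.succAbove j)) * ξ (a.succAbove j)) *
      (∏ k, scat Δ (ζ b) (ζ (b.succAbove k)) * ζ (b.succAbove k)) *
      (K.submatrix a.succAbove b.succAbove).det) * hM
  have hadj1 : ∀ j a, ∑ b, K j b * K.adjugate b a = if j = a then K.det else 0 := fun j a => by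
    have := congrFun (congrFun (Matrix.mul_adjugate K) j) a
    simpa [Matrix.mul_apply, Matrix.one_apply] using this
  have hadj2 : ∀ b k, ∑ a, K.adjugate b a * K a k = if b = k then K.det else 0 := fun b k => by
    have := congrFun (congrFun (Matrix.adjugate_mul K) b) k
    simpa [Matrix.mul_apply, Matrix.one_apply] using this
  simp_rw [hterm, ← Finset.mul_sum]
  rw [detD_eq, ← hK, mul_left_comm]
  congr 1
  set P := (∏ k, ζ k) / ∏ j, ξ j with hP
  have hP' : (∏ k, ξ k) / ∏ j, ζ j = P⁻¹ := by rw [hP, inv_div]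
  have hP0 : P ≠ 0 := div_ne_zero hPζ hPξ
  rw [hP'] at hs1
  -- In the sum over `b`, the relation `K * adjugate = det` turns the two sums with `r` into `ξ_a ·
  -- r_a ξ_a` and `-r_a ξ_a²`, which cancel. Only the term with `ζ_b⁻¹` survives.
  have hinner : ∀ a, ∑ b, dualVec Δ ζ ξ a * K.adjugate b a *
      (dualVec Δ ξ ζ b * (ξ a * (1 - 2 * Δ * ζ b) + ζ b)) =
      P * ∑ b, dualVec Δ ζ ξ a * ξ a * K.adjugate b a * (ζ b)⁻¹ := by
    intro a
    have h1 : ∀ b, dualVec Δ ζ ξ a * K.adjugate b a *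
        (dualVec Δ ξ ζ b * (ξ a * (1 - 2 * Δ * ζ b) + ζ b)) =
        P * (dualVec Δ ζ ξ a * ξ a * K.adjugate b a * (ζ b)⁻¹) +
        P * dualVec Δ ζ ξ a * ξ a * (∑ j, r j * ξ j * (K j b * K.adjugate b a)) -
        P * dualVec Δ ζ ξ a * (∑ j, r j * ξ j ^ 2 * (K j b * K.adjugate b a)) := by
      intro b
      have h2 : ∑ j, r j * ξ j * (K j b * K.adjugate b a) =
          (∑ j, r j * ξ j * kern Δ (ξ j) (ζ b)) * K.adjugate b a := by
        rw [Finset.sum_mul]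
        exact Finset.sum_congr rfl fun j _ => (mul_assoc _ _ _).symm
      have h3 : ∑ j, r j * ξ j ^ 2 * (K j b * K.adjugate b a) =
          (∑ j, r j * ξ j ^ 2 * kern Δ (ξ j) (ζ b)) * K.adjugate b a := by
        rw [Finset.sum_mul]
        exact Finset.sum_congr rfl fun j _ => (mul_assoc _ _ _).symm
      rw [h2, h3]
      linear_combination (dualVec Δ ζ ξ a * K.adjugate b a) * (ξ a * hr2 b + hr1 b)
    have h4 : ∀ c : Fin (n + 1) → ℂ, ∑ b, ∑ j, c j * (K j b * K.adjugate b a) = c a * K.det := by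
      intro c
      rw [Finset.sum_comm]
      simp_rw [← Finset.mul_sum, hadj1]
      simp
    simp_rw [h1]
    rw [Finset.sum_sub_distrib, Finset.sum_add_distrib, ← Finset.mul_sum, ← Finset.mul_sum,
      ← Finset.mul_sum, h4 fun j => r j * ξ j, h4 fun j => r j * ξ j ^ 2]
    ring
  -- The sum over `a` is treated alike with `ξ` and `ζ` exchanged. What remains is `-∑ s_b ζ_b`,
  -- which is `1 - ∏ ξ_j ∏ ζ_k` by `hs3`.
  simp_rw [hinner, hs1]
  have h5 : ∀ a b, -P⁻¹ * (∑ k, s k * ζ k ^ 2 * kern Δ (ζ k) (ξ a)) * K.adjugate b a * (ζ b)⁻¹ =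
      -P⁻¹ * (∑ k, s k * ζ k ^ 2 * (ζ b)⁻¹ * (K.adjugate b a * K a k)) := by
    intro a b
    rw [mul_assoc, mul_assoc, Finset.sum_mul]
    congr 1
    refine Finset.sum_congr rfl fun k _ => ?_
    rw [kern_comm, hK, Matrix.of_apply]
    ring
  simp_rw [h5, ← Finset.mul_sum]
  rw [neg_mul, mul_neg, mul_inv_cancel_left₀ hP0, Finset.sum_comm]
  have h6 : ∀ b, ∑ a, ∑ k, s k * ζ k ^ 2 * (ζ b)⁻¹ * (K.adjugate b a * K a k) =
      s b * ζ b * K.det := by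
    intro b
    have := hζ0 b
    rw [Finset.sum_comm]
    simp_rw [← Finset.mul_sum, hadj2]
    simp only [mul_ite, mul_zero, Finset.sum_ite_eq, Finset.mem_univ, if_true]
    field_simp
  simp_rw [h6, ← Finset.sum_mul]
  linear_combination K.det * hs3

/-! ### Summation over configurations -/

/-- Strictly increasing sequences of `n` integers, all of them at least `m`. -/
abbrev IncSeq (m : ℤ) (n : ℕ) : Type := {x : Fin n → ℤ // StrictMono x ∧ ∀ j, m ≤ x j}

/-- Shifting a sequence by one. -/
def incShift (m : ℤ) (n : ℕ) : IncSeq m n ≃ IncSeq (m + 1) n where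
  toFun x := ⟨fun j => x.1 j + 1, fun i j h => by have := x.2.1 h; dsimp only; omega,
    fun j => by have := x.2.2 j; dsimp only; omega⟩
  invFun x := ⟨fun j => x.1 j - 1, fun i j h => by have := x.2.1 h; dsimp only; omega,
    fun j => by have := x.2.2 j; dsimp only; omega⟩
  left_inv x := by ext j; simp
  right_inv x := by ext j; simp

/-- Prepending the value `m`. -/
def incCons (m : ℤ) (n : ℕ) (x : IncSeq (m + 1) n) : IncSeq m (n + 1) :=
  ⟨Fin.cons m x.1, by
    constructor
    · intro i j h
      induction j using Fin.cases with
      | zero => exact absurd h (Fin.not_lt_zero _)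
      | succ j =>
        induction i using Fin.cases with
        | zero => have := x.2.2 j; simp only [Fin.cons_zero, Fin.cons_succ]; omega
        | succ i => simpa using x.2.1 (Fin.succ_lt_succ_iff.1 h)
    · intro j
      induction j using Fin.cases with
      | zero => simp
      | succ j => have := x.2.2 j; simp only [Fin.cons_succ]; omega⟩

/-- Weakening the lower bound. -/
def incWeaken (m : ℤ) (n : ℕ) (x : IncSeq (m + 1) n) : IncSeq m n :=
  ⟨x.1, x.2.1, fun j => by have := x.2.2 j; omega⟩

/-- Either the first entry is `m`, or all entries are at least `m + 1`. This dichotomy is the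
recursion behind the summation formula. -/
theorem incCons_incWeaken_bijective (m : ℤ) (n : ℕ) :
    Function.Bijective (Sum.elim (incCons m n) (incWeaken m (n + 1))) := by
  constructor
  · rintro (x | x) (y | y) h
    · simp only [Sum.elim_inl, incCons, Subtype.mk.injEq] at h
      exact congrArg Sum.inl (Subtype.ext (Fin.cons_right_injective (α := fun _ => ℤ) m h))
    · simp only [Sum.elim_inl, Sum.elim_inr, incCons, incWeaken, Subtype.mk.injEq] at h
      have h1 := congrFun h 0
      have h2 := y.2.2 0
      simp only [Fin.cons_zero] at h1
      omega
    · simp only [Sum.elim_inl, Sum.elim_inr, incCons, incWeaken, Subtype.mk.injEq] at h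
      have h1 := congrFun h 0
      have h2 := x.2.2 0
      simp only [Fin.cons_zero] at h1
      omega
    · simp only [Sum.elim_inr, incWeaken, Subtype.mk.injEq] at h
      rw [Subtype.ext h]
  · intro x
    by_cases h : x.1 0 = m
    · refine ⟨Sum.inl ⟨Fin.tail x.1, fun i j hij => x.2.1 (Fin.succ_lt_succ_iff.2 hij),
        fun j => ?_⟩, ?_⟩
      · have := x.2.1 (Fin.succ_pos j)
        simp only [Fin.tail]
        omega
      · simp only [Sum.elim_inl, incCons]
        ext j
        simp only [← h, Fin.cons_self_tail]
    · refine ⟨Sum.inr ⟨x.1, x.2.1, fun j => ?_⟩, rfl⟩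
      have h1 := x.2.2 0
      have h2 := x.2.1.monotone (Fin.zero_le j)
      omega

/-! ### Geometric bounds and summability -/

theorem prod_zpow_eq_zpow_sum {ι G : Type*} [CommGroupWithZero G] {q : G} (hq : q ≠ 0)
    (s : Finset ι) (x : ι → ℤ) : ∏ j ∈ s, q ^ x j = q ^ (∑ j ∈ s, x j) := by
  classical
  induction s using Finset.induction_on with
  | empty => simp
  | insert a s ha ih => rw [Finset.prod_insert ha, Finset.sum_insert ha, zpow_add₀ hq, ih]

theorem summable_prod_pow {q : ℝ} (h0 : 0 ≤ q) (h1 : q < 1) (n : ℕ) :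
    Summable fun f : Fin n → ℕ => ∏ i, q ^ f i := by
  induction n with
  | zero => exact Summable.of_finite
  | succ n ih =>
    rw [← (Fin.consEquiv fun _ : Fin (n + 1) => ℕ).summable_iff]
    have h := (summable_geometric_of_lt_one h0 h1).mul_of_nonneg ih
      (fun k => pow_nonneg h0 k) (fun f => Finset.prod_nonneg fun i _ => pow_nonneg h0 _)
    refine h.congr fun x => ?_
    simp [Fin.prod_univ_succ, Fin.consEquiv]

/-- The differences `x_j - m` embed the increasing sequences into `ℕ^n`, where the sum is a product
of geometric series. -/
theorem summable_zpow_sum {q : ℝ} (h0 : 0 < q) (h1 : q < 1) (m : ℤ) (n : ℕ) :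
    Summable fun x : IncSeq m n => q ^ (∑ j, x.1 j) := by
  have hinj : Function.Injective fun (x : IncSeq m n) (j : Fin n) => (x.1 j - m).toNat := by
    intro x y h
    ext j
    have h2 := congrFun h j
    have h3 := x.2.2 j
    have h4 := y.2.2 j
    simp only at h2
    omega
  have h := ((summable_prod_pow h0.le h1 n).comp_injective hinj).mul_left (∏ _j : Fin n, q ^ m)
  refine h.congr fun x => ?_
  simp only [Function.comp_apply]
  rw [← Finset.prod_mul_distrib, ← prod_zpow_eq_zpow_sum h0.ne']
  refine Finset.prod_congr rfl fun j _ => ?_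
  rw [← zpow_natCast, ← zpow_add₀ h0.ne']
  congr 1
  have := x.2.2 j
  omega

theorem norm_scat_le (Δ : ℝ) {a b : ℂ} {R : ℝ} (ha : ‖a‖ ≤ R) (hb : ‖b‖ ≤ R) :
    ‖scat Δ a b‖ ≤ 1 + R * R + 2 * |Δ| * R := by
  have hR : 0 ≤ R := (norm_nonneg a).trans ha
  unfold scat
  refine (norm_sub_le _ _).trans (add_le_add ((norm_add_le _ _).trans (add_le_add ?_ ?_)) ?_)
  · simp
  · rw [norm_mul]; gcongr
  · rw [norm_mul, norm_mul]
    simp only [Complex.norm_ofNat, Complex.norm_real, Real.norm_eq_abs]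
    gcongr

/-- A bound for the Bethe wave function on the torus of radius `R`. -/
def betheBound (Δ : ℝ) (n : ℕ) (R : ℝ) : ℝ :=
  ∑ _σ : Equiv.Perm (Fin n), ∏ j : Fin n, ∏ _k ∈ Finset.Ioi j, (1 + R * R + 2 * |Δ| * R)

theorem norm_bethe_le {n : ℕ} (Δ : ℝ) (x : Fin n → ℤ) {ξ : Fin n → ℂ} {R : ℝ} (hR : 0 < R)
    (hξ : ∀ j, ‖ξ j‖ = R) : ‖bethe Δ x ξ‖ ≤ betheBound Δ n R * R ^ (∑ j, x j) := by
  rw [bethe, betheBound, Finset.sum_mul]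
  refine (norm_sum_le _ _).trans (Finset.sum_le_sum fun σ _ => ?_)
  rw [norm_mul, norm_mul, norm_prod, betheDenom_eq, norm_prod]
  simp only [norm_zpow, hξ, norm_prod]
  have h1 : ‖((Equiv.Perm.sign σ : ℤ) : ℂ)‖ = 1 := by
    rcases Int.units_eq_one_or (Equiv.Perm.sign σ) with h | h <;> simp [h]
  rw [h1, one_mul, prod_zpow_eq_zpow_sum hR.ne']
  refine mul_le_mul_of_nonneg_right ?_ (by positivity)
  gcongr with j _ k _
  exact norm_scat_le Δ (hξ _).le (hξ _).le

theorem summable_bethe_mul_bethe {n : ℕ} (Δ : ℝ) (m : ℤ) {ξ ζ : Fin n → ℂ} {R r : ℝ} (hR : 0 < R)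
    (hr : 0 < r) (hRr : R * r < 1) (hξ : ∀ j, ‖ξ j‖ = R) (hζ : ∀ j, ‖ζ j‖ = r) :
    Summable fun x : IncSeq m n => bethe Δ x.1 ξ * bethe Δ x.1 ζ := by
  refine Summable.of_norm_bounded ((summable_zpow_sum (mul_pos hR hr) hRr m n).mul_left
    (betheBound Δ n R * betheBound Δ n r)) fun x => ?_
  rw [norm_mul, mul_zpow]
  calc _ ≤ (betheBound Δ n R * R ^ (∑ j, x.1 j)) * (betheBound Δ n r * r ^ (∑ j, x.1 j)) :=
        mul_le_mul (norm_bethe_le Δ _ hR hξ) (norm_bethe_le Δ _ hr hζ) (norm_nonneg _)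
          ((norm_nonneg _).trans (norm_bethe_le Δ _ hR hξ))
    _ = _ := by ring

theorem bethe_add_one {n : ℕ} (Δ : ℝ) (x : Fin n → ℤ) (ξ : Fin n → ℂ) (hξ : ∀ j, ξ j ≠ 0) :
    bethe Δ (fun j => x j + 1) ξ = (∏ j, ξ j) * bethe Δ x ξ := by
  rw [bethe, bethe, Finset.mul_sum]
  refine Finset.sum_congr rfl fun σ _ => ?_
  have h : ∏ j, ξ (σ j) ^ (x j + 1) = (∏ j, ξ (σ j) ^ x j) * ∏ j, ξ j := by
    rw [← Equiv.prod_comp σ ξ, ← Finset.prod_mul_distrib]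
    exact Finset.prod_congr rfl fun j _ => zpow_add_one₀ (hξ _) _
  rw [h]
  ring

/-- The Cauchy-type summation formula for Bethe wave functions. -/
theorem hasSum_bethe_mul_bethe {n : ℕ} (Δ : ℝ) (m : ℤ) (ξ ζ : Fin n → ℂ) {R r : ℝ} (hR : 0 < R)
    (hr : 0 < r) (hRr : R * r < 1) (hξ : ∀ j, ‖ξ j‖ = R) (hζ : ∀ j, ‖ζ j‖ = r)
    (hb : ∀ j k, ξ j + ζ k - 2 * Δ * ξ j * ζ k ≠ 0) :
    HasSum (fun x : IncSeq m n => bethe Δ x.1 ξ * bethe Δ x.1 ζ)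
      (((∏ j, ξ j) * ∏ j, ζ j) ^ m * (mixedProd Δ ξ ζ * detD Δ ξ ζ)) := by
  have hS := fun m => (summable_bethe_mul_bethe Δ m hR hr hRr hξ hζ)
  -- The minor identity needs distinct variables. If two of them coincide, the wave functions and
  -- the determinant both vanish.
  by_cases hξi : Function.Injective ξ
  swap
  · obtain ⟨i, j, hij, hne⟩ : ∃ i j, ξ i = ξ j ∧ i ≠ j := by
      simpa [Function.Injective] using hξi
    have hdet : detD Δ ξ ζ = 0 := Matrix.det_zero_of_row_eq hne (by ext k; simp [hij])
    simp only [bethe_eq_zero_of_eq Δ _ ξ hne hij, zero_mul, hdet, mul_zero]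
    exact hasSum_zero
  by_cases hζi : Function.Injective ζ
  swap
  · obtain ⟨i, j, hij, hne⟩ : ∃ i j, ζ i = ζ j ∧ i ≠ j := by
      simpa [Function.Injective] using hζi
    have hdet : detD Δ ξ ζ = 0 := Matrix.det_zero_of_column_eq hne (by intro k; simp [hij])
    simp only [bethe_eq_zero_of_eq Δ _ ζ hne hij, mul_zero, hdet]
    exact hasSum_zero
  induction n generalizing m with
  | zero =>
    have hsub : ∀ x : IncSeq m 0, x = ⟨Fin.elim0, fun i => i.elim0, fun i => i.elim0⟩ :=
      fun x => Subtype.ext (Subsingleton.elim _ _)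
    have h := hasSum_single (f := fun x : IncSeq m 0 => bethe Δ x.1 ξ * bethe Δ x.1 ζ)
      ⟨Fin.elim0, fun i => i.elim0, fun i => i.elim0⟩ fun x hx => absurd (hsub x) hx
    simpa [bethe, betheDenom, mixedProd, detD] using h
  | succ n ih =>
    have hξ0 : ∀ j, ξ j ≠ 0 := fun j h => hR.ne' (by rw [← hξ j, h, norm_zero])
    have hζ0 : ∀ j, ζ j ≠ 0 := fun j h => hr.ne' (by rw [← hζ j, h, norm_zero])
    have ha : ∀ j k, 1 - ξ j * ζ k ≠ 0 := fun j k h => by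
      have h1 : ‖ξ j * ζ k‖ = 1 := by rw [← sub_eq_zero.1 h, norm_one]
      rw [norm_mul, hξ, hζ] at h1
      exact hRr.ne h1
    set p := (∏ j, ξ j) * ∏ j, ζ j with hp
    have hp0 : p ≠ 0 := mul_ne_zero (Finset.prod_ne_zero_iff.2 fun j _ => hξ0 j)
      (Finset.prod_ne_zero_iff.2 fun j _ => hζ0 j)
    have hp1 : 1 - p ≠ 0 := fun h => by
      have h1 : ‖p‖ = 1 := by rw [← sub_eq_zero.1 h, norm_one]
      rw [hp, norm_mul, norm_prod, norm_prod] at h1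
      simp only [hξ, hζ, Finset.prod_const, Finset.card_univ, Fintype.card_fin] at h1
      rw [← mul_pow] at h1
      exact (pow_lt_one₀ (by positivity) hRr n.succ_ne_zero).ne h1
    obtain ⟨s, hs⟩ := hS m
    -- Translating all particles by one site multiplies every summand by `p`.
    have hs1 : HasSum (fun x : IncSeq (m + 1) (n + 1) => bethe Δ x.1 ξ * bethe Δ x.1 ζ)
        (p * s) := by
      rw [← (incShift m (n + 1)).hasSum_iff]
      refine (congrArg (HasSum · (p * s)) (funext fun x => ?_)).mpr (hs.mul_left p)
      simp only [Function.comp_apply, incShift, Equiv.coe_fn_mk]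
      rw [bethe_add_one Δ x.1 ξ hξ0, bethe_add_one Δ x.1 ζ hζ0, hp]
      ring
    -- The part with the first particle at `m`. The induction hypothesis sums the other particles
    -- from `m + 1` on; the power `m + 1` instead of `m` supplies the products of the remaining
    -- `ξ_j` and `ζ_k` in the minor identity.
    have hs2 : HasSum (fun x : IncSeq (m + 1) n =>
        bethe Δ (incCons m n x).1 ξ * bethe Δ (incCons m n x).1 ζ)
        (p ^ m * ((1 - p) * (mixedProd Δ ξ ζ * detD Δ ξ ζ))) := by
      have h1 := fun a b : Fin (n + 1) => (ih (m + 1) (fun j => ξ (a.succAbove j))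
        (fun j => ζ (b.succAbove j)) (fun j => hξ _) (fun j => hζ _) (fun j k => hb _ _)
        (fun m => summable_bethe_mul_bethe Δ m hR hr hRr (fun j => hξ _) (fun j => hζ _))
        (hξi.comp Fin.succAbove_right_injective) (hζi.comp Fin.succAbove_right_injective)).mul_left
        (((-1) ^ (a + b : ℕ) * ((∏ j, scat Δ (ξ a) (ξ (a.succAbove j))) * ξ a ^ m) *
          ((∏ j, scat Δ (ζ b) (ζ (b.succAbove j))) * ζ b ^ m)))
      have h2 := hasSum_sum (s := Finset.univ) fun a _ =>
        hasSum_sum (s := Finset.univ) fun b _ => h1 a b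
      refine (congrArg₂ (HasSum · ·) (funext fun x => ?_) ?_).mpr h2
      · rw [bethe_succ, bethe_succ, Finset.sum_mul_sum]
        refine Finset.sum_congr rfl fun a _ => Finset.sum_congr rfl fun b _ => ?_
        simp only [incCons, Fin.cons_zero, Fin.cons_succ]
        ring
      · rw [hp, ← sum_minor_mixedProd_mul_detD Δ ξ ζ hξi hζi hξ0 hζ0 ha hb, Finset.mul_sum]
        refine Finset.sum_congr rfl fun a _ => ?_
        rw [Finset.mul_sum]
        refine Finset.sum_congr rfl fun b _ => ?_
        rw [Fin.prod_univ_succAbove ξ a, Fin.prod_univ_succAbove ζ b, Finset.prod_mul_distrib,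
          Finset.prod_mul_distrib, zpow_add_one₀ (mul_ne_zero
            (Finset.prod_ne_zero_iff.2 fun j _ => hξ0 _)
            (Finset.prod_ne_zero_iff.2 fun j _ => hζ0 _))]
        simp only [mul_zpow]
        ring
    have hs3 : HasSum (fun x : IncSeq m (n + 1) => bethe Δ x.1 ξ * bethe Δ x.1 ζ)
        (p ^ m * ((1 - p) * (mixedProd Δ ξ ζ * detD Δ ξ ζ)) + p * s) := by
      rw [← (Equiv.ofBijective _ (incCons_incWeaken_bijective m n)).hasSum_iff]
      exact HasSum.sum hs2 hs1
    -- The total `s` is the part with the first particle at `m` plus `p s`, and `1 - p ≠ 0`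
    -- determines it.
    have h4 := hs.unique hs3
    have h5 : s = p ^ m * (mixedProd Δ ξ ζ * detD Δ ξ ζ) := by
      apply mul_left_cancel₀ hp1
      linear_combination h4
    rwa [← h5]

/-! ### Uniform measures on circles and tori -/

/-- The uniform probability measure on the circle `|z| = ρ`. -/
def circ (ρ : ℝ) : Measure ℂ :=
  ENNReal.ofReal (2 * Real.pi)⁻¹ •
    (volume.restrict (Set.Icc 0 (2 * Real.pi))).map (circleMap 0 ρ)

theorem measurable_circleMap (ρ : ℝ) : Measurable (circleMap 0 ρ) :=
  (continuous_circleMap 0 ρ).measurable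

instance isProbabilityMeasure_circ (ρ : ℝ) : IsProbabilityMeasure (circ ρ) := by
  constructor
  rw [circ, Measure.smul_apply, Measure.map_apply (measurable_circleMap ρ) MeasurableSet.univ]
  simp only [Set.preimage_univ, Measure.restrict_apply_univ, Real.volume_Icc, sub_zero,
    smul_eq_mul]
  rw [← ENNReal.ofReal_mul (by positivity), inv_mul_cancel₀ (by positivity), ENNReal.ofReal_one]

theorem ae_circ {ρ : ℝ} (hρ : 0 < ρ) : ∀ᵐ z ∂circ ρ, ‖z‖ = ρ := by
  refine Measure.ae_smul_measure ?_ _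
  rw [ae_map_iff (measurable_circleMap ρ).aemeasurable
    (isClosed_eq continuous_norm continuous_const).measurableSet]
  exact Filter.Eventually.of_forall fun θ => by simp [abs_of_pos hρ]

theorem circ_singleton {ρ : ℝ} (hρ : 0 < ρ) (z : ℂ) : circ ρ {z} = 0 := by
  rw [circ, Measure.smul_apply, Measure.map_apply (measurable_circleMap ρ)
    (measurableSet_singleton z)]
  have h : volume (circleMap 0 ρ ⁻¹' {z}) = 0 :=
    ((Set.countable_singleton z).preimage_circleMap 0 hρ.ne').measure_zero _
  rw [Measure.restrict_apply (measurable_circleMap ρ (measurableSet_singleton z)),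
    measure_mono_null Set.inter_subset_left h, smul_zero]

theorem integrable_of_continuousOn_compact {X : Type*} [TopologicalSpace X] [MeasurableSpace X]
    [OpensMeasurableSpace X] [T2Space X] [TopologicalSpace.PseudoMetrizableSpace X]
    {μ : Measure X} [IsFiniteMeasure μ] {K : Set X} (hK : IsCompact K) (hμ : ∀ᵐ x ∂μ, x ∈ K)
    {f : X → ℂ} (hf : ContinuousOn f K) : Integrable f μ := by
  rw [← Measure.restrict_eq_self_of_ae_mem hμ]
  exact hf.integrableOn_compact hK

theorem integrable_circ {ρ : ℝ} (hρ : 0 < ρ) {f : ℂ → ℂ}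
    (hf : ContinuousOn f (Metric.sphere 0 ρ)) : Integrable f (circ ρ) :=
  integrable_of_continuousOn_compact (isCompact_sphere 0 ρ)
    ((ae_circ hρ).mono fun z hz => by simpa using hz) hf

/-- The uniform measure on the circle is `dz / (2πi z)`. -/
theorem integral_circ {ρ : ℝ} (hρ : 0 < ρ) {f : ℂ → ℂ}
    (hf : ContinuousOn f (Metric.sphere 0 ρ)) :
    ∫ z, f z ∂circ ρ = (2 * Real.pi * Complex.I : ℂ)⁻¹ * ∮ z in C(0, ρ), z⁻¹ * f z := by
  have h1 := integrable_circ hρ hf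
  have h2 : AEStronglyMeasurable f
      ((volume.restrict (Set.Icc 0 (2 * Real.pi))).map (circleMap 0 ρ)) := by
    refine h1.1.mono_ac (Measure.absolutelyContinuous_smul ?_)
    simpa using Real.pi_pos
  rw [circ, integral_smul_measure, integral_map (measurable_circleMap ρ).aemeasurable h2,
    ENNReal.toReal_ofReal (by positivity)]
  have h3 := Real.circleAverage_eq_circleIntegral (f := f) (c := 0) (R := ρ) hρ.ne'
  rw [Real.circleAverage_def, intervalIntegral.integral_of_le (by positivity),
    ← integral_Icc_eq_integral_Ioc] at h3
  rw [h3]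
  simp

/-- The uniform probability measure on the torus `|ξ_j| = ρ_j`. -/
def torus {n : ℕ} (ρ : Fin n → ℝ) : Measure (Fin n → ℂ) := Measure.pi fun j => circ (ρ j)

instance isProbabilityMeasure_torus {n : ℕ} (ρ : Fin n → ℝ) : IsProbabilityMeasure (torus ρ) := by
  unfold torus; infer_instance

/-- The torus as a set. -/
def torusSet {n : ℕ} (ρ : Fin n → ℝ) : Set (Fin n → ℂ) := {ξ | ∀ j, ‖ξ j‖ = ρ j}

theorem isCompact_torusSet {n : ℕ} (ρ : Fin n → ℝ) : IsCompact (torusSet ρ) := by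
  have : torusSet ρ = Set.univ.pi fun j => Metric.sphere (0 : ℂ) (ρ j) := by
    ext ξ; simp [torusSet]
  rw [this]
  exact isCompact_univ_pi fun j => isCompact_sphere 0 _

theorem ae_torus {n : ℕ} {ρ : Fin n → ℝ} (hρ : ∀ j, 0 < ρ j) : ∀ᵐ ξ ∂torus ρ, ξ ∈ torusSet ρ := by
  refine ae_all_iff.2 fun j => ?_
  exact (Measure.tendsto_eval_ae_ae (μ := fun j => circ (ρ j)) (i := j)).eventually
    (ae_circ (hρ j))

theorem integrable_torus {n : ℕ} {ρ : Fin n → ℝ} (hρ : ∀ j, 0 < ρ j) {f : (Fin n → ℂ) → ℂ}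
    (hf : ContinuousOn f (torusSet ρ)) : Integrable f (torus ρ) :=
  integrable_of_continuousOn_compact (isCompact_torusSet ρ) (ae_torus hρ) hf

/-- The overwritten coordinate is integrated against a probability measure and contributes a factor
`1`, so the value `ρ i` is irrelevant. -/
theorem measurePreserving_update {n : ℕ} (ρ : Fin n → ℝ) (i : Fin n) (t : ℝ) :
    MeasurePreserving (fun p : (Fin n → ℂ) × ℂ => Function.update p.1 i p.2)
      ((torus ρ).prod (circ t)) (torus (Function.update ρ i t)) := by
  have hm : Measurable fun p : (Fin n → ℂ) × ℂ => Function.update p.1 i p.2 :=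
    measurable_pi_lambda _ fun j => by
      by_cases h : j = i
      · subst h; simpa using measurable_snd
      · simp only [Function.update_of_ne h]
        exact (measurable_pi_apply j).comp measurable_fst
  refine ⟨hm, (Measure.pi_eq fun s hs => ?_).symm⟩
  rw [Measure.map_apply hm (MeasurableSet.univ_pi hs)]
  have h1 : (fun p : (Fin n → ℂ) × ℂ => Function.update p.1 i p.2) ⁻¹' Set.univ.pi s =
      (Set.univ.pi (Function.update s i Set.univ)) ×ˢ s i := by
    ext p
    simp only [Set.mem_preimage, Set.mem_univ_pi, Set.mem_prod]
    constructor
    · intro h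
      refine ⟨fun j => ?_, by simpa using h i⟩
      by_cases hj : j = i
      · subst hj; simp
      · simpa [hj] using h j
    · rintro ⟨h, h'⟩ j
      by_cases hj : j = i
      · subst hj; simpa using h'
      · simpa [hj] using h j
  rw [h1, Measure.prod_prod, torus, Measure.pi_pi, ← Finset.prod_erase_mul _ _ (Finset.mem_univ i),
    ← Finset.prod_erase_mul Finset.univ (fun j => circ (Function.update ρ i t j) (s j))
      (Finset.mem_univ i)]
  simp only [Function.update_self, measure_univ, mul_one]
  congr 1
  refine Finset.prod_congr rfl fun j hj => ?_
  rw [Function.update_of_ne (Finset.ne_of_mem_erase hj),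
    Function.update_of_ne (Finset.ne_of_mem_erase hj)]

/-- Integration over one of the circles first. -/
theorem integral_torus_update {n : ℕ} (ρ : Fin n → ℝ) (i : Fin n) (t : ℝ) {f : (Fin n → ℂ) → ℂ}
    (hf : Integrable f (torus (Function.update ρ i t))) :
    ∫ ξ, f ξ ∂torus (Function.update ρ i t) =
      ∫ ξ, ∫ z, f (Function.update ξ i z) ∂circ t ∂torus ρ := by
  have h := measurePreserving_update ρ i t
  rw [← integral_prod (fun p : (Fin n → ℂ) × ℂ => f (Function.update p.1 i p.2))
    (h.integrable_comp_of_integrable hf)]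
  conv_lhs => rw [← h.map_eq]
  exact integral_map h.measurable.aemeasurable (by rw [h.map_eq]; exact hf.1)

theorem integral_torus_eq_zero {n : ℕ} {ρ : Fin n → ℝ} (hρ : ∀ j, 0 < ρ j) (i : Fin n)
    {f : (Fin n → ℂ) → ℂ} (hf : ContinuousOn f (torusSet ρ))
    (h : ∀ ξ ∈ torusSet ρ, ∫ z, f (Function.update ξ i z) ∂circ (ρ i) = 0) :
    ∫ ξ, f ξ ∂torus ρ = 0 := by
  have h1 := integral_torus_update ρ i (ρ i) (f := f)
  rw [Function.update_eq_self] at h1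
  rw [h1 (integrable_torus hρ hf)]
  exact integral_eq_zero_of_ae ((ae_torus hρ).mono h)

theorem measurePreserving_snoc {n : ℕ} (ρ : Fin (n + 1) → ℝ) :
    MeasurePreserving (fun p : (Fin n → ℂ) × ℂ => (Fin.snoc p.1 p.2 : Fin (n + 1) → ℂ))
      ((torus fun j : Fin n => ρ j.castSucc).prod (circ (ρ (Fin.last n)))) (torus ρ) := by
  have hm : Measurable fun p : (Fin n → ℂ) × ℂ => (Fin.snoc p.1 p.2 : Fin (n + 1) → ℂ) :=
    measurable_pi_lambda _ fun j => by
      induction j using Fin.lastCases with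
      | last => simpa using measurable_snd
      | cast j =>
        simp only [Fin.snoc_castSucc]
        exact (measurable_pi_apply j).comp measurable_fst
  refine ⟨hm, (Measure.pi_eq fun s hs => ?_).symm⟩
  rw [Measure.map_apply hm (MeasurableSet.univ_pi hs)]
  have h1 : (fun p : (Fin n → ℂ) × ℂ => (Fin.snoc p.1 p.2 : Fin (n + 1) → ℂ)) ⁻¹' Set.univ.pi s =
      (Set.univ.pi fun j : Fin n => s j.castSucc) ×ˢ s (Fin.last n) := by
    ext p
    simp [Fin.forall_fin_succ']
  rw [h1, Measure.prod_prod, torus, Measure.pi_pi, Fin.prod_univ_castSucc]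

/-- Integration over the last circle first. -/
theorem integral_torus_snoc {n : ℕ} (ρ : Fin (n + 1) → ℝ) {f : (Fin (n + 1) → ℂ) → ℂ}
    (hf : Integrable f (torus ρ)) :
    ∫ ξ, f ξ ∂torus ρ =
      ∫ ξ, ∫ z, f (Fin.snoc ξ z) ∂circ (ρ (Fin.last n)) ∂torus fun j : Fin n => ρ j.castSucc := by
  have h := measurePreserving_snoc ρ
  rw [← integral_prod (fun p : (Fin n → ℂ) × ℂ => f (Fin.snoc p.1 p.2))
    (h.integrable_comp_of_integrable hf)]
  conv_lhs => rw [← h.map_eq]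
  exact integral_map h.measurable.aemeasurable (by rw [h.map_eq]; exact hf.1)

theorem update_mem_torusSet {n : ℕ} {ρ : Fin n → ℝ} {ξ : Fin n → ℂ} (hξ : ξ ∈ torusSet ρ)
    (i : Fin n) {z : ℂ} {s : ℝ} (hz : ‖z‖ = s) :
    Function.update ξ i z ∈ torusSet (Function.update ρ i s) := by
  intro j
  by_cases h : j = i
  · subst h; simpa using hz
  · simpa [h] using hξ j

/-! ### Inversion -/

/-- Inversion sends the angle `θ` to `-θ`, on the circle the same as `2π - θ`, and the latter
reflection preserves `[0, 2π]`. -/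
theorem measurePreserving_inv_circ (ρ : ℝ) :
    MeasurePreserving (fun z : ℂ => z⁻¹) (circ ρ) (circ ρ⁻¹) := by
  have hm : Measurable fun z : ℂ => z⁻¹ := measurable_inv
  have hr : MeasurePreserving (fun θ : ℝ => 2 * Real.pi - θ)
      (volume.restrict (Set.Icc 0 (2 * Real.pi))) (volume.restrict (Set.Icc 0 (2 * Real.pi))) := by
    have h1 : (fun θ : ℝ => 2 * Real.pi - θ) ⁻¹' Set.Icc 0 (2 * Real.pi) =
        Set.Icc 0 (2 * Real.pi) := by
      ext θ; simp
    have h2 := (Measure.measurePreserving_sub_left volume (2 * Real.pi)).restrict_preimage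
      (s := Set.Icc 0 (2 * Real.pi)) measurableSet_Icc
    rwa [h1] at h2
  refine ⟨hm, ?_⟩
  rw [circ, circ, Measure.map_smul, Measure.map_map hm (measurable_circleMap ρ)]
  conv_rhs => rw [← hr.map_eq, Measure.map_map (measurable_circleMap _) hr.measurable]
  congr 2
  ext1 θ
  simp only [Function.comp_apply, circleMap, zero_add, mul_inv, ← Complex.exp_neg,
    Complex.ofReal_inv]
  congr 1
  rw [Complex.exp_eq_exp_iff_exists_int]
  exact ⟨-1, by push_cast; ring⟩

/-- Inverting all variables and reversing their order. -/
theorem measurePreserving_inv_rev (n : ℕ) (ρ : ℝ) :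
    MeasurePreserving (fun (ξ : Fin n → ℂ) (j : Fin n) => (ξ j.rev)⁻¹)
      (torus fun _ => ρ) (torus fun _ => ρ⁻¹) := by
  have hm : Measurable fun (ξ : Fin n → ℂ) (j : Fin n) => (ξ j.rev)⁻¹ :=
    measurable_pi_lambda _ fun j => (measurable_pi_apply j.rev).inv
  refine ⟨hm, (Measure.pi_eq fun s hs => ?_).symm⟩
  rw [Measure.map_apply hm (MeasurableSet.univ_pi hs)]
  have h1 : (fun (ξ : Fin n → ℂ) (j : Fin n) => (ξ j.rev)⁻¹) ⁻¹' Set.univ.pi s =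
      Set.univ.pi fun j => (fun z : ℂ => z⁻¹) ⁻¹' s j.rev := by
    ext ξ
    simp only [Set.mem_preimage, Set.mem_univ_pi]
    exact ⟨fun h j => by simpa using h j.rev, fun h j => by simpa using h j.rev⟩
  rw [h1, torus, Measure.pi_pi]
  simp only [(measurePreserving_inv_circ ρ).measure_preimage (hs _).nullMeasurableSet]
  exact Equiv.prod_comp Fin.revPerm fun j => circ ρ⁻¹ (s j)

/-! ### Cauchy's theorem -/

/-- An integral over a circle with simple poles at the distinct points `p l`. -/
theorem circleIntegral_div_prod {ι : Type*} [Fintype ι] [DecidableEq ι] {ρ : ℝ} (hρ : 0 < ρ)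
    (p : ι → ℂ) (hp : Function.Injective p) (hpρ : ∀ l, ‖p l‖ ≠ ρ) [Nonempty ι] {g : ℂ → ℂ}
    (hg : ∀ z, ‖z‖ ≤ ρ → DifferentiableAt ℂ g z) :
    (2 * Real.pi * Complex.I : ℂ)⁻¹ * ∮ z in C(0, ρ), g z / ∏ l, (z - p l) =
      ∑ l, if ‖p l‖ < ρ then g (p l) * ∏ m ∈ Finset.univ.erase l, (p l - p m)⁻¹ else 0 := by
  have hcont : ContinuousOn g (Metric.closedBall 0 ρ) := fun z hz =>
    (hg z (by simpa using hz)).continuousAt.continuousWithinAt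
  -- Partial fractions of `1 / ∏ (z - p_l)`, from the Lagrange interpolation of the constant `1`.
  -- Each remaining integral has a single simple pole.
  have h1 : ∀ z ∈ Metric.sphere (0 : ℂ) ρ, g z / ∏ l, (z - p l) =
      ∑ l, (∏ m ∈ Finset.univ.erase l, (p l - p m)⁻¹) * ((z - p l)⁻¹ * g z) := by
    intro z hz
    have hz' : ‖z‖ = ρ := by simpa using hz
    have hne : ∀ l ∈ Finset.univ, z ≠ p l := fun l _ h => hpρ l (h ▸ hz')
    have h2 := Lagrange.eval_interpolate_not_at_node (s := Finset.univ) (v := p) 1 hne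
    rw [Lagrange.interpolate_one hp.injOn Finset.univ_nonempty, Polynomial.eval_one,
      Lagrange.eval_nodal] at h2
    have h3 : ∏ l, (z - p l) ≠ 0 := Finset.prod_ne_zero_iff.2 fun l hl => sub_ne_zero.2 (hne l hl)
    rw [div_eq_mul_inv, inv_eq_of_mul_eq_one_right h2.symm, Finset.mul_sum]
    refine Finset.sum_congr rfl fun l _ => ?_
    rw [Lagrange.nodalWeight, Pi.one_apply]
    ring
  rw [circleIntegral.integral_congr hρ.le h1, circleIntegral.integral_fun_sum]
  · rw [Finset.mul_sum]
    refine Finset.sum_congr rfl fun l _ => ?_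
    rw [circleIntegral.integral_const_mul]
    split_ifs with hl
    · have h4 := Complex.circleIntegral_sub_inv_smul_of_differentiable_on_off_countable
        (s := ∅) Set.countable_empty (w := p l) (c := 0) (R := ρ) (by simpa using hl) hcont
        (fun z hz => hg z (by simpa using (Metric.ball_subset_closedBall hz.1)))
      simp only [smul_eq_mul] at h4
      rw [h4]
      have := Complex.two_pi_I_ne_zero
      field_simp
    · have h4 := Complex.circleIntegral_eq_zero_of_differentiable_on_off_countable hρ.le
        (s := ∅) Set.countable_empty (c := 0) (f := fun z => (z - p l)⁻¹ * g z) ?_ ?_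
      · rw [h4]; simp
      · refine ContinuousOn.mul (ContinuousOn.inv₀ (by fun_prop) fun z hz h => ?_) hcont
        have := hpρ l
        rw [sub_eq_zero.1 h] at hz
        exact hl (lt_of_le_of_ne (by simpa using hz) this)
      · intro z hz
        have hz' : ‖z‖ < ρ := by simpa using hz.1
        refine DifferentiableAt.mul (DifferentiableAt.inv (by fun_prop) fun h => ?_) (hg z hz'.le)
        rw [sub_eq_zero.1 h] at hz'
        exact hl hz'
  · intro l _
    refine ContinuousOn.circleIntegrable hρ.le ?_
    refine continuousOn_const.mul (ContinuousOn.mul (ContinuousOn.inv₀ (by fun_prop)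
      fun z hz h => ?_) (hcont.mono Metric.sphere_subset_closedBall))
    rw [sub_eq_zero.1 h] at hz
    exact hpρ l (by simpa using hz)

/-- Simple poles at distinct points where the numerator vanishes do not contribute. -/
theorem circleIntegral_div_prod_eq_zero {ι : Type*} [DecidableEq ι] (s : Finset ι) {ρ : ℝ}
    (hρ : 0 < ρ) (p : ι → ℂ) (hp : Set.InjOn p s) (hpρ : ∀ l ∈ s, ‖p l‖ ≠ ρ) {g : ℂ → ℂ}
    (hg : ∀ z, ‖z‖ ≤ ρ → DifferentiableAt ℂ g z) (hg0 : ∀ l ∈ s, ‖p l‖ < ρ → g (p l) = 0) :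
    ∮ z in C(0, ρ), g z / ∏ l ∈ s, (z - p l) = 0 := by
  rcases s.eq_empty_or_nonempty with rfl | hs
  · simp only [Finset.prod_empty, div_one]
    refine Complex.circleIntegral_eq_zero_of_differentiable_on_off_countable hρ.le
      Set.countable_empty (fun z hz => (hg z (by simpa using hz)).continuousAt.continuousWithinAt)
      fun z hz => hg z (by simpa using (Metric.ball_subset_closedBall hz.1))
  · have : Nonempty s := hs.to_subtype
    have h := circleIntegral_div_prod hρ (fun l : s => p l) (fun a b h =>
      Subtype.ext (hp a.2 b.2 h)) (fun l => hpρ l l.2) hg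
    have h2 : ∀ z, ∏ l : s, (z - p l) = ∏ l ∈ s, (z - p l) := fun z =>
      Finset.prod_coe_sort s fun l => z - p l
    simp only [h2] at h
    rw [Finset.sum_eq_zero (fun l _ => by
      split_ifs with hl
      · rw [hg0 l l.2 hl, zero_mul]
      · rfl)] at h
    exact (mul_eq_zero.1 h).resolve_left (inv_ne_zero Complex.two_pi_I_ne_zero)

/-- The mean of `z g(z)` over a circle vanishes if `g` is holomorphic in the disc. -/
theorem integral_circ_mul_eq_zero {ρ : ℝ} (hρ : 0 < ρ) {f g : ℂ → ℂ}
    (hg : ∀ z, ‖z‖ ≤ ρ → DifferentiableAt ℂ g z) (hfg : ∀ z, ‖z‖ = ρ → f z = z * g z) :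
    ∫ z, f z ∂circ ρ = 0 := by
  have hcont : ContinuousOn g (Metric.sphere 0 ρ) := fun z hz =>
    (hg z (by simpa using hz.le)).continuousAt.continuousWithinAt
  rw [integral_circ hρ ((continuousOn_id.mul hcont).congr fun z hz => hfg z (by simpa using hz))]
  rw [circleIntegral.integral_congr hρ.le (g := g) fun z hz => ?_]
  · have := circleIntegral_div_prod_eq_zero (∅ : Finset ℕ) hρ (fun _ => 0) (by simp) (by simp)
      hg (by simp)
    simp only [Finset.prod_empty, div_one] at this
    rw [this, mul_zero]
  · have hz' : ‖z‖ = ρ := by simpa using hz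
    have hz0 : z ≠ 0 := norm_ne_zero_iff.1 (by rw [hz']; exact hρ.ne')
    rw [hfg z hz', inv_mul_cancel_left₀ hz0]

/-- The mean of a function that is holomorphic in an annulus does not depend on the radius. -/
theorem integral_circ_eq_of_le {r R : ℝ} (hr : 0 < r) (hrR : r ≤ R) {f : ℂ → ℂ}
    (hf : ∀ z, r ≤ ‖z‖ → ‖z‖ ≤ R → DifferentiableAt ℂ f z) :
    ∫ z, f z ∂circ R = ∫ z, f z ∂circ r := by
  have hR := hr.trans_le hrR
  have hs : ∀ s, r ≤ s → s ≤ R → ContinuousOn f (Metric.sphere 0 s) := fun s h1 h2 z hz => by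
    have hz' : ‖z‖ = s := by simpa using hz
    exact (hf z (by rwa [hz']) (by rwa [hz'])).continuousAt.continuousWithinAt
  rw [integral_circ hr (hs r le_rfl hrR), integral_circ hR (hs R hrR le_rfl)]
  congr 1
  have h := Complex.circleIntegral_sub_center_inv_smul_eq_of_differentiable_on_annulus_off_countable
    (c := 0) hr hrR (f := f) (s := ∅) Set.countable_empty ?_ ?_
  · simpa using h
  · intro z hz
    have h1 : ‖z‖ ≤ R := by simpa using hz.1
    have h2 : r ≤ ‖z‖ := by simpa using hz.2
    exact (hf z h2 h1).continuousAt.continuousWithinAt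
  · intro z hz
    have h1 : ‖z‖ < R := by simpa using hz.1.1
    have h2 : r < ‖z‖ := by simpa using hz.1.2
    exact hf z h2.le h1.le

/-- The mean over a torus does not change if the radii of the circles are decreased within the
domain of holomorphy. -/
theorem integral_torus_eq_of_le {n : ℕ} {r : ℝ} (ρ : Fin n → ℝ) (hρ : ∀ j, 0 < ρ j)
    (hρr : ∀ j, ρ j ≤ r) {f : (Fin n → ℂ) → ℂ}
    (hc : ContinuousOn f {ξ | ∀ j, ξ j ≠ 0 ∧ ‖ξ j‖ ≤ r})
    (hd : ∀ ξ : Fin n → ℂ, (∀ j, ξ j ≠ 0 ∧ ‖ξ j‖ ≤ r) → ∀ i,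
      DifferentiableAt ℂ (fun z => f (Function.update ξ i z)) (ξ i)) :
    ∫ ξ, f ξ ∂torus (fun _ : Fin n => r) = ∫ ξ, f ξ ∂torus ρ := by
  classical
  -- The radii are moved one at a time; `s` is the set of indices already moved.
  have key : ∀ s : Finset (Fin n),
      ∫ ξ, f ξ ∂torus (fun j => if j ∈ s then ρ j else r) = ∫ ξ, f ξ ∂torus (fun _ => r) := by
    intro s
    induction s using Finset.induction_on with
    | empty => simp
    | insert a s ha ih =>
      rw [← ih]
      have hr : 0 < r := (hρ a).trans_le (hρr a)
      set ρ₁ : Fin n → ℝ := fun j => if j ∈ s then ρ j else r with hρ₁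
      set ρ₂ : Fin n → ℝ := fun j => if j ∈ insert a s then ρ j else r with hρ₂
      have hp1 : ∀ j, 0 < ρ₁ j ∧ ρ₁ j ≤ r := fun j => by
        simp only [hρ₁]; split_ifs
        exacts [⟨hρ j, hρr j⟩, ⟨hr, le_rfl⟩]
      have hp2 : ∀ j, 0 < ρ₂ j ∧ ρ₂ j ≤ r := fun j => by
        simp only [hρ₂]; split_ifs
        exacts [⟨hρ j, hρr j⟩, ⟨hr, le_rfl⟩]
      have hsub : ∀ ρ' : Fin n → ℝ, (∀ j, 0 < ρ' j ∧ ρ' j ≤ r) →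
          torusSet ρ' ⊆ {ξ | ∀ j, ξ j ≠ 0 ∧ ‖ξ j‖ ≤ r} := fun ρ' h ξ hξ j =>
        ⟨norm_ne_zero_iff.1 (by rw [hξ j]; exact (h j).1.ne'), by rw [hξ j]; exact (h j).2⟩
      have hI1 := integrable_torus (fun j => (hp1 j).1) (hc.mono (hsub ρ₁ hp1))
      have hI2 := integrable_torus (fun j => (hp2 j).1) (hc.mono (hsub ρ₂ hp2))
      have h21 : ρ₂ = Function.update ρ₁ a (ρ a) := by
        ext j
        by_cases hj : j = a
        · subst hj; simp [hρ₂]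
        · simp [hρ₁, hρ₂, hj]
      have h1a : ρ₁ a = r := by simp [hρ₁, ha]
      have hinner : ∀ ξ ∈ torusSet ρ₁, ∫ z, f (Function.update ξ a z) ∂circ r =
          ∫ z, f (Function.update ξ a z) ∂circ (ρ a) := by
        intro ξ hξ
        refine integral_circ_eq_of_le (hρ a) (hρr a) fun z hz1 hz2 => ?_
        have h := hd (Function.update ξ a z) (fun j => ?_) a
        · simpa using h
        · by_cases hj : j = a
          · subst hj
            simpa using ⟨norm_ne_zero_iff.1 ((hρ j).trans_le hz1).ne', hz2⟩
          · simpa [hj] using hsub ρ₁ hp1 hξ j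
      have h1 := integral_torus_update ρ₁ a r (f := f)
      rw [← h1a, Function.update_eq_self, h1a] at h1
      rw [h21] at hI2 ⊢
      rw [integral_torus_update ρ₁ a (ρ a) hI2, h1 hI1,
        integral_congr_ae ((ae_torus fun j => (hp1 j).1).mono hinner)]
  have h := key Finset.univ
  simpa using h.symm

/-! ### The dependence of the Bethe wave function on its last variable -/

/-- The permutations are sorted by the position `p` of the particle that carries the last variable.
-/
theorem bethe_snoc {n : ℕ} (Δ : ℝ) (x : Fin (n + 1) → ℤ) (ξ : Fin n → ℂ) (z : ℂ) :
    bethe Δ x (Fin.snoc ξ z) = ∑ p : Fin (n + 1), ∑ σ : Equiv.Perm (Fin n),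
      (-1) ^ (p + n : ℕ) * ((Equiv.Perm.sign σ : ℤ) : ℂ) * betheDenom Δ (fun j => ξ (σ j)) *
        (∏ j, ξ (σ j) ^ x (p.succAbove j)) * z ^ x p *
          ∏ j : Fin n, if j.castSucc < p then scat Δ (ξ (σ j)) z else scat Δ z (ξ (σ j)) := by
  rw [bethe, sum_perm_eq_sum_insertPerm_left (Fin.last n)]
  refine Finset.sum_congr rfl fun p _ => Finset.sum_congr rfl fun σ _ => ?_
  rw [betheDenom_succAbove Δ p, Fin.prod_univ_succAbove _ p, sign_insertPerm]
  simp only [insertPerm_apply_self, insertPerm_apply_succAbove, Fin.succAbove_last, Fin.snoc_last,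
    Fin.snoc_castSucc]
  push_cast
  ring

theorem betheDenom_snoc {n : ℕ} (Δ : ℝ) (ξ : Fin n → ℂ) (z : ℂ) :
    betheDenom Δ (Fin.snoc ξ z : Fin (n + 1) → ℂ) = betheDenom Δ ξ * ∏ l, scat Δ (ξ l) z := by
  rw [betheDenom_succAbove Δ (Fin.last n)]
  simp [Fin.castSucc_lt_last]

/-- A summand of `w^{n + c} bethe (ξ, 1/w)`. -/
def lastTerm {n : ℕ} (Δ : ℝ) (x : Fin (n + 1) → ℤ) (c : ℤ) (ξ : Fin n → ℂ) (w : ℂ)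
    (p : Fin (n + 1)) (σ : Equiv.Perm (Fin n)) : ℂ :=
  (-1) ^ (p + n : ℕ) * ((Equiv.Perm.sign σ : ℤ) : ℂ) * betheDenom Δ (fun j => ξ (σ j)) *
    (∏ j, ξ (σ j) ^ x (p.succAbove j)) * w ^ (c - x p).toNat *
      ∏ j : Fin n, if j.castSucc < p then w * (1 - 2 * Δ * ξ (σ j)) + ξ (σ j)
        else w + ξ (σ j) - 2 * Δ

/-- The polynomial `w^{n + c} bethe (ξ, 1/w)` in `w`. -/
def lastPoly {n : ℕ} (Δ : ℝ) (x : Fin (n + 1) → ℤ) (c : ℤ) (ξ : Fin n → ℂ) (w : ℂ) : ℂ :=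
  ∑ p, ∑ σ, lastTerm Δ x c ξ w p σ

/-- Each of the `n` two-body factors containing the last variable becomes linear in `w` after
multiplication by `w`, and `x_p ≤ c` makes the exponents `c - x_p` natural numbers. -/
theorem lastPoly_eq {n : ℕ} (Δ : ℝ) (x : Fin (n + 1) → ℤ) (c : ℤ) (hc : ∀ p, x p ≤ c)
    (ξ : Fin n → ℂ) {w : ℂ} (hw : w ≠ 0) :
    lastPoly Δ x c ξ w = w ^ n * w ^ c * bethe Δ x (Fin.snoc ξ w⁻¹) := by
  rw [lastPoly, bethe_snoc, Finset.mul_sum]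
  refine Finset.sum_congr rfl fun p _ => ?_
  rw [Finset.mul_sum]
  refine Finset.sum_congr rfl fun σ _ => ?_
  rw [lastTerm]
  have h1 : w ^ (c - x p).toNat = w ^ c * w⁻¹ ^ x p := by
    rw [← zpow_natCast, Int.toNat_of_nonneg (by have := hc p; omega), zpow_sub₀ hw, inv_zpow,
      div_eq_mul_inv]
  have h2 : (∏ j : Fin n, if j.castSucc < p then w * (1 - 2 * Δ * ξ (σ j)) + ξ (σ j)
        else w + ξ (σ j) - 2 * Δ) = w ^ n * ∏ j : Fin n, if j.castSucc < p
          then scat Δ (ξ (σ j)) w⁻¹ else scat Δ w⁻¹ (ξ (σ j)) := by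
    rw [← Fin.prod_const, ← Finset.prod_mul_distrib]
    refine Finset.prod_congr rfl fun j _ => ?_
    unfold scat
    split_ifs
    · field_simp; ring
    · field_simp
  rw [h1, h2]
  ring

/-- At `w = 0` only terms with `x_p = c` survive; since `x` is strictly increasing and bounded by
`c`, this forces `p` to be the last particle. -/
theorem lastPoly_zero {n : ℕ} (Δ : ℝ) (x : Fin (n + 1) → ℤ) (c : ℤ) (hx : StrictMono x)
    (hc : x (Fin.last n) ≤ c) (ξ : Fin n → ℂ) :
    lastPoly Δ x c ξ 0 = if x (Fin.last n) = c then
      (∏ j, ξ j) * bethe Δ (fun j => x j.castSucc) ξ else 0 := by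
  have h0 : ∀ p : Fin (n + 1), x p ≠ c → ∀ σ, lastTerm Δ x c ξ 0 p σ = 0 := fun p hp σ => by
    have h1 : x p ≤ x (Fin.last n) := hx.monotone (Fin.le_last p)
    have h2 : (c - x p).toNat ≠ 0 := by omega
    rw [lastTerm, zero_pow h2]
    ring
  rw [lastPoly]
  split_ifs with h
  · rw [Finset.sum_eq_single (Fin.last n) (fun p _ hp => Finset.sum_eq_zero fun σ _ => h0 p
      (fun h' => hp (hx.injective (h'.trans h.symm))) σ) (by simp), bethe, Finset.mul_sum]
    refine Finset.sum_congr rfl fun σ _ => ?_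
    have h3 : ((-1 : ℂ)) ^ (n + n) = 1 := Even.neg_one_pow ⟨n, rfl⟩
    simp only [lastTerm, h, sub_self, Int.toNat_zero, pow_zero, Fin.castSucc_lt_last, if_true,
      zero_mul, zero_add, Fin.succAbove_last, Fin.val_last, h3]
    rw [Equiv.prod_comp σ ξ]
    ring
  · exact Finset.sum_eq_zero fun p _ => Finset.sum_eq_zero fun σ _ => h0 p (fun h' => h (by
      have h1 : x p ≤ x (Fin.last n) := hx.monotone (Fin.le_last p)
      omega)) σ

/-! ### The weight and its residues -/

/-- The integrand `bethe(ξ) / ∏_{j<k} (1 + ξ_j ξ_k - 2Δ ξ_j) ∏_j ξ_j^{-y_j}`. -/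
def waveWeight {n : ℕ} (Δ : ℝ) (x y : Fin n → ℤ) (ξ : Fin n → ℂ) : ℂ :=
  bethe Δ x ξ / betheDenom Δ ξ * ∏ j, ξ j ^ (-y j)

/-- The zero in `w` of `w + a - 2Δ a w`. -/
def poleAt (Δ : ℝ) (a : ℂ) : ℂ := -a / (1 - 2 * Δ * a)

/-- The residue of the integrand at the zero of `w (1 - 2Δ ξ_l) + ξ_l`, where `w` is the inverse
of the last variable. -/
def lastResidue {n : ℕ} (Δ : ℝ) (x : Fin (n + 1) → ℤ) (y : Fin n → ℤ) (c : ℤ) (l : Fin n)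
    (ξ : Fin n → ℂ) : ℂ :=
  (∏ j, ξ j ^ (-y j)) / betheDenom Δ ξ / (∏ j, (1 - 2 * Δ * ξ j)) *
    lastPoly Δ x c ξ (poleAt Δ (ξ l)) * (poleAt Δ (ξ l))⁻¹ *
      ∏ m ∈ Finset.univ.erase l, (poleAt Δ (ξ l) - poleAt Δ (ξ m))⁻¹

/-- The radius `r` is so small that no two-body factor vanishes in the closed disc. -/
def NoZero (Δ : ℝ) (r : ℝ) : Prop := ∀ a b : ℂ, ‖a‖ ≤ r → ‖b‖ ≤ r → scat Δ a b ≠ 0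

theorem NoZero.one_sub_ne_zero {Δ r : ℝ} (h : NoZero Δ r) {a : ℂ} (ha : ‖a‖ ≤ r) :
    1 - 2 * Δ * a ≠ 0 := by
  have := h a 0 ha (by simpa using (norm_nonneg a).trans ha)
  simpa [scat] using this

theorem NoZero.betheDenom_ne_zero {Δ r : ℝ} (h : NoZero Δ r) {n : ℕ} {ξ : Fin n → ℂ}
    (hξ : ∀ j, ‖ξ j‖ ≤ r) : betheDenom Δ ξ ≠ 0 :=
  Finset.prod_ne_zero_iff.2 fun j _ => Finset.prod_ne_zero_iff.2 fun k _ => h _ _ (hξ j) (hξ k)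

/-- If the pole `u` had modulus at least `s⁻¹`, then `u⁻¹` would lie in the disc of radius `r` and
`(a, u⁻¹)` would be a zero of `scat`. So all poles in `w` are inside the circle of radius `s⁻¹`. -/
theorem NoZero.norm_poleAt_lt {Δ r : ℝ} (h : NoZero Δ r) {a : ℂ} (ha : ‖a‖ ≤ r) {s : ℝ}
    (hs : 0 < s) (hsr : s ≤ r) : ‖poleAt Δ a‖ < s⁻¹ := by
  by_contra hlt
  rw [not_lt] at hlt
  have hu : poleAt Δ a ≠ 0 := norm_ne_zero_iff.1 ((inv_pos.2 hs).trans_le hlt).ne'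
  have h1 := h a (poleAt Δ a)⁻¹ ha (by
    rw [norm_inv]
    exact (inv_le_of_inv_le₀ hs hlt).trans hsr)
  have h2 := h.one_sub_ne_zero ha
  have ha0 : a ≠ 0 := fun h0 => hu (by simp [poleAt, h0])
  apply h1
  rw [scat, poleAt, inv_div]
  field_simp
  ring

theorem continuous_betheDenom {n : ℕ} (Δ : ℝ) : Continuous (betheDenom (N := n) Δ) := by
  unfold betheDenom
  fun_prop

theorem continuousOn_bethe {n : ℕ} (Δ : ℝ) (x : Fin n → ℤ) :
    ContinuousOn (bethe Δ x) {ξ | ∀ j, ξ j ≠ 0} := by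
  unfold bethe
  refine continuousOn_finsetSum _ fun σ _ => ContinuousOn.mul ?_ ?_
  · exact (continuous_const.mul ((continuous_betheDenom Δ).comp (by fun_prop))).continuousOn
  · exact continuousOn_finsetProd _ fun j _ => ContinuousOn.zpow₀ (by fun_prop) _
      fun ξ hξ => Or.inl (hξ _)

theorem continuousOn_prod_zpow {n : ℕ} (y : Fin n → ℤ) :
    ContinuousOn (fun ξ : Fin n → ℂ => ∏ j, ξ j ^ y j) {ξ | ∀ j, ξ j ≠ 0} :=
  continuousOn_finsetProd _ fun j _ => ContinuousOn.zpow₀ (by fun_prop) _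
      fun ξ hξ => Or.inl (hξ _)

theorem continuousOn_waveWeight {n : ℕ} (Δ : ℝ) (x y : Fin n → ℤ) :
    ContinuousOn (waveWeight Δ x y) {ξ | (∀ j, ξ j ≠ 0) ∧ betheDenom Δ ξ ≠ 0} :=
  (((continuousOn_bethe Δ x).mono fun _ h => h.1).div (continuous_betheDenom Δ).continuousOn
    fun _ h => h.2).mul ((continuousOn_prod_zpow _).mono fun _ h => h.1)

theorem ne_zero_of_mem_torusSet {n : ℕ} {ρ : Fin n → ℝ} (hρ : ∀ j, 0 < ρ j) {ξ : Fin n → ℂ}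
    (hξ : ξ ∈ torusSet ρ) (j : Fin n) : ξ j ≠ 0 :=
  norm_ne_zero_iff.1 (by rw [hξ j]; exact (hρ j).ne')

theorem poleAt_sub_poleAt {Δ : ℝ} {a b : ℂ} (ha : 1 - 2 * Δ * a ≠ 0) (hb : 1 - 2 * Δ * b ≠ 0) :
    poleAt Δ a - poleAt Δ b = -(a - b) / ((1 - 2 * Δ * a) * (1 - 2 * Δ * b)) := by
  rw [poleAt, poleAt, div_sub_div _ _ ha hb]
  congr 1
  ring

theorem poleAt_ne_zero {Δ : ℝ} {a : ℂ} (h0 : a ≠ 0) (ha : 1 - 2 * Δ * a ≠ 0) :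
    poleAt Δ a ≠ 0 := div_ne_zero (neg_ne_zero.2 h0) ha

/-- Distinct radii keep `ξ_l ≠ ξ_m` on the torus, so the differences of poles do not vanish there.
-/
theorem continuousOn_lastResidue {n : ℕ} {Δ r : ℝ} (hr : NoZero Δ r) (x : Fin (n + 1) → ℤ)
    (y : Fin n → ℤ) (c : ℤ) (l : Fin n) {ρ : Fin n → ℝ} (hρ : ∀ j, 0 < ρ j) (hρr : ∀ j, ρ j ≤ r)
    (hinj : Function.Injective ρ) :
    ContinuousOn (lastResidue Δ x y c l) (torusSet ρ) := by
  have h0 : ∀ ξ ∈ torusSet ρ, ∀ j, ξ j ≠ 0 := fun ξ hξ => ne_zero_of_mem_torusSet hρ hξ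
  have hle : ∀ ξ ∈ torusSet ρ, ∀ j, ‖ξ j‖ ≤ r := fun ξ hξ j => (hξ j).le.trans (hρr j)
  have h1 : ∀ ξ ∈ torusSet ρ, ∀ j, 1 - 2 * Δ * ξ j ≠ 0 := fun ξ hξ j =>
    hr.one_sub_ne_zero (hle ξ hξ j)
  have hpole : ∀ j, ContinuousOn (fun ξ : Fin n → ℂ => poleAt Δ (ξ j)) (torusSet ρ) := fun j =>
    ContinuousOn.div (by fun_prop) (by fun_prop) fun ξ hξ => h1 ξ hξ j
  have hpoly : ContinuousOn (fun ξ : Fin n → ℂ => lastPoly Δ x c ξ (poleAt Δ (ξ l)))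
      (torusSet ρ) := by
    unfold lastPoly lastTerm
    refine continuousOn_finsetSum _ fun p _ => continuousOn_finsetSum _ fun σ _ =>
      ContinuousOn.mul (ContinuousOn.mul (ContinuousOn.mul ?_ ?_) ?_) ?_
    · exact (continuous_const.mul ((continuous_betheDenom Δ).comp (by fun_prop))).continuousOn
    · exact continuousOn_finsetProd _ fun j _ => ContinuousOn.zpow₀ (by fun_prop) _
        fun ξ hξ => Or.inl (h0 ξ hξ _)
    · exact (hpole l).pow _
    · refine continuousOn_finsetProd _ fun j _ => ?_
      split_ifs
      · exact ((hpole l).mul (by fun_prop)).add (by fun_prop)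
      · exact ((hpole l).add (by fun_prop)).sub (by fun_prop)
  refine ContinuousOn.mul (ContinuousOn.mul (ContinuousOn.mul (ContinuousOn.div (ContinuousOn.div
    ((continuousOn_prod_zpow _).mono fun ξ hξ => h0 ξ hξ) (continuous_betheDenom Δ).continuousOn
      fun ξ hξ => hr.betheDenom_ne_zero (hle ξ hξ)) (by fun_prop)
      fun ξ hξ => Finset.prod_ne_zero_iff.2 fun j _ => h1 ξ hξ j) hpoly) ?_) ?_
  · exact (hpole l).inv₀ fun ξ hξ => poleAt_ne_zero (h0 ξ hξ l) (h1 ξ hξ l)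
  · refine continuousOn_finsetProd _ fun m hm => ((hpole l).sub (hpole m)).inv₀ fun ξ hξ h => ?_
    change poleAt Δ (ξ l) - poleAt Δ (ξ m) = 0 at h
    rw [poleAt_sub_poleAt (h1 ξ hξ l) (h1 ξ hξ m), div_eq_zero_iff] at h
    rcases h with h | h
    · have h2 : ξ l = ξ m := by linear_combination -h
      refine Finset.ne_of_mem_erase hm (hinj ?_)
      rw [← hξ l, ← hξ m, h2]
    · exact mul_ne_zero (h1 ξ hξ l) (h1 ξ hξ m) h

/-! ### The residues integrate to zero -/

theorem differentiableAt_betheDenom {n : ℕ} (Δ : ℝ) {η : ℂ → Fin n → ℂ} {z : ℂ}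
    (hη : ∀ j, DifferentiableAt ℂ (fun s => η s j) z) :
    DifferentiableAt ℂ (fun s => betheDenom Δ (η s)) z := by
  unfold betheDenom
  exact DifferentiableAt.fun_finsetProd fun j _ => DifferentiableAt.fun_finsetProd fun k _ =>
    (((differentiableAt_const _).add ((hη j).mul (hη k))).sub
      ((differentiableAt_const _).mul (hη j)))

theorem differentiableAt_update {n : ℕ} (ξ : Fin n → ℂ) (l j : Fin n) (z : ℂ) :
    DifferentiableAt ℂ (fun s => Function.update ξ l s j) z := by
  by_cases h : j = l
  · subst h; simp
  · simp [h]

/-- A summand of the residue, divided by the integration variable, as a function that is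
holomorphic in the disc. -/
def residueTerm {n : ℕ} (Δ : ℝ) (x : Fin (n + 1) → ℤ) (y : Fin n → ℤ) (c : ℤ) (l : Fin n)
    (ξ : Fin n → ℂ) (p : Fin (n + 1)) (σ : Equiv.Perm (Fin n)) (s : ℂ) : ℂ :=
  if (σ.symm l).castSucc < p then 0 else
    (-1) ^ (p + n : ℕ) * ((Equiv.Perm.sign σ : ℤ) : ℂ) *
      betheDenom Δ (fun j => Function.update ξ l s (σ j)) *
      (∏ j ∈ Finset.univ.erase (σ.symm l), ξ (σ j) ^ x (p.succAbove j)) *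
      (s ^ (x (p.succAbove (σ.symm l)) - y l + (c - x p) - 2).toNat *
        (-(1 - 2 * Δ * s)⁻¹) ^ ((c - x p).toNat - 1)) *
      ∏ j : Fin n, if j.castSucc < p then
        poleAt Δ s * (1 - 2 * Δ * Function.update ξ l s (σ j)) + Function.update ξ l s (σ j)
        else poleAt Δ s + Function.update ξ l s (σ j) - 2 * Δ

/-- If the particle carrying `ξ_l` is to the left of the one carrying the last variable, the summand
contains `w (1 - 2Δ s) + s`, which vanishes at the pole. Otherwise it sits at some `x_{p'} > x_p`,
and the power of `s` is `x_{p'} - y_l + c - x_p - 1 ≥ 1`, because `y_l < c` as well. One factor `s`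
can therefore be extracted, and neither `toNat` nor the natural subtraction truncates. -/
theorem lastTerm_update_eq {n : ℕ} {Δ : ℝ} {x : Fin (n + 1) → ℤ} {y : Fin n → ℤ} {c : ℤ}
    (hx : StrictMono x) (hc : x (Fin.last n) ≤ c) {l : Fin n} (hy : y l < c) (ξ : Fin n → ℂ)
    (p : Fin (n + 1)) (σ : Equiv.Perm (Fin n)) {s : ℂ} (hs : s ≠ 0) (hs1 : 1 - 2 * Δ * s ≠ 0) :
    s ^ (-y l) * (poleAt Δ s)⁻¹ * lastTerm Δ x c (Function.update ξ l s) (poleAt Δ s) p σ =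
      s * residueTerm Δ x y c l ξ p σ s := by
  rw [residueTerm, lastTerm]
  split_ifs with h
  · have h1 : (∏ j : Fin n, if j.castSucc < p then
        poleAt Δ s * (1 - 2 * Δ * Function.update ξ l s (σ j)) + Function.update ξ l s (σ j)
        else poleAt Δ s + Function.update ξ l s (σ j) - 2 * Δ) = 0 := by
      refine Finset.prod_eq_zero (Finset.mem_univ (σ.symm l)) ?_
      rw [if_pos h, Equiv.apply_symm_apply, Function.update_self, poleAt, div_mul_cancel₀ _ hs1]
      ring
    rw [h1]
    ring
  · set j₀ := σ.symm l with hj₀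
    have hp : p < p.succAbove j₀ := by
      rw [Fin.lt_succAbove_iff_le_castSucc]; exact not_lt.1 h
    have h1 : x p < x (p.succAbove j₀) := hx hp
    have h2 : x (p.succAbove j₀) ≤ x (Fin.last n) := hx.monotone (Fin.le_last _)
    have h3 : ∏ j, Function.update ξ l s (σ j) ^ x (p.succAbove j) =
        s ^ x (p.succAbove j₀) * ∏ j ∈ Finset.univ.erase j₀, ξ (σ j) ^ x (p.succAbove j) := by
      rw [← Finset.mul_prod_erase _ _ (Finset.mem_univ j₀)]
      congr 1
      · rw [hj₀, Equiv.apply_symm_apply, Function.update_self]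
      · refine Finset.prod_congr rfl fun j hj => ?_
        rw [Function.update_of_ne]
        intro h'
        exact Finset.ne_of_mem_erase hj (by rw [hj₀, ← h', Equiv.symm_apply_apply])
    have h4 : s ^ (-y l) * (poleAt Δ s)⁻¹ * (s ^ x (p.succAbove j₀) *
        poleAt Δ s ^ (c - x p).toNat) =
        s * (s ^ (x (p.succAbove j₀) - y l + (c - x p) - 2).toNat *
        (-(1 - 2 * Δ * s)⁻¹) ^ ((c - x p).toNat - 1)) := by
      have hu : poleAt Δ s ≠ 0 := poleAt_ne_zero hs hs1
      obtain ⟨k, hk⟩ : ∃ k : ℕ, (c - x p).toNat = k + 1 := ⟨(c - x p).toNat - 1, by omega⟩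
      have hpow : poleAt Δ s ^ k = s ^ k * (-(1 - 2 * Δ * s)⁻¹) ^ k := by
        rw [← mul_pow, poleAt, div_eq_mul_inv]
        congr 1
        ring
      rw [hk, pow_succ, Nat.add_sub_cancel, hpow]
      have h5 : s ^ (-y l) * s ^ x (p.succAbove j₀) * s ^ k =
          s * s ^ (x (p.succAbove j₀) - y l + (c - x p) - 2).toNat := by
        rw [← zpow_natCast s k, ← zpow_natCast s (Int.toNat _), ← zpow_add₀ hs, ← zpow_add₀ hs,
          ← zpow_one_add₀ hs]
        congr 1
        omega
      field_simp
      linear_combination (-(1 - 2 * Δ * s)⁻¹) ^ k * h5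
    rw [h3]
    linear_combination ((-1) ^ (p + n : ℕ) * ((Equiv.Perm.sign σ : ℤ) : ℂ) *
      betheDenom Δ (fun j => Function.update ξ l s (σ j)) *
      (∏ j ∈ Finset.univ.erase j₀, ξ (σ j) ^ x (p.succAbove j)) *
      ∏ j : Fin n, if j.castSucc < p then
        poleAt Δ s * (1 - 2 * Δ * Function.update ξ l s (σ j)) + Function.update ξ l s (σ j)
        else poleAt Δ s + Function.update ξ l s (σ j) - 2 * Δ) * h4

theorem differentiableAt_poleAt {Δ : ℝ} {s : ℂ} (hs : 1 - 2 * Δ * s ≠ 0) :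
    DifferentiableAt ℂ (poleAt Δ) s := by
  unfold poleAt
  exact DifferentiableAt.div (by fun_prop) (by fun_prop) hs

theorem differentiableAt_residueTerm {n : ℕ} (Δ : ℝ) (x : Fin (n + 1) → ℤ) (y : Fin n → ℤ) (c : ℤ)
    (l : Fin n) (ξ : Fin n → ℂ) (p : Fin (n + 1)) (σ : Equiv.Perm (Fin n)) {s : ℂ}
    (hs : 1 - 2 * Δ * s ≠ 0) : DifferentiableAt ℂ (residueTerm Δ x y c l ξ p σ) s := by
  unfold residueTerm
  split_ifs with h
  · exact differentiableAt_const _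
  have hu := fun j => differentiableAt_update ξ l j s
  have hp := differentiableAt_poleAt hs
  refine DifferentiableAt.mul (DifferentiableAt.mul (DifferentiableAt.mul ?_
    (differentiableAt_const _)) ?_) ?_
  · exact (differentiableAt_const _).mul (differentiableAt_betheDenom Δ fun j => hu _)
  · have hd : DifferentiableAt ℂ (fun s : ℂ => 1 - 2 * Δ * s) s := by fun_prop
    exact DifferentiableAt.mul (by fun_prop) ((hd.inv hs).neg.pow _)
  · refine DifferentiableAt.fun_finsetProd fun j _ => ?_
    split_ifs
    · exact (hp.mul ((differentiableAt_const _).sub ((differentiableAt_const _).mul (hu _)))).add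
        (hu _)
    · exact (hp.add (hu _)).sub (differentiableAt_const _)

/-- On the circle of `s = ξ_l` the residue is `s` times a function whose only poles in the disc are
simple ones at points `ξ_m`, `m ≠ l`, from the differences of the poles in `w`. They are cancelled,
as two arguments of `bethe` coincide at `s = ξ_m`. So the mean over this circle is zero. -/
theorem integral_lastResidue {n : ℕ} {Δ r : ℝ} (hr : NoZero Δ r) {x : Fin (n + 1) → ℤ}
    {y : Fin n → ℤ} {c : ℤ} (hx : StrictMono x) (hc : x (Fin.last n) ≤ c) {l : Fin n}
    (hy : y l < c) {ρ : Fin n → ℝ} (hρ : ∀ j, 0 < ρ j) (hρr : ∀ j, ρ j ≤ r)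
    (hinj : Function.Injective ρ) : ∫ ξ, lastResidue Δ x y c l ξ ∂torus ρ = 0 := by
  have hcont := continuousOn_lastResidue hr x y c l hρ hρr hinj
  refine integral_torus_eq_zero hρ l hcont fun ξ hξ => ?_
  have hξ0 := ne_zero_of_mem_torusSet hρ hξ
  have hξr : ∀ j, ‖ξ j‖ ≤ r := fun j => (hξ j).le.trans (hρr j)
  have hξ1 : ∀ j, 1 - 2 * Δ * ξ j ≠ 0 := fun j => hr.one_sub_ne_zero (hξr j)
  have hle : ∀ s : ℂ, ‖s‖ ≤ ρ l → ∀ j, ‖Function.update ξ l s j‖ ≤ r := fun s hs j => by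
    by_cases h : j = l
    · subst h; simpa using hs.trans (hρr j)
    · simpa [h] using hξr j
  set E := Finset.univ.erase l with hE
  set A : ℂ → ℂ := fun s => (∏ j ∈ E, ξ j ^ (-y j)) / betheDenom Δ (Function.update ξ l s) /
    (∏ j, (1 - 2 * Δ * Function.update ξ l s j)) with hA
  set H : ℂ → ℂ := fun s => A s * ∑ p, ∑ σ, residueTerm Δ x y c l ξ p σ s with hH
  -- By `poleAt_sub_poleAt` the inverse differences of poles multiply to `W s / ∏ (s - ξ_m)`.
  set W : ℂ → ℂ := fun s => ∏ m ∈ E, (-((1 - 2 * Δ * s) * (1 - 2 * Δ * ξ m))) with hW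
  have hbase : ∀ s : ℂ, s ≠ 0 → ‖s‖ ≤ ρ l →
      (∏ j, Function.update ξ l s j ^ (-y j)) / betheDenom Δ (Function.update ξ l s) /
        (∏ j, (1 - 2 * Δ * Function.update ξ l s j)) *
        lastPoly Δ x c (Function.update ξ l s) (poleAt Δ s) * (poleAt Δ s)⁻¹ = s * H s := by
    intro s hs hsr
    have hs1 : 1 - 2 * Δ * s ≠ 0 := hr.one_sub_ne_zero (hsr.trans (hρr l))
    have h1 : ∏ j, Function.update ξ l s j ^ (-y j) = s ^ (-y l) * ∏ j ∈ E, ξ j ^ (-y j) := by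
      rw [← Finset.mul_prod_erase _ _ (Finset.mem_univ l), Function.update_self]
      congr 1
      refine Finset.prod_congr rfl fun j hj => ?_
      rw [Function.update_of_ne (Finset.ne_of_mem_erase hj)]
    have h2 : s ^ (-y l) * (poleAt Δ s)⁻¹ * lastPoly Δ x c (Function.update ξ l s) (poleAt Δ s) =
        s * ∑ p, ∑ σ, residueTerm Δ x y c l ξ p σ s := by
      rw [lastPoly, Finset.mul_sum, Finset.mul_sum]
      refine Finset.sum_congr rfl fun p _ => ?_
      rw [Finset.mul_sum, Finset.mul_sum]
      exact Finset.sum_congr rfl fun σ _ => lastTerm_update_eq hx hc hy ξ p σ hs hs1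
    rw [h1]
    simp only [hH, hA]
    linear_combination ((∏ j ∈ E, ξ j ^ (-y j)) / betheDenom Δ (Function.update ξ l s) /
      (∏ j, (1 - 2 * Δ * Function.update ξ l s j))) * h2
  have hres : ∀ s : ℂ, ‖s‖ = ρ l → lastResidue Δ x y c l (Function.update ξ l s) =
      s * ((H s * W s) / ∏ m ∈ E, (s - ξ m)) := by
    intro s hs
    have hs0 : s ≠ 0 := norm_ne_zero_iff.1 (by rw [hs]; exact (hρ l).ne')
    have hs1 : 1 - 2 * Δ * s ≠ 0 := hr.one_sub_ne_zero (hs.le.trans (hρr l))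
    have h1 : ∏ m ∈ Finset.univ.erase l, (poleAt Δ s - poleAt Δ (Function.update ξ l s m))⁻¹ =
        W s / ∏ m ∈ E, (s - ξ m) := by
      rw [hW, ← Finset.prod_div_distrib]
      refine Finset.prod_congr rfl fun m hm => ?_
      rw [Function.update_of_ne (Finset.ne_of_mem_erase hm), poleAt_sub_poleAt hs1 (hξ1 m),
        inv_div, div_neg, neg_div]
    rw [lastResidue, Function.update_self, h1, hbase s hs0 hs.le]
    ring
  have hHd : ∀ s, ‖s‖ ≤ ρ l → DifferentiableAt ℂ (fun s => H s * W s) s := by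
    intro s hs
    have hs1 : 1 - 2 * Δ * s ≠ 0 := hr.one_sub_ne_zero (hs.trans (hρr l))
    have hu := fun j => differentiableAt_update ξ l j s
    refine DifferentiableAt.mul (DifferentiableAt.mul ?_ ?_) ?_
    · refine DifferentiableAt.div (DifferentiableAt.div (differentiableAt_const _)
        (differentiableAt_betheDenom Δ hu) (hr.betheDenom_ne_zero (hle s hs)))
        (DifferentiableAt.fun_finsetProd fun j _ => (differentiableAt_const _).sub
          ((differentiableAt_const _).mul (hu j)))
        (Finset.prod_ne_zero_iff.2 fun j _ => hr.one_sub_ne_zero (hle s hs j))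
    · exact DifferentiableAt.fun_sum fun p _ => DifferentiableAt.fun_sum fun σ _ =>
        differentiableAt_residueTerm Δ x y c l ξ p σ hs1
    · exact DifferentiableAt.fun_finsetProd fun m _ => by fun_prop
  have hH0 : ∀ m ∈ E, ‖ξ m‖ < ρ l → H (ξ m) * W (ξ m) = 0 := by
    intro m hm hml
    have hne : m ≠ l := Finset.ne_of_mem_erase hm
    have hu : poleAt Δ (ξ m) ≠ 0 := poleAt_ne_zero (hξ0 m) (hξ1 m)
    have hb : bethe Δ x (Fin.snoc (Function.update ξ l (ξ m)) (poleAt Δ (ξ m))⁻¹) = 0 := by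
      refine bethe_eq_zero_of_eq Δ x _ (i := l.castSucc) (j := m.castSucc)
        (fun h => hne (Fin.castSucc_injective _ h).symm) ?_
      simp [hne]
    have h1 := hbase (ξ m) (hξ0 m) hml.le
    rw [lastPoly_eq Δ x c (fun p => (hx.monotone (Fin.le_last p)).trans hc) _ hu, hb] at h1
    simp only [mul_zero, zero_mul] at h1
    rw [(mul_eq_zero.1 h1.symm).resolve_left (hξ0 m), zero_mul]
  have hsphere : ContinuousOn (fun s => lastResidue Δ x y c l (Function.update ξ l s))
      (Metric.sphere 0 (ρ l)) := by
    refine hcont.comp (by fun_prop) fun s hs => ?_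
    have := update_mem_torusSet hξ l (z := s) (s := ρ l) (by simpa using hs)
    rwa [Function.update_eq_self] at this
  rw [integral_circ (hρ l) hsphere, circleIntegral.integral_congr (hρ l).le
    (g := fun s => (H s * W s) / ∏ m ∈ E, (s - ξ m)) fun s hs => ?_]
  · rw [circleIntegral_div_prod_eq_zero E (hρ l) ξ (fun a _ b _ h => hinj (by
      rw [← hξ a, ← hξ b, h])) (fun m hm h => Finset.ne_of_mem_erase hm (hinj (by
      rw [← hξ m, h]))) hHd hH0, mul_zero]
  · have hs' : ‖s‖ = ρ l := by simpa using hs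
    have hs0 : s ≠ 0 := norm_ne_zero_iff.1 (by rw [hs']; exact (hρ l).ne')
    rw [hres s hs', inv_mul_cancel_left₀ hs0]

/-! ### The initial condition -/

theorem integral_circ_inv {ρ : ℝ} (hρ : 0 < ρ) {f : ℂ → ℂ}
    (hf : ContinuousOn f (Metric.sphere 0 ρ)) :
    ∫ z, f z ∂circ ρ = ∫ w, f w⁻¹ ∂circ ρ⁻¹ := by
  have h := measurePreserving_inv_circ ρ⁻¹
  rw [inv_inv] at h
  conv_lhs => rw [← h.map_eq]
  exact integral_map h.measurable.aemeasurable (by rw [h.map_eq]; exact (integrable_circ hρ hf).1)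

theorem prod_erase_none {ι M : Type*} [Fintype ι] [DecidableEq ι] [CommMonoid M]
    (f : Option ι → M) : ∏ o ∈ Finset.univ.erase none, f o = ∏ l, f (some l) := by
  have h : (Finset.univ : Finset (Option ι)).erase none = Finset.univ.map Function.Embedding.some := by
    ext o
    cases o <;> simp
  rw [h, Finset.prod_map]
  rfl

theorem prod_erase_some {ι M : Type*} [Fintype ι] [DecidableEq ι] [CommMonoid M]
    (f : Option ι → M) (l : ι) :
    ∏ o ∈ Finset.univ.erase (some l), f o = f none * ∏ m ∈ Finset.univ.erase l, f (some m) := by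
  have h : (Finset.univ : Finset (Option ι)).erase (some l) =
      Finset.insertNone (Finset.univ.erase l) := by
    ext o
    cases o <;> simp
  rw [h, Finset.prod_insertNone]

/-- With `c` equal to the last entry of `y`, the power `w^c` is the one from the factor of the last
variable, and `w^n` is the one from the denominator; no power of `w` is left over. -/
theorem waveWeight_snoc_inv {n : ℕ} {Δ : ℝ} {x y : Fin (n + 1) → ℤ} (hx : StrictMono x)
    (hc : x (Fin.last n) ≤ y (Fin.last n)) {ξ : Fin n → ℂ} (hξ : ∀ j, 1 - 2 * Δ * ξ j ≠ 0)
    {w : ℂ} (hw : w ≠ 0) :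
    waveWeight Δ x y (Fin.snoc ξ w⁻¹) =
      (∏ j, ξ j ^ (-y j.castSucc)) / betheDenom Δ ξ / (∏ j, (1 - 2 * Δ * ξ j)) *
        lastPoly Δ x (y (Fin.last n)) ξ w / ∏ l, (w - poleAt Δ (ξ l)) := by
  rw [waveWeight, lastPoly_eq Δ x _ (fun p => (hx.monotone (Fin.le_last p)).trans hc) ξ hw,
    betheDenom_snoc, Fin.prod_univ_castSucc]
  simp only [Fin.snoc_castSucc, Fin.snoc_last]
  have h1 : ∏ l, scat Δ (ξ l) w⁻¹ =
      (∏ j, (1 - 2 * Δ * ξ j)) * (∏ l, (w - poleAt Δ (ξ l))) / w ^ n := by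
    rw [eq_div_iff (pow_ne_zero _ hw), ← Fin.prod_const, ← Finset.prod_mul_distrib,
      ← Finset.prod_mul_distrib]
    refine Finset.prod_congr rfl fun j _ => ?_
    have h2 := hξ j
    have h3 : (1 - 2 * Δ * ξ j) * poleAt Δ (ξ j) = -ξ j := mul_div_cancel₀ _ h2
    rw [mul_sub, h3, scat]
    field_simp
    ring
  have h2 : w⁻¹ ^ (-y (Fin.last n)) = w ^ y (Fin.last n) := by
    rw [inv_zpow, zpow_neg, inv_inv]
  rw [h1, h2]
  simp only [div_eq_mul_inv, mul_inv, inv_inv]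
  ring

/-- Integration over the last variable. -/
theorem integral_waveWeight_snoc {n : ℕ} {Δ r : ℝ} (hr : NoZero Δ r) {x y : Fin (n + 1) → ℤ}
    (hx : StrictMono x) (hc : x (Fin.last n) ≤ y (Fin.last n)) {t : ℝ} (ht : 0 < t) (htr : t ≤ r)
    {ξ : Fin n → ℂ} (hξr : ∀ j, ‖ξ j‖ ≤ r) (hξ0 : ∀ j, ξ j ≠ 0) (hinj : Function.Injective ξ) :
    ∫ z, waveWeight Δ x y (Fin.snoc ξ z) ∂circ t =
      (if x (Fin.last n) = y (Fin.last n) then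
        waveWeight Δ (fun j => x j.castSucc) (fun j => y j.castSucc) ξ else 0) +
      ∑ l, lastResidue Δ x (fun j => y j.castSucc) (y (Fin.last n)) l ξ := by
  have hξ1 : ∀ j, 1 - 2 * Δ * ξ j ≠ 0 := fun j => hr.one_sub_ne_zero (hξr j)
  have hcont : ContinuousOn (fun z => waveWeight Δ x y (Fin.snoc ξ z)) (Metric.sphere 0 t) := by
    refine (continuousOn_waveWeight Δ x y).comp ?_ fun z hz => ?_
    · refine Continuous.continuousOn (continuous_pi fun j => ?_)
      induction j using Fin.lastCases with
      | last => simp only [Fin.snoc_last]; exact continuous_id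
      | cast j => simpa using continuous_const
    · have hz' : ‖z‖ = t := by simpa using hz
      constructor
      · intro j
        induction j using Fin.lastCases with
        | last => simpa using norm_ne_zero_iff.1 (by rw [hz']; exact ht.ne')
        | cast j => simpa using hξ0 j
      · refine hr.betheDenom_ne_zero fun j => ?_
        induction j using Fin.lastCases with
        | last => simpa [hz'] using htr
        | cast j => simpa using hξr j
  have hinv : ContinuousOn (fun w => waveWeight Δ x y (Fin.snoc ξ w⁻¹))
      (Metric.sphere 0 t⁻¹) := by
    refine hcont.comp (ContinuousOn.inv₀ continuousOn_id fun w hw h => ?_) fun w hw => ?_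
    · have hw' : ‖w‖ = t⁻¹ := by simpa using hw
      change w = 0 at h
      rw [h, norm_zero] at hw'
      exact (inv_pos.2 ht).ne hw'
    · have hw' : ‖w‖ = t⁻¹ := by simpa using hw
      simp [hw']
  set pre := (∏ j, ξ j ^ (-y j.castSucc)) / betheDenom Δ ξ / (∏ j, (1 - 2 * Δ * ξ j)) with hpre
  -- `none` stands for the pole at `w = 0`, which comes from the measure `dw / w`. All poles lie
  -- inside the circle, so every residue contributes.
  set P : Option (Fin n) → ℂ := fun o => o.elim 0 fun l => poleAt Δ (ξ l) with hP
  have hu : ∀ l, poleAt Δ (ξ l) ≠ 0 := fun l => poleAt_ne_zero (hξ0 l) (hξ1 l)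
  have hPinj : Function.Injective P := by
    rintro (_ | l) (_ | m) h
    · rfl
    · exact absurd h.symm (hu m)
    · exact absurd h (hu l)
    · have h1 : poleAt Δ (ξ l) - poleAt Δ (ξ m) = 0 := sub_eq_zero.2 h
      rw [poleAt_sub_poleAt (hξ1 l) (hξ1 m), div_eq_zero_iff] at h1
      rcases h1 with h1 | h1
      · rw [hinj (a₁ := l) (a₂ := m) (by linear_combination -h1)]
      · exact absurd h1 (mul_ne_zero (hξ1 l) (hξ1 m))
  have hPlt : ∀ o, ‖P o‖ < t⁻¹ := by
    rintro (_ | l)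
    · simpa [hP] using ht
    · exact hr.norm_poleAt_lt (hξr l) ht htr
  have hg : ∀ z, DifferentiableAt ℂ (fun w => pre * lastPoly Δ x (y (Fin.last n)) ξ w) z := by
    intro z
    unfold lastPoly lastTerm
    refine (differentiableAt_const _).mul (DifferentiableAt.fun_sum fun p _ =>
      DifferentiableAt.fun_sum fun σ _ => DifferentiableAt.mul (by fun_prop)
      (DifferentiableAt.fun_finsetProd fun j _ => ?_))
    split_ifs <;> fun_prop
  have key := circleIntegral_div_prod (inv_pos.2 ht) P hPinj (fun o => (hPlt o).ne)
    (fun z _ => hg z)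
  rw [integral_circ_inv ht hcont, integral_circ (inv_pos.2 ht) hinv,
    circleIntegral.integral_congr (inv_pos.2 ht).le
      (g := fun w => pre * lastPoly Δ x (y (Fin.last n)) ξ w / ∏ o, (w - P o)) fun w hw => ?_,
    key, Fintype.sum_option]
  · congr 1
    · rw [if_pos (hPlt none), prod_erase_none]
      simp only [hP, Option.elim_none, Option.elim_some, zero_sub]
      rw [lastPoly_zero Δ x _ hx hc]
      split_ifs
      · have h1 : ∏ l, (-poleAt Δ (ξ l))⁻¹ = (∏ j, (1 - 2 * Δ * ξ j)) * (∏ j, ξ j)⁻¹ := by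
          rw [← Finset.prod_inv_distrib, ← Finset.prod_mul_distrib]
          refine Finset.prod_congr rfl fun j _ => ?_
          rw [poleAt, neg_div, neg_neg, inv_div, div_eq_mul_inv]
        have h2 : ∏ j, ξ j ≠ 0 := Finset.prod_ne_zero_iff.2 fun j _ => hξ0 j
        have h3 : ∏ j, (1 - 2 * Δ * ξ j) ≠ 0 := Finset.prod_ne_zero_iff.2 fun j _ => hξ1 j
        rw [h1, hpre, waveWeight]
        generalize (∏ j, ξ j) = A at *
        generalize (∏ j, (1 - 2 * (Δ : ℂ) * ξ j)) = B at *
        field_simp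
      · simp
    · refine Finset.sum_congr rfl fun l _ => ?_
      rw [if_pos (hPlt _), prod_erase_some]
      simp only [hP, Option.elim_none, Option.elim_some, sub_zero]
      rw [lastResidue, hpre]
      ring
  · have hw' : ‖w‖ = t⁻¹ := by simpa using hw
    have hw0 : w ≠ 0 := norm_ne_zero_iff.1 (by rw [hw']; exact (inv_pos.2 ht).ne')
    beta_reduce
    rw [waveWeight_snoc_inv hx hc hξ1 hw0, Fintype.prod_option]
    simp only [hP, Option.elim_none, Option.elim_some, sub_zero, div_eq_mul_inv, mul_inv]
    ring

theorem mem_torusSet_subset {n : ℕ} {Δ r : ℝ} (hr : NoZero Δ r) {ρ : Fin n → ℝ}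
    (hρ : ∀ j, 0 < ρ j) (hρr : ∀ j, ρ j ≤ r) :
    torusSet ρ ⊆ {ξ | (∀ j, ξ j ≠ 0) ∧ betheDenom Δ ξ ≠ 0} := fun _ hξ =>
  ⟨ne_zero_of_mem_torusSet hρ hξ, hr.betheDenom_ne_zero fun j => (hξ j).le.trans (hρr j)⟩

/-- If the last entry of `x` exceeds the last entry of `y`, every term of the Bethe wave function
is holomorphic in one of the variables. -/
theorem integral_waveWeight_of_lt {n : ℕ} {Δ r : ℝ} (hr : NoZero Δ r) {x y : Fin (n + 1) → ℤ}
    (hy : StrictMono y) (hxy : y (Fin.last n) < x (Fin.last n)) {ρ : Fin (n + 1) → ℝ}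
    (hρ : ∀ j, 0 < ρ j) (hρr : ∀ j, ρ j ≤ r) : ∫ ξ, waveWeight Δ x y ξ ∂torus ρ = 0 := by
  have hsub := mem_torusSet_subset hr hρ hρr
  set T : Equiv.Perm (Fin (n + 1)) → (Fin (n + 1) → ℂ) → ℂ := fun σ ξ =>
    ((Equiv.Perm.sign σ : ℤ) : ℂ) * betheDenom Δ (fun j => ξ (σ j)) * (∏ j, ξ (σ j) ^ x j) /
      betheDenom Δ ξ * ∏ j, ξ j ^ (-y j) with hT
  have hsum : ∀ ξ, waveWeight Δ x y ξ = ∑ σ, T σ ξ := fun ξ => by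
    simp only [waveWeight, bethe, hT, Finset.sum_div, Finset.sum_mul]
  have hTc : ∀ σ, ContinuousOn (T σ) (torusSet ρ) := by
    intro σ
    refine ContinuousOn.mul (ContinuousOn.div (ContinuousOn.mul (Continuous.continuousOn ?_) ?_)
      (continuous_betheDenom Δ).continuousOn fun ξ hξ => (hsub hξ).2)
      ((continuousOn_prod_zpow _).mono fun ξ hξ => (hsub hξ).1)
    · exact continuous_const.mul ((continuous_betheDenom Δ).comp (by fun_prop))
    · exact continuousOn_finsetProd _ fun j _ => ContinuousOn.zpow₀ (by fun_prop) _
        fun ξ hξ => Or.inl ((hsub hξ).1 _)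
  simp_rw [hsum]
  rw [integral_finsetSum _ fun σ _ => integrable_torus hρ (hTc σ)]
  refine Finset.sum_eq_zero fun σ _ => ?_
  -- In the variable of the last particle the exponent is `x_last - y_i ≥ x_last - y_last > 0`, so
  -- the term is `s` times a function holomorphic in the disc.
  set i := σ (Fin.last n) with hi
  refine integral_torus_eq_zero hρ i (hTc σ) fun ξ hξ => ?_
  have hle : ∀ s : ℂ, ‖s‖ ≤ ρ i → ∀ j, ‖Function.update ξ i s j‖ ≤ r := fun s hs j => by
    by_cases h : j = i
    · rw [h, Function.update_self]; exact hs.trans (hρr i)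
    · rw [Function.update_of_ne h]; exact (hξ j).le.trans (hρr j)
  have hyi : y i ≤ y (Fin.last n) := hy.monotone (Fin.le_last _)
  refine integral_circ_mul_eq_zero (hρ i) (g := fun s =>
    ((Equiv.Perm.sign σ : ℤ) : ℂ) * betheDenom Δ (fun j => Function.update ξ i s (σ j)) *
      (∏ j ∈ Finset.univ.erase (Fin.last n), ξ (σ j) ^ x j) /
      betheDenom Δ (Function.update ξ i s) * (∏ j ∈ Finset.univ.erase i, ξ j ^ (-y j)) *
      s ^ (x (Fin.last n) - y i - 1).toNat) (fun s hs => ?_) fun s hs => ?_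
  · have hu := fun j => differentiableAt_update ξ i j s
    exact DifferentiableAt.mul (DifferentiableAt.mul (DifferentiableAt.div
      (((differentiableAt_const _).mul (differentiableAt_betheDenom Δ fun j => hu _)).mul
        (differentiableAt_const _)) (differentiableAt_betheDenom Δ hu)
      (hr.betheDenom_ne_zero (hle s hs))) (differentiableAt_const _)) (by fun_prop)
  · have hs0 : s ≠ 0 := norm_ne_zero_iff.1 (by rw [hs]; exact (hρ i).ne')
    have h1 : ∏ j, Function.update ξ i s (σ j) ^ x j = s ^ x (Fin.last n) *
        ∏ j ∈ Finset.univ.erase (Fin.last n), ξ (σ j) ^ x j := by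
      rw [← Finset.mul_prod_erase _ _ (Finset.mem_univ (Fin.last n)), ← hi, Function.update_self]
      congr 1
      refine Finset.prod_congr rfl fun j hj => ?_
      rw [Function.update_of_ne fun h => Finset.ne_of_mem_erase hj (σ.injective h)]
    have h2 : ∏ j, Function.update ξ i s j ^ (-y j) = s ^ (-y i) *
        ∏ j ∈ Finset.univ.erase i, ξ j ^ (-y j) := by
      rw [← Finset.mul_prod_erase _ _ (Finset.mem_univ i), Function.update_self]
      congr 1
      refine Finset.prod_congr rfl fun j hj => ?_
      rw [Function.update_of_ne (Finset.ne_of_mem_erase hj)]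
    have h3 : s ^ x (Fin.last n) * s ^ (-y i) = s * s ^ (x (Fin.last n) - y i - 1).toNat := by
      rw [← zpow_natCast s, ← zpow_add₀ hs0, ← zpow_one_add₀ hs0]
      congr 1
      omega
    simp only [hT]
    rw [h1, h2]
    simp only [div_eq_mul_inv]
    linear_combination (((Equiv.Perm.sign σ : ℤ) : ℂ) *
      betheDenom Δ (fun j => Function.update ξ i s (σ j)) *
      (∏ j ∈ Finset.univ.erase (Fin.last n), ξ (σ j) ^ x j) *
      (betheDenom Δ (Function.update ξ i s))⁻¹ * (∏ j ∈ Finset.univ.erase i, ξ j ^ (-y j))) * h3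

/-- Induction on the number of particles. For `x_last > y_last` the mean vanishes by holomorphy.
Otherwise integrating the last variable leaves the delta of the last entries times the weight of the
other particles, plus residues of mean zero. -/
theorem integral_waveWeight_of_injective {n : ℕ} {Δ r : ℝ} (hr : NoZero Δ r) {x y : Fin n → ℤ}
    (hx : StrictMono x) (hy : StrictMono y) {ρ : Fin n → ℝ} (hρ : ∀ j, 0 < ρ j)
    (hρr : ∀ j, ρ j ≤ r) (hinj : Function.Injective ρ) :
    ∫ ξ, waveWeight Δ x y ξ ∂torus ρ = if x = y then 1 else 0 := by
  induction n with
  | zero =>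
    rw [if_pos (Subsingleton.elim _ _)]
    simp [waveWeight, bethe, betheDenom]
  | succ n ih =>
    rcases lt_or_ge (y (Fin.last n)) (x (Fin.last n)) with h | h
    · rw [integral_waveWeight_of_lt hr hy h hρ hρr, if_neg fun h' => by rw [h'] at h; omega]
    · have hρ' : ∀ j : Fin n, 0 < ρ j.castSucc := fun j => hρ _
      have hρr' : ∀ j : Fin n, ρ j.castSucc ≤ r := fun j => hρr _
      have hinj' : Function.Injective fun j : Fin n => ρ j.castSucc :=
        hinj.comp (Fin.castSucc_injective n)
      have hx' : StrictMono fun j : Fin n => x j.castSucc := hx.comp Fin.strictMono_castSucc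
      have hy' : StrictMono fun j : Fin n => y j.castSucc := hy.comp Fin.strictMono_castSucc
      have hsub := mem_torusSet_subset hr hρ' hρr'
      rw [integral_torus_snoc ρ (integrable_torus hρ ((continuousOn_waveWeight Δ x y).mono
        (mem_torusSet_subset hr hρ hρr)))]
      have hinner : ∀ ξ ∈ torusSet fun j : Fin n => ρ j.castSucc, _ = _ := fun ξ hξ =>
        integral_waveWeight_snoc hr hx h (hρ (Fin.last n)) (hρr _)
          (fun j => (hξ j).le.trans (hρr _)) (hsub hξ).1 (fun a b hab => hinj'
            ((hξ a).symm.trans ((congrArg norm hab).trans (hξ b))))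
      rw [integral_congr_ae ((ae_torus hρ').mono hinner), integral_add, integral_finsetSum]
      · have hres : ∀ l : Fin n, ∫ ξ, lastResidue Δ x (fun j => y j.castSucc) (y (Fin.last n)) l ξ
            ∂torus (fun j : Fin n => ρ j.castSucc) = 0 := fun l =>
          integral_lastResidue hr hx h (hy (Fin.castSucc_lt_last l)) hρ' hρr' hinj'
        rw [Finset.sum_eq_zero fun l _ => hres l, add_zero]
        by_cases hl : x (Fin.last n) = y (Fin.last n)
        · simp only [if_pos hl]
          rw [ih hx' hy' hρ' hρr' hinj']
          congr 1
          refine propext ⟨fun h' => ?_, fun h' => by rw [h']⟩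
          ext j
          induction j using Fin.lastCases with
          | last => exact hl
          | cast j => exact congrFun h' j
        · simp only [if_neg hl]
          rw [if_neg fun h' => hl (by rw [h'])]
          simp
      · exact fun l _ => integrable_torus hρ'
          (continuousOn_lastResidue hr x _ _ l hρ' hρr' hinj')
      · by_cases hl : x (Fin.last n) = y (Fin.last n)
        · simp only [if_pos hl]
          exact integrable_torus hρ' ((continuousOn_waveWeight Δ _ _).mono hsub)
        · simp only [if_neg hl]
          exact integrable_zero _ _ _
      · exact integrable_finsetSum _ fun l _ => integrable_torus hρ'
          (continuousOn_lastResidue hr x _ _ l hρ' hρr' hinj')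

/-! ### From small distinct radii to every admissible small radius -/

theorem exists_noZero (Δ : ℝ) {r : ℝ} (hr : 0 < r) : ∃ s, 0 < s ∧ s ≤ r ∧ NoZero Δ s := by
  have hD : 0 < 2 + 2 * |Δ| := by positivity
  -- For this radius `s`, `2|Δ| s + s² ≤ (1 + 2|Δ|) s < (2 + 2|Δ|) s ≤ 1`, so the constant `1` in
  -- `scat` cannot be compensated.
  refine ⟨min r (min 1 (2 + 2 * |Δ|)⁻¹), by positivity, min_le_left _ _, fun a b ha hb h => ?_⟩
  set s := min r (min 1 (2 + 2 * |Δ|)⁻¹)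
  have hs0 : 0 < s := by positivity
  have hs1 : s ≤ 1 := (min_le_right _ _).trans (min_le_left _ _)
  have hs2 : s ≤ (2 + 2 * |Δ|)⁻¹ := (min_le_right _ _).trans (min_le_right _ _)
  have h1 : (1 : ℂ) = 2 * Δ * a - a * b := by
    rw [scat] at h
    linear_combination h
  have h2 : (1 : ℝ) ≤ 2 * |Δ| * s + s * s := by
    calc (1 : ℝ) = ‖(2 * Δ * a - a * b : ℂ)‖ := by rw [← h1, norm_one]
      _ ≤ ‖(2 * Δ * a : ℂ)‖ + ‖a * b‖ := norm_sub_le _ _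
      _ = 2 * |Δ| * ‖a‖ + ‖a‖ * ‖b‖ := by simp
      _ ≤ _ := by gcongr
  have h3 : (2 + 2 * |Δ|) * s ≤ 1 := by
    calc _ ≤ (2 + 2 * |Δ|) * (2 + 2 * |Δ|)⁻¹ := by gcongr
      _ = 1 := mul_inv_cancel₀ hD.ne'
  nlinarith

theorem SmallRadius.betheDenom_ne_zero {n : ℕ} {Δ r : ℝ} (h : SmallRadius n Δ r) {ξ : Fin n → ℂ}
    (hξ : ∀ j, ‖ξ j‖ ≤ r) : betheDenom Δ ξ ≠ 0 :=
  Finset.prod_ne_zero_iff.2 fun j _ => Finset.prod_ne_zero_iff.2 fun k hk =>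
    h.2 ξ hξ j k (Finset.mem_Ioi.1 hk)

theorem LargeRadius.betheDenom_ne_zero {n : ℕ} {Δ R : ℝ} (h : LargeRadius n Δ R) {ξ : Fin n → ℂ}
    (hξ : ∀ j, R ≤ ‖ξ j‖) : betheDenom Δ ξ ≠ 0 :=
  Finset.prod_ne_zero_iff.2 fun j _ => Finset.prod_ne_zero_iff.2 fun k hk =>
    h.2 ξ hξ j k (Finset.mem_Ioi.1 hk)

/-- Orthogonality on small circles. -/
theorem integral_waveWeight_of_smallRadius {n : ℕ} {Δ r : ℝ} (hr : SmallRadius n Δ r)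
    {x y : Fin n → ℤ} (hx : StrictMono x) (hy : StrictMono y) :
    ∫ ξ, waveWeight Δ x y ξ ∂torus (fun _ => r) = if x = y then 1 else 0 := by
  obtain ⟨s, hs0, hsr, hs⟩ := exists_noZero Δ hr.1
  -- Distinct radii, at most `s ≤ r`. The weight is holomorphic for `0 < |ξ_j| ≤ r`, which allows
  -- deformation to the common radius `r`.
  set ρ : Fin n → ℝ := fun j => s / (j + 1) with hρ
  have hρ0 : ∀ j, 0 < ρ j := fun j => by positivity
  have hρs : ∀ j, ρ j ≤ s := fun j => div_le_self hs0.le (by simp)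
  have hinj : Function.Injective ρ := fun i j h => by
    simp only [hρ] at h
    rw [div_eq_div_iff (by positivity) (by positivity)] at h
    have h1 : ((i : ℕ) : ℝ) = (j : ℕ) := by linarith [mul_left_cancel₀ hs0.ne' h]
    exact Fin.ext (by exact_mod_cast h1)
  rw [← integral_waveWeight_of_injective hs hx hy hρ0 hρs hinj]
  refine integral_torus_eq_of_le ρ hρ0 (fun j => (hρs j).trans hsr)
    ((continuousOn_waveWeight Δ x y).mono fun ξ hξ =>
      ⟨fun j => (hξ j).1, hr.betheDenom_ne_zero fun j => (hξ j).2⟩) fun ξ hξ i => ?_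
  have hu := fun j => differentiableAt_update ξ i j (ξ i)
  have hne : ∀ j, Function.update ξ i (ξ i) j ≠ 0 := fun j => by
    rw [Function.update_eq_self]; exact (hξ j).1
  have hz : ∀ (j : Fin n) (k : ℤ), DifferentiableAt ℂ (fun s => Function.update ξ i s j ^ k) (ξ i) :=
    fun j k => (hu j).zpow (Or.inl (hne j))
  unfold waveWeight bethe
  refine DifferentiableAt.mul (DifferentiableAt.div (DifferentiableAt.fun_sum fun σ _ =>
    ((differentiableAt_const _).mul (differentiableAt_betheDenom Δ fun j => hu _)).mul
      (DifferentiableAt.fun_finsetProd fun j _ => hz _ _)) (differentiableAt_betheDenom Δ hu) ?_)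
      (DifferentiableAt.fun_finsetProd fun j _ => hz _ _)
  rw [Function.update_eq_self]
  exact hr.betheDenom_ne_zero fun j => (hξ j).2

/-! ### Inversion of the variables and large circles -/

theorem prod_prod_Ioi_mul {n : ℕ} (η : Fin n → ℂ) :
    ∏ j, ∏ k ∈ Finset.Ioi j, (η j * η k) = (∏ j, η j) ^ (n - 1) := by
  have h1 : ∏ j : Fin n, ∏ k ∈ Finset.Ioi j, η k = ∏ k : Fin n, ∏ _j ∈ Finset.Iio k, η k :=
    Finset.prod_comm' (by simp)
  simp only [Finset.prod_mul_distrib]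
  rw [h1, ← Finset.prod_mul_distrib, ← Finset.prod_pow]
  refine Finset.prod_congr rfl fun j _ => ?_
  rw [Finset.prod_const, Finset.prod_const, ← pow_add, Fin.card_Ioi, Fin.card_Iio]
  congr 1
  omega

/-- Inversion turns the factor of `(a, b)` into that of `(b, a)` divided by `a b`; reversing the
order of the variables restores the order. Each variable occurs in `n - 1` pairs. -/
theorem betheDenom_inv_rev {n : ℕ} (Δ : ℝ) {η : Fin n → ℂ} (hη : ∀ j, η j ≠ 0) :
    betheDenom Δ (fun j => (η j.rev)⁻¹) = betheDenom Δ η / (∏ j, η j) ^ (n - 1) := by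
  rw [← prod_prod_Ioi_mul, betheDenom, betheDenom]
  simp only [← Finset.prod_div_distrib]
  have key : ∀ a b : ℂ, a ≠ 0 → b ≠ 0 →
      1 + b⁻¹ * a⁻¹ - 2 * Δ * b⁻¹ = (1 + a * b - 2 * Δ * a) / (a * b) := fun a b ha hb => by
    field_simp
    ring
  calc _ = ∏ j : Fin n, ∏ k ∈ Finset.Ioi j.rev,
        (1 + (η j)⁻¹ * (η k.rev)⁻¹ - 2 * Δ * (η j)⁻¹) := by
        rw [← Equiv.prod_comp Fin.revPerm]
        simp
    _ = ∏ j : Fin n, ∏ k ∈ Finset.Iio j, (1 + (η j)⁻¹ * (η k)⁻¹ - 2 * Δ * (η j)⁻¹) := by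
        refine Finset.prod_congr rfl fun j _ => ?_
        refine Finset.prod_nbij' Fin.rev Fin.rev (fun k hk => ?_) (fun k hk => ?_)
          (by simp) (by simp) (by simp)
        · rw [Finset.mem_Ioi] at hk
          rw [Finset.mem_Iio]
          exact Fin.rev_lt_iff.1 hk
        · rw [Finset.mem_Iio] at hk
          rw [Finset.mem_Ioi]
          exact Fin.rev_lt_rev.2 hk
    _ = ∏ k : Fin n, ∏ j ∈ Finset.Ioi k, (1 + (η j)⁻¹ * (η k)⁻¹ - 2 * Δ * (η j)⁻¹) :=
        Finset.prod_comm' (by simp)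
    _ = _ := Finset.prod_congr rfl fun j _ => Finset.prod_congr rfl fun k _ =>
        key _ _ (hη j) (hη k)

theorem bethe_inv_rev {n : ℕ} (Δ : ℝ) (x : Fin n → ℤ) {η : Fin n → ℂ} (hη : ∀ j, η j ≠ 0) :
    bethe Δ x (fun j => (η j.rev)⁻¹) =
      bethe Δ (fun j => -x j.rev) η / (∏ j, η j) ^ (n - 1) := by
  rw [bethe, bethe, Finset.sum_div, ← Equiv.sum_comp (Fin.revPerm (n := n)).permCongr]
  refine Finset.sum_congr rfl fun σ _ => ?_
  have h1 : (fun j => (η (Fin.revPerm.permCongr σ j).rev)⁻¹) =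
      fun j => ((fun k => η (σ k)) j.rev)⁻¹ := by
    ext j
    simp
  have h2 : ∏ j, η (σ j) = ∏ j, η j := Equiv.prod_comp σ η
  have h3 : ∏ j, (η (Fin.revPerm.permCongr σ j).rev)⁻¹ ^ x j = ∏ j, η (σ j) ^ (-x j.rev) := by
    rw [← Equiv.prod_comp Fin.revPerm]
    refine Finset.prod_congr rfl fun j _ => ?_
    simp
  rw [h1, h3, betheDenom_inv_rev Δ fun j => hη _, h2, Equiv.Perm.sign_permCongr]
  ring

theorem waveWeight_inv_rev {n : ℕ} (Δ : ℝ) (x y : Fin n → ℤ) {η : Fin n → ℂ}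
    (hη : ∀ j, η j ≠ 0) :
    waveWeight Δ x y (fun j => (η j.rev)⁻¹) =
      waveWeight Δ (fun j => -x j.rev) (fun j => -y j.rev) η := by
  have h1 : (∏ j, η j) ^ (n - 1) ≠ 0 := pow_ne_zero _ (Finset.prod_ne_zero_iff.2 fun j _ => hη j)
  rw [waveWeight, waveWeight, bethe_inv_rev Δ x hη, betheDenom_inv_rev Δ hη,
    div_div_div_cancel_right₀ h1]
  congr 1
  rw [← Equiv.prod_comp Fin.revPerm]
  simp

/-- A zero `(a, b)` of the two-body factor with nonzero entries of modulus at most `R⁻¹` gives the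
forbidden zero `(b⁻¹, a⁻¹)`. A zero with `ζ_k = 0` has no such partner and is replaced by another
zero. -/
theorem LargeRadius.smallRadius_inv {n : ℕ} {Δ R : ℝ} (h : LargeRadius n Δ R) :
    SmallRadius n Δ R⁻¹ := by
  refine ⟨inv_pos.2 h.1, fun ζ hζ j k hjk h0 => ?_⟩
  have key : ∀ a b : ℂ, a ≠ 0 → b ≠ 0 → ‖a‖ ≤ R⁻¹ → ‖b‖ ≤ R⁻¹ → 1 + a * b - 2 * Δ * a ≠ 0 := by
    intro a b ha hb har hbr h1
    refine h.2 (fun i => if i = j then b⁻¹ else if i = k then a⁻¹ else (R : ℂ)) (fun i => ?_)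
      j k hjk ?_
    · split_ifs
      · rw [norm_inv]
        exact (le_inv_comm₀ h.1 (norm_pos_iff.2 hb)).2 hbr
      · rw [norm_inv]
        exact (le_inv_comm₀ h.1 (norm_pos_iff.2 ha)).2 har
      · simp [abs_of_pos h.1]
    · simp only [if_true, if_neg hjk.ne']
      field_simp
      linear_combination h1
  by_cases hj : ζ j = 0
  · simp [hj] at h0
  by_cases hk : ζ k = 0
  · have h1 : 2 * (Δ : ℂ) * ζ j = 1 := by
      rw [hk] at h0
      linear_combination -h0
    have hΔ : Δ ≠ 0 := by
      rintro rfl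
      simp at h1
    have h2 : R ≤ 2 * |Δ| := by
      have h3 : 2 * |Δ| * ‖ζ j‖ = 1 := by simpa using congrArg norm h1
      have h4 : 2 * |Δ| * ‖ζ j‖ ≤ 2 * |Δ| * R⁻¹ := by gcongr; exact hζ j
      rw [h3, ← div_eq_mul_inv, le_div_iff₀ h.1] at h4
      linarith
    -- Here `c` has modulus `R⁻¹` and the sign opposite to `Δ`, so `|2Δ - c| ≥ 2|Δ| ≥ R`, and `((2Δ
    -- - c)⁻¹, c)` is a zero with nonzero entries in the disc of radius `R⁻¹`.
    obtain ⟨c, hc, hc1, hc2⟩ : ∃ c : ℝ, c ≠ 0 ∧ |c| = R⁻¹ ∧ R ≤ |2 * Δ - c| := by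
      have hR := inv_pos.2 h.1
      rcases lt_or_gt_of_ne hΔ with hneg | hpos
      · refine ⟨R⁻¹, hR.ne', abs_of_pos hR, ?_⟩
        rw [abs_of_neg hneg] at h2
        rw [abs_of_neg (by linarith)]
        linarith
      · refine ⟨-R⁻¹, neg_ne_zero.2 hR.ne', by rw [abs_neg, abs_of_pos hR], ?_⟩
        rw [abs_of_pos hpos] at h2
        rw [abs_of_pos (by linarith)]
        linarith
    have h5 : 2 * Δ - c ≠ 0 := abs_pos.1 (h.1.trans_le hc2)
    refine key ((2 * Δ - c : ℝ) : ℂ)⁻¹ c (inv_ne_zero (by exact_mod_cast h5))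
      (by exact_mod_cast hc) ?_ ?_ ?_
    · rw [norm_inv, Complex.norm_real]
      exact inv_anti₀ h.1 hc2
    · rw [Complex.norm_real]
      exact hc1.le
    · have h6 : (2 * (Δ : ℂ) - c) ≠ 0 := by exact_mod_cast h5
      push_cast
      field_simp
      ring
  · exact key _ _ hj hk (hζ j) (hζ k) h0

/-- Orthogonality on large circles. -/
theorem integral_waveWeight_of_largeRadius {n : ℕ} {Δ R : ℝ} (hR : LargeRadius n Δ R)
    {x y : Fin n → ℤ} (hx : StrictMono x) (hy : StrictMono y) :
    ∫ ξ, waveWeight Δ x y ξ ∂torus (fun _ => R) = if x = y then 1 else 0 := by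
  have hrev : ∀ {z : Fin n → ℤ}, StrictMono z → StrictMono fun j : Fin n => -z j.rev :=
    fun hz i j hij => neg_lt_neg (hz (Fin.rev_lt_rev.2 hij))
  have hs := hR.smallRadius_inv
  have hmp := measurePreserving_inv_rev n R⁻¹
  rw [inv_inv] at hmp
  have hcont : ContinuousOn (waveWeight Δ x y) (torusSet fun _ => R) :=
    (continuousOn_waveWeight Δ x y).mono fun ξ hξ =>
      ⟨ne_zero_of_mem_torusSet (fun _ => hR.1) hξ, hR.betheDenom_ne_zero fun j => (hξ j).ge⟩
  rw [← hmp.map_eq, integral_map hmp.measurable.aemeasurable, integral_congr_ae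
    ((ae_torus fun _ => inv_pos.2 hR.1).mono fun η hη =>
      waveWeight_inv_rev Δ x y (ne_zero_of_mem_torusSet (fun _ => inv_pos.2 hR.1) hη)),
    integral_waveWeight_of_smallRadius hs (hrev hx) (hrev hy)]
  · congr 1
    refine propext ⟨fun h => funext fun j => ?_, fun h => by rw [h]⟩
    have := congrFun h j.rev
    simpa using this
  · rw [hmp.map_eq]
    exact (integrable_torus (fun _ => hR.1) hcont).aestronglyMeasurable

/-! ### The Bethe wave function is an eigenfunction -/

theorem Config.strictMono_pos {N : ℕ} (X : Config N) : StrictMono X.pos :=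
  (X.1.orderEmbOfFin X.2).strictMono

theorem Config.pos_mem {N : ℕ} (X : Config N) (j : Fin N) : X.pos j ∈ X.1 :=
  X.1.orderEmbOfFin_mem X.2 j

theorem Config.pos_eq {N : ℕ} (X : Config N) {f : Fin N → ℤ} (hf : StrictMono f)
    (h : ∀ j, f j ∈ X.1) : X.pos = f :=
  (Finset.orderEmbOfFin_unique X.2 h hf).symm

theorem Config.image_pos {N : ℕ} (X : Config N) : Finset.univ.image X.pos = X.1 := by
  ext i
  have h := Finset.range_orderEmbOfFin X.1 X.2
  rw [Finset.mem_image, ← Finset.mem_coe, ← h, Set.mem_range]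
  simp only [Finset.mem_univ, true_and, Config.pos]

theorem Config.mem_iff {N : ℕ} (X : Config N) (i : ℤ) : i ∈ X.1 ↔ ∃ q, X.pos q = i := by
  conv_lhs => rw [← X.image_pos]
  simp only [Finset.mem_image, Finset.mem_univ, true_and]

theorem Config.pos_injective {N : ℕ} : Function.Injective (Config.pos (N := N)) := fun X Y h =>
  Subtype.ext (by rw [← X.image_pos, ← Y.image_pos, h])

/-- The target site is free, so the moved particle keeps its rank and only its own position changes.
-/
theorem extend_flip_right {N : ℕ} (B : (Fin N → ℤ) → ℂ) (X : Config N) (p : Fin N)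
    (h : X.pos p + 1 ∉ X.1) :
    extend (fun X => B X.pos) (flip (X.pos p) X.1) =
      B (Function.update X.pos p (X.pos p + 1)) := by
  have hc : (flip (X.pos p) X.1).card = N := (card_flip _ _).trans X.2
  have hne : ∀ i, X.pos i ≠ X.pos p + 1 := fun i hi => h (hi ▸ X.pos_mem i)
  rw [extend, dif_pos hc]
  congr 1
  refine Config.pos_eq ⟨_, hc⟩ (fun a b hab => ?_) fun i => ?_
  · have h1 := X.strictMono_pos hab
    by_cases ha : a = p
    · subst ha
      rw [Function.update_self, Function.update_of_ne hab.ne']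
      have := hne b
      omega
    · rw [Function.update_of_ne ha]
      by_cases hb : b = p
      · subst hb
        rw [Function.update_self]
        omega
      · rwa [Function.update_of_ne hb]
  · change _ ∈ flip _ _
    rw [mem_flip]
    by_cases hi : i = p
    · subst hi
      rw [Function.update_self, Equiv.swap_apply_right]
      exact X.pos_mem i
    · rw [Function.update_of_ne hi, Equiv.swap_apply_of_ne_of_ne
        (fun h' => hi (X.strictMono_pos.injective h')) (hne i)]
      exact X.pos_mem i

theorem extend_flip_left {N : ℕ} (B : (Fin N → ℤ) → ℂ) (X : Config N) (p : Fin N)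
    (h : X.pos p - 1 ∉ X.1) :
    extend (fun X => B X.pos) (flip (X.pos p - 1) X.1) =
      B (Function.update X.pos p (X.pos p - 1)) := by
  have hc : (flip (X.pos p - 1) X.1).card = N := (card_flip _ _).trans X.2
  have hne : ∀ i, X.pos i ≠ X.pos p - 1 := fun i hi => h (hi ▸ X.pos_mem i)
  rw [extend, dif_pos hc]
  congr 1
  refine Config.pos_eq ⟨_, hc⟩ (fun a b hab => ?_) fun i => ?_
  · have h1 := X.strictMono_pos hab
    by_cases ha : a = p
    · subst ha
      rw [Function.update_self, Function.update_of_ne hab.ne']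
      omega
    · rw [Function.update_of_ne ha]
      by_cases hb : b = p
      · subst hb
        rw [Function.update_self]
        have := hne a
        omega
      · rwa [Function.update_of_ne hb]
  · change _ ∈ flip _ _
    rw [mem_flip]
    by_cases hi : i = p
    · subst hi
      rw [Function.update_self, Equiv.swap_apply_left, sub_add_cancel]
      exact X.pos_mem i
    · rw [Function.update_of_ne hi, Equiv.swap_apply_of_ne_of_ne (hne i)
        (fun h' => hi (X.strictMono_pos.injective (by omega)))]
      exact X.pos_mem i

theorem sum_pos {N : ℕ} (X : Config N) (f : ℤ → ℂ) : ∑ p, f (X.pos p) = ∑ i ∈ X.1, f i := by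
  conv_rhs => rw [← X.image_pos]
  rw [Finset.sum_image fun a _ b _ h => X.strictMono_pos.injective h]

/-- The Hamiltonian on functions of the ordered positions: free hopping minus the contribution of
adjacent pairs. -/
theorem action_extend_pos {N : ℕ} (Δ : ℝ) (B : (Fin N → ℤ) → ℂ) (X : Config N) :
    action Δ (extend fun X => B X.pos) X.1 =
      (∑ p, (B (Function.update X.pos p (X.pos p + 1)) + B (Function.update X.pos p (X.pos p - 1))
        - 2 * Δ * B X.pos)) -
      ∑ p, ∑ q, if X.pos q = X.pos p + 1 then
        B (Function.update X.pos p (X.pos p + 1)) + B (Function.update X.pos q (X.pos q - 1))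
          - 2 * Δ * B X.pos else 0 := by
  classical
  set φ : Amplitude := extend fun X => B X.pos with hφ
  have hX : φ X.1 = B X.pos := by simp [hφ, extend, X.2]
  -- An active bond has exactly one up-spin: at its left end, counted by `f`, or at its right end,
  -- counted by `g`. Both functions vanish when the neighbouring site is occupied.
  set f : ℤ → ℂ := fun j => if j + 1 ∈ X.1 then 0 else φ (flip j X.1) - Δ * B X.pos with hf
  set g : ℤ → ℂ := fun j => if j - 1 ∈ X.1 then 0 else φ (flip (j - 1) X.1) - Δ * B X.pos with hg
  have hbond : ∀ j, bond Δ j φ X.1 = (if j ∈ X.1 then f j else 0) +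
      (if j + 1 ∈ X.1 then g (j + 1) else 0) := fun j => by
    by_cases h : Active X.1 j
    · rw [bond_apply_of_active Δ j φ X.1 h, hX]
      by_cases h1 : j ∈ X.1 <;> by_cases h2 : j + 1 ∈ X.1 <;> simp_all [Active]
    · rw [bond_apply_of_not_active Δ j φ X.1 h]
      by_cases h1 : j ∈ X.1 <;> by_cases h2 : j + 1 ∈ X.1 <;> simp_all [Active]
  have h1 : action Δ φ X.1 = ∑ j ∈ X.1, f j + ∑ j ∈ X.1, g j := by
    rw [action_eq_sum, Finset.sum_congr rfl fun j _ => hbond j, Finset.sum_add_distrib]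
    congr 1
    · rw [← Finset.sum_filter]
      congr 1
      ext j
      simp [bonds]
    · rw [← Finset.sum_filter]
      refine Finset.sum_nbij' (fun j => j + 1) (fun j => j - 1) (fun j hj => ?_) (fun j hj => ?_)
        (by simp) (by simp) (by simp)
      · exact (Finset.mem_filter.1 hj).2
      · rw [Finset.mem_filter, sub_add_cancel]
        exact ⟨Finset.mem_union_right _ (Finset.mem_image_of_mem _ hj), hj⟩
  rw [h1, ← sum_pos, ← sum_pos]
  have hf' : ∀ p, f (X.pos p) = B (Function.update X.pos p (X.pos p + 1)) - Δ * B X.pos -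
      ∑ q, if X.pos q = X.pos p + 1 then
        B (Function.update X.pos p (X.pos p + 1)) - Δ * B X.pos else 0 := fun p => by
    by_cases h : X.pos p + 1 ∈ X.1
    · obtain ⟨q, hq⟩ := (X.mem_iff _).1 h
      rw [Finset.sum_eq_single q (fun q' _ hq' => if_neg fun h' =>
        hq' (X.strictMono_pos.injective (h'.trans hq.symm))) (by simp), if_pos hq]
      simp [hf, h]
    · rw [Finset.sum_eq_zero fun q _ => if_neg fun h' : X.pos q = X.pos p + 1 => h (h' ▸ X.pos_mem q)]
      simp only [hf, if_neg h, sub_zero]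
      rw [hφ, extend_flip_right B X p h]
  have hg' : ∀ q, g (X.pos q) = B (Function.update X.pos q (X.pos q - 1)) - Δ * B X.pos -
      ∑ p, if X.pos q = X.pos p + 1 then
        B (Function.update X.pos q (X.pos q - 1)) - Δ * B X.pos else 0 := fun q => by
    by_cases h : X.pos q - 1 ∈ X.1
    · obtain ⟨p, hp⟩ := (X.mem_iff _).1 h
      rw [Finset.sum_eq_single p (fun p' _ hp' => if_neg fun h' =>
        hp' (X.strictMono_pos.injective (by omega))) (by simp), if_pos (by omega)]
      simp [hg, h]
    · rw [Finset.sum_eq_zero fun p _ => if_neg fun h' => h (by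
        rw [h', add_sub_cancel_right]; exact X.pos_mem p)]
      simp only [hg, if_neg h, sub_zero]
      rw [hφ, extend_flip_left B X q h]
  simp only [hf', hg', Finset.sum_sub_distrib, Finset.sum_add_distrib]
  rw [Finset.sum_comm (f := fun q p => if X.pos q = X.pos p + 1 then
    B (Function.update X.pos q (X.pos q - 1)) - Δ * B X.pos else 0)]
  have h2 : ∑ p, ∑ q, (if X.pos q = X.pos p + 1 then
        B (Function.update X.pos p (X.pos p + 1)) + B (Function.update X.pos q (X.pos q - 1))
          - 2 * Δ * B X.pos else 0) =
      ∑ p, ∑ q, (if X.pos q = X.pos p + 1 then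
        B (Function.update X.pos p (X.pos p + 1)) - Δ * B X.pos else 0) +
      ∑ p, ∑ q, (if X.pos q = X.pos p + 1 then
        B (Function.update X.pos q (X.pos q - 1)) - Δ * B X.pos else 0) := by
    simp only [← Finset.sum_add_distrib]
    refine Finset.sum_congr rfl fun p _ => Finset.sum_congr rfl fun q _ => ?_
    split_ifs
    · ring
    · ring
  rw [h2]
  have h3 : ∑ _p : Fin N, 2 * (Δ : ℂ) * B X.pos =
      ∑ _p : Fin N, Δ * B X.pos + ∑ _p : Fin N, Δ * B X.pos := by
    rw [← Finset.sum_add_distrib]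
    exact Finset.sum_congr rfl fun _ _ => by ring
  rw [h3]
  ring

theorem prod_zpow_update_add {n : ℕ} {η : Fin n → ℂ} (x : Fin n → ℤ) (p : Fin n) (d : ℤ)
    (hη : η p ≠ 0) :
    ∏ j, η j ^ Function.update x p (x p + d) j = η p ^ d * ∏ j, η j ^ x j := by
  rw [← Finset.mul_prod_erase _ _ (Finset.mem_univ p),
    ← Finset.mul_prod_erase _ (fun j => η j ^ x j) (Finset.mem_univ p), Function.update_self,
    zpow_add₀ hη, ← mul_assoc, mul_comm (η p ^ d)]
  congr 1
  refine Finset.prod_congr rfl fun j hj => ?_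
  rw [Function.update_of_ne (Finset.ne_of_mem_erase hj)]

theorem bethe_update_add {n : ℕ} (Δ : ℝ) (x : Fin n → ℤ) (p : Fin n) (d : ℤ) {ξ : Fin n → ℂ}
    (hξ : ∀ j, ξ j ≠ 0) :
    bethe Δ (Function.update x p (x p + d)) ξ = ∑ σ : Equiv.Perm (Fin n),
      ((Equiv.Perm.sign σ : ℤ) : ℂ) * betheDenom Δ (fun j => ξ (σ j)) *
        (∏ j, ξ (σ j) ^ x j) * ξ (σ p) ^ d := by
  refine Finset.sum_congr rfl fun σ _ => ?_
  rw [prod_zpow_update_add (η := fun j => ξ (σ j)) x p d (hξ _)]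
  ring

/-- Transposing adjacent indices reverses the order of the pair `(p, q)` only. All products are
written over all index pairs and compared factor by factor. -/
theorem betheDenom_comp_swap {n : ℕ} (Δ : ℝ) (η : Fin n → ℂ) {p q : Fin n}
    (hpq : (p : ℕ) + 1 = q) :
    betheDenom Δ (fun j => η (Equiv.swap p q j)) * scat Δ (η p) (η q) =
      betheDenom Δ η * scat Δ (η q) (η p) := by
  have hne : p ≠ q := fun h => by rw [h] at hpq; omega
  simp only [betheDenom_eq, prod_Ioi_eq_prod_ite]
  have h1 : ∏ i, ∏ j, (if i < j then scat Δ (η (Equiv.swap p q i)) (η (Equiv.swap p q j)) else 1) =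
      ∏ i, ∏ j, (if Equiv.swap p q i < Equiv.swap p q j then scat Δ (η i) (η j) else 1) := by
    rw [← Equiv.prod_comp (Equiv.swap p q)]
    refine Finset.prod_congr rfl fun i _ => ?_
    rw [← Equiv.prod_comp (Equiv.swap p q)]
    simp
  have h2 : ∀ a b : Fin n, scat Δ (η a) (η b) =
      ∏ i, ∏ j, (if i = a then if j = b then scat Δ (η i) (η j) else 1 else 1) := fun a b => by
    rw [Finset.prod_eq_single a (fun i _ hi => by simp [hi]) (by simp),
      Finset.prod_eq_single b (fun i _ hi => by simp [hi]) (by simp)]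
    simp
  rw [h1, h2 p q, h2 q p]
  simp only [← Finset.prod_mul_distrib]
  refine Finset.prod_congr rfl fun i _ => Finset.prod_congr rfl fun j _ => ?_
  have hval : ∀ a : Fin n, ((Equiv.swap p q a : Fin n) : ℕ) =
      if (a : ℕ) = p then (q : ℕ) else if (a : ℕ) = q then (p : ℕ) else a := fun a => by
    rw [Equiv.swap_apply_def]
    simp only [Fin.ext_iff]
    split_ifs <;> rfl
  simp only [Fin.lt_def, hval, Fin.ext_iff]
  split_ifs <;> first | omega | ring1

/-- The contact condition for two adjacent particles. -/
theorem bethe_contact {n : ℕ} (Δ : ℝ) (x : Fin n → ℤ) {ξ : Fin n → ℂ} (hξ : ∀ j, ξ j ≠ 0)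
    {p q : Fin n} (hpq : (p : ℕ) + 1 = q) (hx : x q = x p + 1) :
    bethe Δ (Function.update x p (x p + 1)) ξ + bethe Δ (Function.update x q (x q - 1)) ξ
      - 2 * Δ * bethe Δ x ξ = 0 := by
  have hne : p ≠ q := fun h => by rw [h] at hpq; omega
  rw [sub_eq_add_neg (x q) 1, bethe_update_add Δ x p 1 hξ, bethe_update_add Δ x q (-1) hξ, bethe,
    Finset.mul_sum, ← Finset.sum_add_distrib, ← Finset.sum_sub_distrib]
  -- For each `σ` the three terms combine to `ξ_{σ(q)}⁻¹ scat(ξ_{σ(q)}, ξ_{σ(p)})`, and the inverse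
  -- is absorbed in `x'`. Since `x'` agrees at `p` and `q`, composing `σ` with their transposition
  -- changes only the sign of the summand.
  set x' := Function.update x q (x q + -1) with hx'
  have hx's : ∀ j, x' (Equiv.swap p q j) = x' j := fun j => by
    rw [Equiv.swap_apply_def]
    split_ifs with h1 h2
    · rw [h1, hx', Function.update_self, Function.update_of_ne hne, hx]
      ring
    · rw [h2, hx', Function.update_self, Function.update_of_ne hne, hx]
      ring
    · rfl
  set T : Equiv.Perm (Fin n) → ℂ := fun σ => ((Equiv.Perm.sign σ : ℤ) : ℂ) *
    (betheDenom Δ (fun j => ξ (σ j)) * scat Δ (ξ (σ q)) (ξ (σ p))) * ∏ j, ξ (σ j) ^ x' j with hT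
  have hsum : ∑ σ, T σ = -∑ σ, T σ := by
    conv_lhs => rw [← Equiv.sum_comp (Equiv.mulRight (Equiv.swap p q))]
    rw [← Finset.sum_neg_distrib]
    refine Finset.sum_congr rfl fun σ _ => ?_
    have h1 := betheDenom_comp_swap Δ (fun j => ξ (σ j)) hpq
    have h2 : ∏ j, ξ (σ (Equiv.swap p q j)) ^ x' j = ∏ j, ξ (σ j) ^ x' j := by
      rw [← Equiv.prod_comp (Equiv.swap p q)]
      simp [hx's]
    simp only [hT, Equiv.coe_mulRight, Equiv.Perm.coe_mul, Function.comp_apply, h2,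
      Equiv.Perm.sign_mul, Equiv.Perm.sign_swap hne, Equiv.swap_apply_left,
      Equiv.swap_apply_right, h1]
    push_cast
    ring
  have h0 : ∑ σ, T σ = 0 := by linear_combination (1 / 2 : ℂ) * hsum
  rw [← h0]
  refine Finset.sum_congr rfl fun σ _ => ?_
  have hq := hξ (σ q)
  simp only [hT]
  rw [hx', prod_zpow_update_add (η := fun j => ξ (σ j)) x q (-1) hq, scat, zpow_neg, zpow_one,
    zpow_one]
  field_simp
  ring

theorem bethe_free {n : ℕ} (Δ : ℝ) (x : Fin n → ℤ) {ξ : Fin n → ℂ} (hξ : ∀ j, ξ j ≠ 0) :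
    ∑ p, (bethe Δ (Function.update x p (x p + 1)) ξ + bethe Δ (Function.update x p (x p - 1)) ξ
      - 2 * Δ * bethe Δ x ξ) = (∑ j, energy Δ (ξ j)) * bethe Δ x ξ := by
  have h1 : ∀ p, bethe Δ (Function.update x p (x p + 1)) ξ +
      bethe Δ (Function.update x p (x p - 1)) ξ - 2 * Δ * bethe Δ x ξ =
      ∑ σ : Equiv.Perm (Fin n), energy Δ (ξ (σ p)) * (((Equiv.Perm.sign σ : ℤ) : ℂ) *
        betheDenom Δ (fun j => ξ (σ j)) * (∏ j, ξ (σ j) ^ x j)) := fun p => by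
    rw [sub_eq_add_neg (x p) 1, bethe_update_add Δ x p 1 hξ, bethe_update_add Δ x p (-1) hξ, bethe,
      Finset.mul_sum, ← Finset.sum_add_distrib, ← Finset.sum_sub_distrib]
    refine Finset.sum_congr rfl fun σ _ => ?_
    rw [energy, zpow_neg, zpow_one]
    ring
  simp only [h1]
  rw [Finset.sum_comm, bethe, Finset.mul_sum]
  refine Finset.sum_congr rfl fun σ _ => ?_
  rw [← Finset.sum_mul, Equiv.sum_comp σ fun j => energy Δ (ξ j)]

/-- Positions that differ by one belong to consecutive particles, so the contact condition removes
every correction to free hopping. -/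
theorem action_bethe {N : ℕ} (Δ : ℝ) {ξ : Fin N → ℂ} (hξ : ∀ j, ξ j ≠ 0) (X : Config N) :
    action Δ (extend fun X => bethe Δ X.pos ξ) X.1 =
      (∑ j, energy Δ (ξ j)) * bethe Δ X.pos ξ := by
  rw [action_extend_pos Δ (fun x => bethe Δ x ξ) X, bethe_free Δ X.pos hξ, sub_eq_self]
  refine Finset.sum_eq_zero fun p _ => Finset.sum_eq_zero fun q _ => ?_
  split_ifs with h
  · refine bethe_contact Δ X.pos hξ ?_ h
    have h1 : p < q := X.strictMono_pos.lt_iff_lt.1 (by omega)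
    by_contra h2
    have h3 : (p : ℕ) + 1 < q := by
      have := Fin.lt_def.1 h1
      omega
    have h4 : p < (⟨p + 1, h3.trans q.2⟩ : Fin N) := Fin.lt_def.2 (Nat.lt_succ_self _)
    have h5 : (⟨p + 1, h3.trans q.2⟩ : Fin N) < q := Fin.lt_def.2 h3
    have h6 := X.strictMono_pos h4
    have h7 := X.strictMono_pos h5
    omega
  · rfl

/-! ### Contour integral formula for the state -/

theorem action_extend_integral {N : ℕ} {α : Type*} [MeasurableSpace α] {μ : Measure α} (Δ : ℝ)
    {F : Config N → α → ℂ} (hF : ∀ X, Integrable (F X) μ) (X : Finset ℤ) :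
    action Δ (extend fun X => ∫ a, F X a ∂μ) X =
      ∫ a, action Δ (extend fun X => F X a) X ∂μ := by
  have hE : ∀ Z : Finset ℤ, Integrable (fun a => extend (fun X => F X a) Z) μ := fun Z => by
    by_cases h : Z.card = N
    · simpa only [extend, dif_pos h] using hF ⟨Z, h⟩
    · simp only [extend, dif_neg h]
      exact integrable_zero _ _ _
  have hI : ∀ Z : Finset ℤ, extend (fun X => ∫ a, F X a ∂μ) Z =
      ∫ a, extend (fun X => F X a) Z ∂μ := fun Z => by
    by_cases h : Z.card = N
    · simp only [extend, dif_pos h]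
    · simp [extend, dif_neg h]
  simp only [action_eq_sum]
  have hb : ∀ j, Integrable (fun a => bond Δ j (extend fun X => F X a) X) μ ∧
      bond Δ j (extend fun X => ∫ a, F X a ∂μ) X =
        ∫ a, bond Δ j (extend fun X => F X a) X ∂μ := fun j => by
    by_cases h : Active X j
    · simp only [bond_apply_of_active Δ j _ X h]
      refine ⟨(hE _).sub ((hE _).const_mul _), ?_⟩
      rw [integral_sub (hE _) ((hE _).const_mul _), integral_const_mul, hI, hI]
    · simp only [bond_apply_of_not_active Δ j _ X h]
      exact ⟨integrable_zero _ _ _, by simp⟩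
  rw [integral_finsetSum _ fun j _ => (hb j).1]
  exact Finset.sum_congr rfl fun j _ => (hb j).2

theorem hamiltonian_apply {N : ℕ} (Δ : ℝ) (ψ : Sector N) (X : Config N) :
    hamiltonian N Δ ψ X = action Δ (extend ψ) X.1 := rfl

theorem single_apply_eq {N : ℕ} (Y X : Config N) :
    (lp.single 2 Y (1 : ℂ) : Sector N) X = if X = Y then 1 else 0 := by
  rw [lp.single_apply, Pi.single_apply]

theorem continuousOn_sum_energy {n : ℕ} (Δ : ℝ) :
    ContinuousOn (fun ξ : Fin n → ℂ => ∑ j, energy Δ (ξ j)) {ξ | ∀ j, ξ j ≠ 0} := by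
  refine continuousOn_finsetSum _ fun j _ => ?_
  unfold energy
  have h : ContinuousOn (fun ξ : Fin n → ℂ => ξ j) {ξ | ∀ j, ξ j ≠ 0} := by fun_prop
  exact (h.add (h.inv₀ fun ξ hξ => hξ j)).sub continuousOn_const

/-- The wave functions are orthonormal on the circle of radius `ρ`. -/
structure OrthoRadius (N : ℕ) (Δ ρ : ℝ) : Prop where
  pos : 0 < ρ
  betheDenom_ne_zero : ∀ ξ ∈ torusSet (fun _ : Fin N => ρ), betheDenom Δ ξ ≠ 0
  integral_eq : ∀ X Y : Config N, ∫ ξ, waveWeight Δ X.pos Y.pos ξ ∂torus (fun _ => ρ) =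
    if X = Y then 1 else 0

theorem SmallRadius.orthoRadius {N : ℕ} {Δ r : ℝ} (h : SmallRadius N Δ r) : OrthoRadius N Δ r where
  pos := h.1
  betheDenom_ne_zero _ hξ := h.betheDenom_ne_zero fun j => (hξ j).le
  integral_eq X Y := by
    rw [integral_waveWeight_of_smallRadius h X.strictMono_pos Y.strictMono_pos]
    simp only [Config.pos_injective.eq_iff]

theorem LargeRadius.orthoRadius {N : ℕ} {Δ r : ℝ} (h : LargeRadius N Δ r) : OrthoRadius N Δ r where
  pos := h.1
  betheDenom_ne_zero _ hξ := h.betheDenom_ne_zero fun j => (hξ j).ge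
  integral_eq X Y := by
    rw [integral_waveWeight_of_largeRadius h X.strictMono_pos Y.strictMono_pos]
    simp only [Config.pos_injective.eq_iff]

namespace OrthoRadius

variable {N : ℕ} {Δ ρ : ℝ}

theorem ne_zero (h : OrthoRadius N Δ ρ) {ξ : Fin N → ℂ} (hξ : ξ ∈ torusSet fun _ => ρ) (j : Fin N) :
    ξ j ≠ 0 :=
  ne_zero_of_mem_torusSet (fun _ => h.pos) hξ j

theorem continuousOn_waveWeight (h : OrthoRadius N Δ ρ) (x y : Fin N → ℤ) :
    ContinuousOn (waveWeight Δ x y) (torusSet fun _ => ρ) :=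
  (XXZ.continuousOn_waveWeight Δ x y).mono fun ξ hξ => ⟨h.ne_zero hξ, h.betheDenom_ne_zero ξ hξ⟩

theorem continuousOn_energy (h : OrthoRadius N Δ ρ) :
    ContinuousOn (fun ξ : Fin N → ℂ => ∑ j, energy Δ (ξ j)) (torusSet fun _ => ρ) :=
  (continuousOn_sum_energy Δ).mono fun _ hξ => h.ne_zero hξ

/-- The case `n = 0` is orthogonality. The Hamiltonian acts on the positions only; it passes under
the integral and multiplies the eigenfunction by its energy. -/
theorem hamiltonian_pow_apply (h : OrthoRadius N Δ ρ) (Y : Config N) (n : ℕ) (X : Config N) :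
    (hamiltonian N Δ ^ n) (lp.single 2 Y (1 : ℂ)) X =
      ∫ ξ, waveWeight Δ X.pos Y.pos ξ * (∑ j, energy Δ (ξ j)) ^ n ∂torus (fun _ => ρ) := by
  induction n generalizing X with
  | zero =>
    simp only [pow_zero, mul_one, h.integral_eq]
    exact single_apply_eq Y X
  | succ n ih =>
    rw [pow_succ', mul_apply_eq_comp, hamiltonian_apply]
    have h1 : (⇑((hamiltonian N Δ ^ n) (lp.single 2 Y (1 : ℂ))) : Config N → ℂ) = fun X =>
        ∫ ξ, waveWeight Δ X.pos Y.pos ξ * (∑ j, energy Δ (ξ j)) ^ n ∂torus (fun _ => ρ) :=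
      funext fun X => ih X
    rw [h1, action_extend_integral Δ (F := fun X ξ =>
      waveWeight Δ X.pos Y.pos ξ * (∑ j, energy Δ (ξ j)) ^ n) fun X => integrable_torus
        (fun _ => h.pos) ((h.continuousOn_waveWeight _ _).mul (h.continuousOn_energy.pow n))]
    refine integral_congr_ae ((ae_torus fun _ => h.pos).mono fun ξ hξ => ?_)
    beta_reduce
    set c : ℂ := (betheDenom Δ ξ)⁻¹ * (∏ j, ξ j ^ (-Y.pos j)) * (∑ j, energy Δ (ξ j)) ^ n with hc
    have h2 : (fun X : Config N => waveWeight Δ X.pos Y.pos ξ * (∑ j, energy Δ (ξ j)) ^ n) =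
        c • fun X : Config N => bethe Δ X.pos ξ := by
      ext X
      simp only [waveWeight, hc, Pi.smul_apply, smul_eq_mul, div_eq_mul_inv]
      ring
    rw [h2, extend_smul, action_smul, Pi.smul_apply, action_bethe Δ (h.ne_zero hξ), smul_eq_mul,
      hc, waveWeight]
    ring

end OrthoRadius

/-! ### The exponential series and time reversal -/

theorem hasSum_state {N : ℕ} (Δ : ℝ) (Y : Config N) (t : ℝ) (X : Config N) :
    HasSum (fun n : ℕ => ((n.factorial : ℂ)⁻¹ * (-(Complex.I * t)) ^ n) *
      (hamiltonian N Δ ^ n) (lp.single 2 Y (1 : ℂ)) X) (state Δ Y t X) := by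
  have h1 := NormedSpace.exp_series_hasSum_exp' (𝕂 := ℂ)
    ((-(Complex.I * (t : ℂ))) • hamiltonian N Δ)
  have h2 := h1.mapL ((ContinuousLinearMap.apply ℂ (Sector N)) (lp.single 2 Y (1 : ℂ)))
  have h3 := h2.mapL (lp.evalCLM ℂ (fun _ : Config N => ℂ) 2 X)
  have h4 : (fun n : ℕ => ((n.factorial : ℂ)⁻¹ * (-(Complex.I * t)) ^ n) *
      (hamiltonian N Δ ^ n) (lp.single 2 Y (1 : ℂ)) X) = fun n : ℕ =>
      lp.evalCLM ℂ (fun _ : Config N => ℂ) 2 X ((ContinuousLinearMap.apply ℂ (Sector N))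
        (lp.single 2 Y (1 : ℂ)) ((n.factorial : ℂ)⁻¹ •
          ((-(Complex.I * (t : ℂ))) • hamiltonian N Δ) ^ n)) := by
    ext n
    rw [smul_pow, smul_smul, map_smul, map_smul, smul_eq_mul]
    rfl
  rw [h4]
  exact h3

/-- The exponential series is summed under the integral: on the compact torus the weight is bounded
by `C` and the energy by `K`, and `C (|t| K)^n / n!` dominates. -/
theorem OrthoRadius.state_eq {N : ℕ} {Δ ρ : ℝ} (h : OrthoRadius N Δ ρ) (Y : Config N) (t : ℝ)
    (X : Config N) :
    state Δ Y t X = ∫ ξ, waveWeight Δ X.pos Y.pos ξ *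
      Complex.exp (-(Complex.I * t) * ∑ j, energy Δ (ξ j)) ∂torus (fun _ => ρ) := by
  obtain ⟨C, hC⟩ := (isCompact_torusSet fun _ : Fin N => ρ).exists_bound_of_continuousOn
    (h.continuousOn_waveWeight X.pos Y.pos)
  obtain ⟨K, hK⟩ := (isCompact_torusSet fun _ : Fin N => ρ).exists_bound_of_continuousOn
    h.continuousOn_energy
  have hae := ae_torus fun _ : Fin N => h.pos
  have hsum : Summable fun n : ℕ => C * ((|t| * K) ^ n / n.factorial) :=
    (Real.summable_pow_div_factorial _).mul_left C
  have h1 := hasSum_integral_of_dominated_convergence (μ := torus fun _ : Fin N => ρ)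
    (F := fun (n : ℕ) ξ => ((n.factorial : ℂ)⁻¹ * (-(Complex.I * t)) ^ n) *
      (waveWeight Δ X.pos Y.pos ξ * (∑ j, energy Δ (ξ j)) ^ n))
    (f := fun ξ => waveWeight Δ X.pos Y.pos ξ *
      Complex.exp (-(Complex.I * t) * ∑ j, energy Δ (ξ j)))
    (fun n _ => C * ((|t| * K) ^ n / n.factorial))
    (fun n => ((integrable_torus (fun _ => h.pos)
      ((h.continuousOn_waveWeight _ _).mul (h.continuousOn_energy.pow n))).const_mul _).1)
    (fun n => hae.mono fun ξ hξ => ?_) (hae.mono fun _ _ => hsum) (integrable_const _)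
    (hae.mono fun ξ hξ => ?_)
  · refine (hasSum_state Δ Y t X).unique ?_
    simp only [integral_const_mul, ← h.hamiltonian_pow_apply] at h1
    exact h1
  · have h2 := hC ξ hξ
    have h3 := hK ξ hξ
    have hC0 : 0 ≤ C := (norm_nonneg _).trans h2
    rw [norm_mul, norm_mul, norm_mul, norm_pow, norm_pow, norm_inv, norm_neg, norm_mul,
      Complex.norm_I, one_mul, Complex.norm_real, Complex.norm_natCast, Real.norm_eq_abs]
    calc _ ≤ (n.factorial : ℝ)⁻¹ * |t| ^ n * (C * K ^ n) := by gcongr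
      _ = _ := by rw [mul_pow]; ring
  · have h2 := (NormedSpace.expSeries_div_hasSum_exp (𝔸 := ℂ)
      (-(Complex.I * t) * ∑ j, energy Δ (ξ j))).mul_left (waveWeight Δ X.pos Y.pos ξ)
    rw [← Complex.exp_eq_exp_ℂ] at h2
    refine h2.congr_fun fun n => ?_
    rw [mul_pow]
    ring

theorem conj_action {Δ : ℝ} {φ : Amplitude} (h : ∀ X, (starRingEnd ℂ) (φ X) = φ X)
    (X : Finset ℤ) : (starRingEnd ℂ) (action Δ φ X) = action Δ φ X := by
  rw [action_eq_sum, map_sum]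
  refine Finset.sum_congr rfl fun j _ => ?_
  by_cases ha : Active X j
  · simp [bond_apply_of_active Δ j _ X ha, h]
  · simp [bond_apply_of_not_active Δ j _ X ha]

theorem conj_hamiltonian_pow {N : ℕ} (Δ : ℝ) (Y : Config N) (n : ℕ) (X : Config N) :
    (starRingEnd ℂ) ((hamiltonian N Δ ^ n) (lp.single 2 Y (1 : ℂ)) X) =
      (hamiltonian N Δ ^ n) (lp.single 2 Y (1 : ℂ)) X := by
  induction n generalizing X with
  | zero =>
    change (starRingEnd ℂ) ((lp.single 2 Y (1 : ℂ) : Sector N) X) = (lp.single 2 Y (1 : ℂ) : Sector N) X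
    rw [single_apply_eq]
    split_ifs <;> simp
  | succ n ih =>
    rw [pow_succ', mul_apply_eq_comp, hamiltonian_apply]
    refine conj_action (fun Z => ?_) X.1
    by_cases h : Z.card = N
    · simp only [extend, dif_pos h, ih]
    · simp [extend, dif_neg h]

/-- Complex conjugation reverses the time. -/
theorem conj_state {N : ℕ} (Δ : ℝ) (Y : Config N) (t : ℝ) (X : Config N) :
    (starRingEnd ℂ) (state Δ Y t X) = state Δ Y (-t) X := by
  have h1 := (hasSum_state Δ Y t X).star
  refine h1.unique ?_
  refine (hasSum_state Δ Y (-t) X).congr_fun fun n => ?_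
  rw [← starRingEnd_apply]
  simp only [map_mul, map_inv₀, map_pow, map_neg, Complex.conj_I, Complex.conj_ofReal,
    map_natCast, conj_hamiltonian_pow, Complex.ofReal_neg]
  ring

/-! ### The distribution of the left-most particle -/

/-- The time-dependent weight of a Bethe wave function. -/
def evolutionWeight {n : ℕ} (Δ : ℝ) (y : Fin n → ℤ) (t : ℝ) (ξ : Fin n → ℂ) : ℂ :=
  (∏ j, ξ j ^ (-y j)) / betheDenom Δ ξ * Complex.exp (-(Complex.I * t) * ∑ j, energy Δ (ξ j))

namespace OrthoRadius

variable {N : ℕ} {Δ ρ : ℝ}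

theorem state_eq_bethe (h : OrthoRadius N Δ ρ) (Y : Config N) (t : ℝ) (X : Config N) :
    state Δ Y t X = ∫ ξ, bethe Δ X.pos ξ * evolutionWeight Δ Y.pos t ξ ∂torus (fun _ => ρ) := by
  rw [h.state_eq]
  refine integral_congr_ae (Filter.Eventually.of_forall fun ξ => ?_)
  simp only [waveWeight, evolutionWeight]
  ring

theorem continuousOn_evolutionWeight (h : OrthoRadius N Δ ρ) (y : Fin N → ℤ) (t : ℝ) :
    ContinuousOn (evolutionWeight Δ y t) (torusSet fun _ => ρ) :=
  (((continuousOn_prod_zpow _).mono fun _ hξ => h.ne_zero hξ).div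
    (continuous_betheDenom Δ).continuousOn h.betheDenom_ne_zero).mul
    (continuousOn_const.mul h.continuousOn_energy).cexp

theorem continuousOn_bethe (h : OrthoRadius N Δ ρ) (x : Fin N → ℤ) :
    ContinuousOn (bethe Δ x) (torusSet fun _ => ρ) :=
  (XXZ.continuousOn_bethe Δ x).mono fun _ hξ => h.ne_zero hξ

end OrthoRadius

theorem Config.exists_pos_eq {N : ℕ} {x : Fin N → ℤ} (hx : StrictMono x) :
    ∃ X : Config N, X.pos = x :=
  have hc : (Finset.univ.image x).card = N := by
    rw [Finset.card_image_of_injective _ hx.injective, Finset.card_univ, Fintype.card_fin]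
  ⟨⟨Finset.univ.image x, hc⟩, Config.pos_eq _ hx fun j => Finset.mem_image_of_mem _
    (Finset.mem_univ j)⟩

theorem summable_norm_state_sq {N : ℕ} (Δ : ℝ) (Y : Config N) (t : ℝ) :
    Summable fun X : Config N => ‖state Δ Y t X‖ ^ 2 := by
  have := lp.hasSum_norm (p := 2) (by norm_num) (state Δ Y t)
  simpa using this.summable

/-- The configurations whose left-most particle is at or to the right of `x`. -/
def incSeqEquiv {N : ℕ} (hN : 0 < N) (x : ℤ) :
    (Σ n : {n : ℤ // x ≤ n}, {X : Config N // X.pos ⟨0, hN⟩ = n.1}) ≃ IncSeq x N :=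
  Equiv.ofBijective (fun p => ⟨p.2.1.pos, p.2.1.strictMono_pos, fun j =>
      (p.1.2.trans p.2.2.ge).trans (p.2.1.strictMono_pos.monotone (Fin.mk_le_of_le_val
        (Nat.zero_le _)))⟩) <| by
    constructor
    · rintro ⟨⟨n, hn⟩, X, hX⟩ ⟨⟨m, hm⟩, Z, hZ⟩ h
      have h1 : X = Z := Config.pos_injective (congrArg Subtype.val h)
      subst h1
      simp only at hX hZ
      subst hX
      subst hZ
      rfl
    · rintro ⟨z, hz, hxz⟩
      obtain ⟨X, rfl⟩ := Config.exists_pos_eq hz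
      exact ⟨⟨⟨X.pos ⟨0, hN⟩, hxz _⟩, X, rfl⟩, rfl⟩

theorem probFirstGE_eq_tsum {N : ℕ} (hN : 0 < N) (Δ : ℝ) (Y : Config N) (x : ℤ) (t : ℝ) :
    probFirstGE hN Δ Y x t = ∑' p : (Σ n : {n : ℤ // x ≤ n}, {X : Config N // X.pos ⟨0, hN⟩ = n.1}),
      ‖state Δ Y t p.2.1‖ ^ 2 := by
  have hs : Summable fun p : (Σ n : {n : ℤ // x ≤ n}, {X : Config N // X.pos ⟨0, hN⟩ = n.1}) =>
      ‖state Δ Y t p.2.1‖ ^ 2 := by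
    refine (summable_norm_state_sq Δ Y t).comp_injective (i := fun p :
      (Σ n : {n : ℤ // x ≤ n}, {X : Config N // X.pos ⟨0, hN⟩ = n.1}) => p.2.1) fun p q h => ?_
    exact (incSeqEquiv hN x).injective (Subtype.ext (congrArg Config.pos h))
  rw [hs.tsum_sigma]
  rfl

/-- Conjugation reverses time, so the square is a product of two amplitudes. They are represented on
circles of different radii, which will produce summable powers of `R r`. -/
theorem norm_state_sq {N : ℕ} {Δ R r : ℝ} (hR : OrthoRadius N Δ R) (hr : OrthoRadius N Δ r)
    (Y : Config N) (t : ℝ) (X : Config N) :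
    ((‖state Δ Y t X‖ ^ 2 : ℝ) : ℂ) = ∫ p, (bethe Δ X.pos p.1 * evolutionWeight Δ Y.pos t p.1) *
      (bethe Δ X.pos p.2 * evolutionWeight Δ Y.pos (-t) p.2)
        ∂(torus fun _ : Fin N => R).prod (torus fun _ : Fin N => r) := by
  rw [integral_prod_mul (fun ξ => bethe Δ X.pos ξ * evolutionWeight Δ Y.pos t ξ)
    (fun ξ => bethe Δ X.pos ξ * evolutionWeight Δ Y.pos (-t) ξ), ← hR.state_eq_bethe,
    ← hr.state_eq_bethe, ← conj_state, Complex.mul_conj, Complex.normSq_eq_norm_sq]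

theorem ae_prod_torus {N : ℕ} {R r : ℝ} (hR : 0 < R) (hr : 0 < r) :
    ∀ᵐ p ∂(torus fun _ : Fin N => R).prod (torus fun _ : Fin N => r),
      (p.1 ∈ torusSet fun _ : Fin N => R) ∧ (p.2 ∈ torusSet fun _ : Fin N => r) :=
  (Measure.quasiMeasurePreserving_fst.ae (ae_torus fun _ => hR)).and
    (Measure.quasiMeasurePreserving_snd.ae (ae_torus fun _ => hr))

/-- On the product of two tori no mixed factor vanishes, up to a null set. -/
theorem ae_mixed_ne_zero {N : ℕ} (Δ : ℝ) {R r : ℝ} (hR : 0 < R) (hr : 0 < r) :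
    ∀ᵐ p ∂(torus fun _ : Fin N => R).prod (torus fun _ : Fin N => r),
      ∀ j k, p.1 j + p.2 k - 2 * (Δ : ℂ) * p.1 j * p.2 k ≠ 0 := by
  refine ae_all_iff.2 fun j => ae_all_iff.2 fun k => ?_
  have hm : MeasurableSet {p : (Fin N → ℂ) × (Fin N → ℂ) |
      p.1 j + p.2 k - 2 * Δ * p.1 j * p.2 k = 0} :=
    (isClosed_eq (by fun_prop) continuous_const).measurableSet
  refine (Measure.ae_prod_iff_ae_ae (p := fun p : (Fin N → ℂ) × (Fin N → ℂ) =>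
    p.1 j + p.2 k - 2 * Δ * p.1 j * p.2 k ≠ 0) hm.compl).2 ?_
  refine (ae_torus fun _ => hR).mono fun ξ hξ => ?_
  have hξj : ξ j ≠ 0 := ne_zero_of_mem_torusSet (fun _ => hR) hξ j
  have hne : ∀ z : ℂ, ∀ᵐ ζ ∂torus (fun _ : Fin N => r), ζ k ≠ z := fun z => by
    refine (Measure.tendsto_eval_ae_ae (μ := fun _ : Fin N => circ r) (i := k)).eventually
      (p := fun w => w ≠ z) ?_
    rw [ae_iff]
    simpa using circ_singleton hr z
  -- For fixed `ξ` at most one value of `ζ_k` is bad, and the circle measure has no atoms. If `1 -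
  -- 2Δ ξ_j = 0`, a zero would force `ξ_j = 0`.
  refine (hne (-ξ j / (1 - 2 * Δ * ξ j))).mono fun ζ hζ h => ?_
  have h1 : ζ k * (1 - 2 * Δ * ξ j) = -ξ j := by linear_combination h
  have h2 : 1 - 2 * Δ * ξ j ≠ 0 := fun h2 => by
    rw [h2, mul_zero] at h1
    exact hξj (neg_eq_zero.1 h1.symm)
  exact hζ ((eq_div_iff h2).2 h1)

/-- The factor `∏ ξ_j ζ_j` on the right is the Jacobian between the uniform measure and the contour
differentials; it accounts for the `-1` in the exponent `x - y_j - 1`. -/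
theorem evolutionWeight_mul_eq_integrandD {N : ℕ} (Δ : ℝ) (Y : Config N) (x : ℤ) (t : ℝ)
    {ξ ζ : Fin N → ℂ} (hξ : ∀ j, ξ j ≠ 0) (hζ : ∀ j, ζ j ≠ 0) :
    ((∏ j, ξ j) * ∏ j, ζ j) ^ x * (mixedProd Δ ξ ζ * detD Δ ξ ζ) *
        (evolutionWeight Δ Y.pos t ξ * evolutionWeight Δ Y.pos (-t) ζ) =
      ((∏ j, ξ j) * ∏ j, ζ j) * integrandD Δ Y x t ξ ζ := by
  have h1 : timeFactor Δ Y x t ξ ζ * ((∏ j, ξ j) * ∏ j, ζ j) =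
      ((∏ j, ξ j) * ∏ j, ζ j) ^ x * ((∏ j, ξ j ^ (-Y.pos j)) * ∏ j, ζ j ^ (-Y.pos j)) *
        (Complex.exp (-(Complex.I * t) * ∑ j, energy Δ (ξ j)) *
          Complex.exp (-(Complex.I * (-t : ℝ)) * ∑ j, energy Δ (ζ j))) := by
    rw [← Complex.exp_add, Finset.mul_sum, Finset.mul_sum, ← Finset.sum_add_distrib,
      Complex.exp_sum, timeFactor, ← Finset.prod_mul_distrib, ← Finset.prod_mul_distrib,
      ← Finset.prod_zpow, ← Finset.prod_mul_distrib, ← Finset.prod_mul_distrib,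
      ← Finset.prod_mul_distrib]
    refine Finset.prod_congr rfl fun j _ => ?_
    have h0 := mul_ne_zero (hξ j) (hζ j)
    have h2 : (ξ j * ζ j) ^ (x - Y.pos j - 1) * (ξ j * ζ j) =
        (ξ j * ζ j) ^ x * (ξ j ^ (-Y.pos j) * ζ j ^ (-Y.pos j)) := by
      rw [← mul_zpow, ← zpow_add₀ h0, ← zpow_add_one₀ h0]
      congr 1
      ring
    have h3 : -(Complex.I * t * (energy Δ (ξ j) - energy Δ (ζ j))) =
        -(Complex.I * t) * energy Δ (ξ j) + -(Complex.I * (-t : ℝ)) * energy Δ (ζ j) := by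
      push_cast
      ring
    rw [h3, ← h2]
    ring
  rw [integrandD, evolutionWeight, evolutionWeight]
  linear_combination -(mixedProd Δ ξ ζ * detD Δ ξ ζ /
    (betheDenom Δ ξ * betheDenom Δ ζ)) * h1

/-- The sum over configurations is moved inside the integral, where `hasSum_bethe_mul_bethe`
evaluates it almost everywhere. The summands are dominated by a multiple of `(R r)^{∑ x_j}`,
summable because `R r < 1` and the positions are bounded below. -/
theorem probFirstGE_eq_integral {N : ℕ} (hN : 0 < N) {Δ R r : ℝ} (hR : OrthoRadius N Δ R)
    (hr : OrthoRadius N Δ r) (hRr : R * r < 1) (Y : Config N) (x : ℤ) (t : ℝ) :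
    ((probFirstGE hN Δ Y x t : ℝ) : ℂ) =
      ∫ p, ((∏ j, p.1 j) * ∏ j, p.2 j) * integrandD Δ Y x t p.1 p.2
        ∂(torus fun _ : Fin N => R).prod (torus fun _ : Fin N => r) := by
  obtain ⟨C, hC⟩ := (isCompact_torusSet fun _ : Fin N => R).exists_bound_of_continuousOn
    (hR.continuousOn_evolutionWeight Y.pos t)
  obtain ⟨D, hD⟩ := (isCompact_torusSet fun _ : Fin N => r).exists_bound_of_continuousOn
    (hr.continuousOn_evolutionWeight Y.pos (-t))
  set μ := (torus fun _ : Fin N => R).prod (torus fun _ : Fin N => r) with hμ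
  have hae := ae_prod_torus (N := N) hR.pos hr.pos
  have hsum := (summable_zpow_sum (mul_pos hR.pos hr.pos) hRr x N).mul_left
    (betheBound Δ N R * betheBound Δ N r * (C * D))
  have key := hasSum_integral_of_dominated_convergence (μ := μ)
    (F := fun (z : IncSeq x N) p => (bethe Δ z.1 p.1 * evolutionWeight Δ Y.pos t p.1) *
      (bethe Δ z.1 p.2 * evolutionWeight Δ Y.pos (-t) p.2))
    (f := fun p => ((∏ j, p.1 j) * ∏ j, p.2 j) * integrandD Δ Y x t p.1 p.2)
    (fun z _ => betheBound Δ N R * betheBound Δ N r * (C * D) * (R * r) ^ (∑ j, z.1 j))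
    (fun z => (((integrable_torus (fun _ => hR.pos) ((hR.continuousOn_bethe z.1).mul
      (hR.continuousOn_evolutionWeight Y.pos t))).mul_prod (integrable_torus (fun _ => hr.pos)
      ((hr.continuousOn_bethe z.1).mul (hr.continuousOn_evolutionWeight Y.pos (-t)))))).1)
    (fun z => hae.mono fun p hp => ?_) (hae.mono fun _ _ => hsum) (integrable_const _)
    ((hae.and (ae_mixed_ne_zero Δ hR.pos hr.pos)).mono fun p hp => ?_)
  · rw [probFirstGE_eq_tsum, Complex.ofReal_tsum, ← key.tsum_eq, ← (incSeqEquiv hN x).tsum_eq]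
    exact tsum_congr fun p => norm_state_sq hR hr Y t p.2.1
  · have h1 := norm_bethe_le Δ z.1 hR.pos hp.1
    have h2 := norm_bethe_le Δ z.1 hr.pos hp.2
    have h3 := hC _ hp.1
    have h4 := hD _ hp.2
    have hC0 := (norm_nonneg _).trans h3
    have h10 := (norm_nonneg _).trans h1
    have h20 := (norm_nonneg _).trans h2
    rw [norm_mul, norm_mul, norm_mul, mul_zpow]
    calc _ ≤ ((betheBound Δ N R * R ^ (∑ j, z.1 j)) * C) *
          ((betheBound Δ N r * r ^ (∑ j, z.1 j)) * D) := by gcongr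
      _ = _ := by ring
  · have h1 := (hasSum_bethe_mul_bethe Δ x p.1 p.2 hR.pos hr.pos hRr hp.1.1 hp.1.2 hp.2).mul_right
      (evolutionWeight Δ Y.pos t p.1 * evolutionWeight Δ Y.pos (-t) p.2)
    rw [evolutionWeight_mul_eq_integrandD Δ Y x t (hR.ne_zero hp.1.1) (hr.ne_zero hp.1.2)] at h1
    exact h1.congr_fun fun z => by ring

/-! ### Contour integrals as integrals over the product of two tori -/

theorem measurable_torusMap {n : ℕ} (ρ : Fin n → ℝ) : Measurable (torusMap 0 ρ) := by
  unfold torusMap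
  fun_prop

theorem torus_eq_map {n : ℕ} (ρ : Fin n → ℝ) :
    torus ρ = (ENNReal.ofReal (2 * Real.pi)⁻¹) ^ n •
      (volume.restrict (Set.Icc (0 : Fin n → ℝ) fun _ => 2 * Real.pi)).map (torusMap 0 ρ) := by
  refine Measure.pi_eq fun s hs => ?_
  have hpre : torusMap 0 ρ ⁻¹' Set.univ.pi s ∩ Set.Icc (0 : Fin n → ℝ) (fun _ => 2 * Real.pi) =
      Set.univ.pi fun j => circleMap 0 (ρ j) ⁻¹' s j ∩ Set.Icc 0 (2 * Real.pi) := by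
    ext θ
    simp only [Set.mem_inter_iff, Set.mem_preimage, Set.mem_univ_pi, Set.mem_Icc, Pi.le_def,
      torusMap, circleMap, Pi.zero_apply]
    exact ⟨fun h j => ⟨h.1 j, h.2.1 j, h.2.2 j⟩,
      fun h => ⟨fun j => (h j).1, fun j => (h j).2.1, fun j => (h j).2.2⟩⟩
  have hm := MeasurableSet.univ_pi hs
  rw [Measure.smul_apply, Measure.map_apply (measurable_torusMap ρ) hm,
    Measure.restrict_apply (measurable_torusMap ρ hm), hpre, volume_pi_pi, smul_eq_mul]
  have hc : ∀ j, circ (ρ j) (s j) = ENNReal.ofReal (2 * Real.pi)⁻¹ *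
      volume (circleMap 0 (ρ j) ⁻¹' s j ∩ Set.Icc 0 (2 * Real.pi)) := fun j => by
    rw [circ, Measure.smul_apply, Measure.map_apply (measurable_circleMap _) (hs j),
      Measure.restrict_apply (measurable_circleMap _ (hs j)), smul_eq_mul]
  simp only [hc, Finset.prod_mul_distrib, Finset.prod_const, Finset.card_univ, Fintype.card_fin]

theorem torusIntegrable_of_integrable_torus {n : ℕ} {ρ : Fin n → ℝ} {f : (Fin n → ℂ) → ℂ}
    (hf : Integrable f (torus ρ)) : TorusIntegrable f 0 ρ := by
  rw [torus_eq_map, integrable_smul_measure (pow_ne_zero _ (by simpa using Real.pi_pos))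
    (ENNReal.pow_ne_top ENNReal.ofReal_ne_top)] at hf
  exact hf.comp_measurable (measurable_torusMap ρ)

/-- Each differential `dz_j` is `i z_j dθ_j`, whence the product of the `z_j`. -/
theorem torusIntegral_eq {n : ℕ} {ρ : Fin n → ℝ} {f : (Fin n → ℂ) → ℂ}
    (hf : Integrable f (torus ρ)) :
    torusIntegral f 0 ρ = (2 * Real.pi * Complex.I) ^ n * ∫ z, (∏ j, z j) * f z ∂torus ρ := by
  have h1 : AEStronglyMeasurable (fun z : Fin n → ℂ => (∏ j, z j) * f z)
      ((volume.restrict (Set.Icc (0 : Fin n → ℝ) fun _ => 2 * Real.pi)).map (torusMap 0 ρ)) := by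
    rw [torus_eq_map, integrable_smul_measure (pow_ne_zero _ (by simpa using Real.pi_pos))
      (ENNReal.pow_ne_top ENNReal.ofReal_ne_top)] at hf
    exact (Continuous.aestronglyMeasurable (by fun_prop)).mul hf.1
  rw [torus_eq_map, integral_smul_measure, integral_map (measurable_torusMap ρ).aemeasurable h1,
    ENNReal.toReal_pow, ENNReal.toReal_ofReal (by positivity), torusIntegral, Complex.real_smul,
    ← mul_assoc, ← integral_const_mul]
  have h2 : (2 * (Real.pi : ℂ)) ≠ 0 := by simp [Real.pi_ne_zero]
  refine integral_congr_ae (Filter.Eventually.of_forall fun θ => ?_)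
  simp only [torusMap, Pi.zero_apply, zero_add, smul_eq_mul, Finset.prod_mul_distrib,
    Finset.prod_const, Finset.card_univ, Fintype.card_fin]
  push_cast
  rw [mul_pow, inv_pow]
  have h3 := pow_ne_zero n h2
  generalize ∏ j, Complex.exp (θ j * Complex.I) = E
  field_simp

theorem measurePreserving_append {m n : ℕ} (ρ : Fin m → ℝ) (ρ' : Fin n → ℝ) :
    MeasurePreserving (fun p : (Fin m → ℂ) × (Fin n → ℂ) => Fin.append p.1 p.2)
      ((torus ρ).prod (torus ρ')) (torus (Fin.append ρ ρ')) := by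
  have hm : Measurable fun p : (Fin m → ℂ) × (Fin n → ℂ) => Fin.append p.1 p.2 := by
    refine measurable_pi_lambda _ fun j => ?_
    induction j using Fin.addCases with
    | left j => simp only [Fin.append_left]; fun_prop
    | right j => simp only [Fin.append_right]; fun_prop
  refine ⟨hm, (Measure.pi_eq fun s hs => ?_).symm⟩
  have hpre : (fun p : (Fin m → ℂ) × (Fin n → ℂ) => Fin.append p.1 p.2) ⁻¹' Set.univ.pi s =
      (Set.univ.pi fun j => s (Fin.castAdd n j)) ×ˢ (Set.univ.pi fun j => s (Fin.natAdd m j)) := by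
    ext p
    simp only [Set.mem_preimage, Set.mem_univ_pi, Set.mem_prod]
    refine ⟨fun h => ⟨fun j => ?_, fun j => ?_⟩, fun h j => ?_⟩
    · simpa using h (Fin.castAdd n j)
    · simpa using h (Fin.natAdd m j)
    · induction j using Fin.addCases with
      | left j => simpa using h.1 j
      | right j => simpa using h.2 j
  rw [Measure.map_apply hm (MeasurableSet.univ_pi hs), hpre, Measure.prod_prod, torus, torus,
    Measure.pi_pi, Measure.pi_pi, Fin.prod_univ_add]
  simp only [Fin.append_left, Fin.append_right]

theorem measurePreserving_split {m n : ℕ} (ρ : Fin m → ℝ) (ρ' : Fin n → ℝ) :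
    MeasurePreserving (fun z : Fin (m + n) → ℂ =>
      ((fun j => z (Fin.castAdd n j), fun j => z (Fin.natAdd m j)) : (Fin m → ℂ) × (Fin n → ℂ)))
      (torus (Fin.append ρ ρ')) ((torus ρ).prod (torus ρ')) := by
  have hm : Measurable (fun z : Fin (m + n) → ℂ =>
      ((fun j => z (Fin.castAdd n j), fun j => z (Fin.natAdd m j)) :
        (Fin m → ℂ) × (Fin n → ℂ))) := by fun_prop
  refine ⟨hm, ?_⟩
  have h := measurePreserving_append ρ ρ'
  rw [← h.map_eq, Measure.map_map hm h.measurable]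
  convert Measure.map_id
  ext p <;> simp

theorem contourIntegrable_and_contourIntegral_eq {N : ℕ} {R r : ℝ}
    {f : (Fin N → ℂ) → (Fin N → ℂ) → ℂ}
    (hf : Integrable (fun p : (Fin N → ℂ) × (Fin N → ℂ) => f p.1 p.2)
      ((torus fun _ => R).prod (torus fun _ => r))) :
    ContourIntegrable R r f ∧ contourIntegral R r f =
      ∫ p, ((∏ j, p.1 j) * ∏ j, p.2 j) * f p.1 p.2
        ∂(torus fun _ : Fin N => R).prod (torus fun _ : Fin N => r) := by
  have h := measurePreserving_split (fun _ : Fin N => R) (fun _ : Fin N => r)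
  have hj : Integrable (joint f) (torus (radii N R r)) := h.integrable_comp_of_integrable hf
  refine ⟨torusIntegrable_of_integrable_torus hj, ?_⟩
  have h2 : (2 * (Real.pi : ℂ) * Complex.I) ≠ 0 := by simp [Real.pi_ne_zero]
  have h3 : AEStronglyMeasurable (fun p : (Fin N → ℂ) × (Fin N → ℂ) =>
      ((∏ j, p.1 j) * ∏ j, p.2 j) * f p.1 p.2)
      ((torus fun _ : Fin N => R).prod (torus fun _ : Fin N => r)) :=
    (Continuous.aestronglyMeasurable (by fun_prop)).mul hf.1
  rw [contourIntegral, torusIntegral_eq hj, two_mul N, inv_mul_cancel_left₀ (pow_ne_zero _ h2)]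
  rw [← h.map_eq] at h3 ⊢
  rw [integral_map h.measurable.aemeasurable h3]
  simp only [Fin.prod_univ_add, joint, radii]

/-! ### The polynomial numerator of the determinant -/

/-- The numerator of `det (1 / c j k)` over the common denominator `∏ c j k`. -/
def permProd {n : ℕ} {A : Type*} [CommRing A] (c : Fin n → Fin n → A) : A :=
  ∑ σ : Equiv.Perm (Fin n), ((Equiv.Perm.sign σ : ℤ) : A) *
    ∏ j, ∏ k, if k = σ j then 1 else c j k

theorem map_permProd {n : ℕ} {A B : Type*} [CommRing A] [CommRing B] (f : A →+* B)
    (c : Fin n → Fin n → A) : f (permProd c) = permProd fun j k => f (c j k) := by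
  simp only [permProd, map_sum, map_mul, map_intCast, map_prod, apply_ite f, map_one]

theorem permProd_transpose {n : ℕ} {A : Type*} [CommRing A] (c : Fin n → Fin n → A) :
    permProd (fun j k => c k j) = permProd c := by
  rw [permProd, permProd, ← Equiv.sum_comp (Equiv.inv (Equiv.Perm (Fin n)))]
  refine Finset.sum_congr rfl fun σ _ => ?_
  rw [Finset.prod_comm]
  simp only [Equiv.inv_apply, Equiv.Perm.sign_inv]
  congr 1
  refine Finset.prod_congr rfl fun j _ => Finset.prod_congr rfl fun k _ => ?_
  congr 1
  rw [Equiv.Perm.eq_inv_iff_eq]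
  exact propext eq_comm

/-- Reindexing the sum by `σ ↦ μ σ τ⁻¹` gives antisymmetry in rows and columns separately. -/
theorem permProd_comp_perm {n : ℕ} {A : Type*} [CommRing A] (c : Fin n → Fin n → A)
    (τ μ : Equiv.Perm (Fin n)) :
    permProd (fun j k => c (τ j) (μ k)) =
      ((Equiv.Perm.sign τ : ℤ) : A) * ((Equiv.Perm.sign μ : ℤ) : A) * permProd c := by
  have h3 : permProd c = ∑ σ : Equiv.Perm (Fin n), ((Equiv.Perm.sign (μ * σ * τ⁻¹) : ℤ) : A) *
      ∏ j, ∏ k, if k = (μ * σ * τ⁻¹) j then 1 else c j k :=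
    (Equiv.sum_comp ((Equiv.mulLeft μ).trans (Equiv.mulRight τ⁻¹)) _).symm
  rw [h3, permProd, Finset.mul_sum]
  refine Finset.sum_congr rfl fun σ _ => ?_
  have h1 : ∏ j, ∏ k, (if k = σ j then 1 else c (τ j) (μ k)) =
      ∏ j, ∏ k, (if k = (μ * σ * τ⁻¹) j then 1 else c j k) := by
    rw [← Equiv.prod_comp τ (fun j => ∏ k, (if k = (μ * σ * τ⁻¹) j then 1 else c j k))]
    refine Finset.prod_congr rfl fun j _ => ?_
    rw [← Equiv.prod_comp μ (fun k => if k = (μ * σ * τ⁻¹) (τ j) then 1 else c (τ j) k)]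
    simp
  have h2 : ∀ ρ : Equiv.Perm (Fin n),
      ((Equiv.Perm.sign ρ : ℤ) : A) * ((Equiv.Perm.sign ρ : ℤ) : A) = 1 := fun ρ => by
    rw [← Int.cast_mul, ← Units.val_mul, Int.units_mul_self, Units.val_one, Int.cast_one]
  rw [h1]
  simp only [Equiv.Perm.sign_mul, Equiv.Perm.sign_inv, Units.val_mul, Int.cast_mul]
  linear_combination (-((Equiv.Perm.sign σ : ℤ) : A) * (∏ j, ∏ k,
    if k = (μ * σ * τ⁻¹) j then 1 else c j k)) * (h2 τ * ((Equiv.Perm.sign μ : ℤ) : A) ^ 2 + h2 μ)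

theorem permProd_eq_mul_det {n : ℕ} {K : Type*} [Field K] {c : Fin n → Fin n → K}
    (hc : ∀ j k, c j k ≠ 0) :
    permProd c = (∏ j, ∏ k, c j k) * Matrix.det (Matrix.of fun i j => 1 / c i j) := by
  rw [← Matrix.det_transpose, Matrix.det_apply', permProd, Finset.mul_sum]
  refine Finset.sum_congr rfl fun σ _ => ?_
  have h1 : ∀ j, (∏ k, if k = σ j then 1 else c j k) = (∏ k, c j k) * (1 / c j (σ j)) := by
    intro j
    rw [← Finset.mul_prod_erase _ (fun k => c j k) (Finset.mem_univ (σ j)),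
      ← Finset.mul_prod_erase _ _ (Finset.mem_univ (σ j)), if_pos rfl, one_mul,
      mul_comm (c j (σ j)), mul_assoc, mul_one_div_cancel (hc _ _), mul_one]
    exact Finset.prod_congr rfl fun k hk => if_neg (Finset.ne_of_mem_erase hk)
  simp only [h1, Finset.prod_mul_distrib, Matrix.transpose_apply, Matrix.of_apply]
  ring

theorem prod_Ioi_sub_comp_perm {n : ℕ} {A : Type*} [CommRing A] (v : Fin n → A)
    (σ : Equiv.Perm (Fin n)) :
    ∏ j, ∏ k ∈ Finset.Ioi j, (v (σ k) - v (σ j)) =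
      ((Equiv.Perm.sign σ : ℤ) : A) * ∏ j, ∏ k ∈ Finset.Ioi j, (v k - v j) := by
  rw [← Matrix.det_vandermonde v, ← Matrix.det_permute, ← Matrix.det_vandermonde fun j => v (σ j)]
  rfl

/-! ### Divisibility by the Vandermonde polynomials -/

open MvPolynomial

theorem irreducible_X_sub_X {ι : Type*} {u v : ι} (h : u ≠ v) :
    Irreducible (X v - X u : MvPolynomial ι ℂ) := by
  classical
  have hc : coeff (Finsupp.single v 1) (X v - X u : MvPolynomial ι ℂ) = 1 := by
    have h1 : Finsupp.single u 1 ≠ Finsupp.single v 1 := fun h' =>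
      h (Finsupp.single_left_injective one_ne_zero h')
    simp [coeff_X, h1]
  refine irreducible_of_totalDegree_eq_one (le_antisymm ?_ ?_) fun x hx => ?_
  · refine (totalDegree_sub _ _).trans ?_
    simp [totalDegree_X]
  · have h1 := le_totalDegree (s := Finsupp.single v 1) (p := (X v - X u : MvPolynomial ι ℂ))
      (by rw [mem_support_iff, hc]; exact one_ne_zero)
    simpa using h1
  · exact isUnit_of_dvd_one (hc ▸ hx (Finsupp.single v 1))

/-- The first factor is irreducible, and evaluation at the indicator of `w` kills it but not the
second one. -/
theorem isRelPrime_X_sub_X {ι : Type*} {u v u' v' : ι} (h : u ≠ v) {w : ι}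
    (hw : w = u' ∧ w ≠ v' ∨ w = v' ∧ w ≠ u') (hwu : w ≠ u) (hwv : w ≠ v) :
    IsRelPrime (X v - X u : MvPolynomial ι ℂ) (X v' - X u') := by
  classical
  rw [(irreducible_X_sub_X h).isRelPrime_iff_not_dvd]
  intro hd
  have h1 := map_dvd (eval (Pi.single w (1 : ℂ))) hd
  simp only [map_sub, eval_X, Pi.single_apply, if_neg hwu.symm, if_neg hwv.symm, sub_zero,
    zero_dvd_iff] at h1
  rcases hw with ⟨h2, h3⟩ | ⟨h2, h3⟩
  · simp [← h2, h3.symm] at h1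
  · simp [← h2, h3.symm] at h1

/-- Modulo `X v - X u` the transposition acts trivially, so `p` equals `-p` there, and `2` is
invertible. -/
theorem X_sub_X_dvd_of_antisymm {ι : Type*} [DecidableEq ι] {p : MvPolynomial ι ℂ} {u v : ι}
    (h : rename (Equiv.swap u v) p = -p) : X v - X u ∣ p := by
  set I : Ideal (MvPolynomial ι ℂ) := Ideal.span {X v - X u} with hI
  have hX : Ideal.Quotient.mkₐ ℂ I (X v) = Ideal.Quotient.mkₐ ℂ I (X u) :=
    Ideal.Quotient.eq.2 (Ideal.subset_span rfl)
  have h1 : (Ideal.Quotient.mkₐ ℂ I).comp (rename (R := ℂ) (Equiv.swap u v)) = Ideal.Quotient.mkₐ ℂ I := by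
    refine algHom_ext fun w => ?_
    rw [AlgHom.comp_apply, rename_X, Equiv.swap_apply_def]
    split_ifs with h2 h3
    · rw [h2, hX]
    · rw [h3, hX]
    · rfl
  have h2 := DFunLike.congr_fun h1 p
  rw [AlgHom.comp_apply, h] at h2
  have h3 : -p - p ∈ I := Ideal.Quotient.eq.1 h2
  have h4 : p = C (-(1 / 2)) * (-p - p) := by
    have h5 : (C (-(1 / 2)) : MvPolynomial ι ℂ) * C (-2) = 1 := by
      rw [← C_mul]
      norm_num
    have h6 : (C (-2) : MvPolynomial ι ℂ) = -2 := by
      rw [map_neg, map_ofNat]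
    rw [h6] at h5
    linear_combination (-p) * h5
  rw [h4]
  exact Dvd.dvd.mul_left (Ideal.mem_span_singleton.1 h3) _

/-- The product of the Vandermonde polynomials of the two groups of variables. -/
def vandermondePoly (N : ℕ) : MvPolynomial (Fin N ⊕ Fin N) ℂ :=
  (∏ j : Fin N, ∏ k ∈ Finset.Ioi j, (X (Sum.inl k) - X (Sum.inl j))) *
    ∏ j : Fin N, ∏ k ∈ Finset.Ioi j, (X (Sum.inr k) - X (Sum.inr j))

-- In the order on the disjoint sum, elements of different summands are incomparable, so one product
-- over ordered pairs covers both groups.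
open Classical in
theorem vandermondePoly_eq (N : ℕ) : vandermondePoly N =
    ∏ p : (Fin N ⊕ Fin N) × (Fin N ⊕ Fin N) with p.1 < p.2, (X p.2 - X p.1) := by
  rw [Finset.prod_filter, Fintype.prod_prod_type, Fintype.prod_sum_type, vandermondePoly]
  simp [Fintype.prod_sum_type, prod_Ioi_eq_prod_ite]

/-- The linear factors are pairwise coprime, so it suffices that each of them divides `p`. -/
theorem vandermondePoly_dvd {N : ℕ} {p : MvPolynomial (Fin N ⊕ Fin N) ℂ}
    (hl : ∀ i j : Fin N, i ≠ j → rename (Equiv.swap (Sum.inl i) (Sum.inl j)) p = -p)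
    (hr : ∀ i j : Fin N, i ≠ j → rename (Equiv.swap (Sum.inr i) (Sum.inr j)) p = -p) :
    vandermondePoly N ∣ p := by
  rw [vandermondePoly_eq]
  refine Finset.prod_dvd_of_isRelPrime (fun a ha b hb hab => ?_) fun a ha => ?_
  · simp only [Finset.coe_filter, Finset.mem_univ, true_and, Set.mem_ofPred_eq] at ha hb
    by_cases h1 : b.1 = a.1 ∨ b.1 = a.2
    · have h2 : b.2 ≠ a.1 := by
        intro h2
        rcases h1 with h1 | h1
        · exact hb.ne (h1.trans h2.symm)
        · rw [h1, h2] at hb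
          exact lt_asymm ha hb
      have h3 : b.2 ≠ a.2 := by
        intro h3
        rcases h1 with h1 | h1
        · exact hab (Prod.ext h1.symm h3.symm)
        · exact hb.ne (h1.trans h3.symm)
      exact isRelPrime_X_sub_X ha.ne (Or.inr ⟨rfl, hb.ne'⟩) h2 h3
    · push Not at h1
      exact isRelPrime_X_sub_X ha.ne (Or.inl ⟨rfl, hb.ne⟩) h1.1 h1.2
  · obtain ⟨u, v⟩ := a
    have ha' : u < v := by simpa using ha
    rcases u with i | i <;> rcases v with j | j
    · exact X_sub_X_dvd_of_antisymm (hl i j fun h => by simp [h] at ha')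
    · simp at ha'
    · simp at ha'
    · exact X_sub_X_dvd_of_antisymm (hr i j fun h => by simp [h] at ha')

theorem vandermondePoly_ne_zero (N : ℕ) : vandermondePoly N ≠ 0 := by
  rw [vandermondePoly_eq]
  exact Finset.prod_ne_zero_iff.2 fun p hp =>
    (irreducible_X_sub_X (show p.1 < p.2 by simpa using hp).ne).ne_zero

theorem eval_vandermondePoly {N : ℕ} (ξ ζ : Fin N → ℂ) :
    eval (Sum.elim ξ ζ) (vandermondePoly N) = vandermonde ξ * vandermonde ζ := by
  simp [vandermondePoly, vandermonde]

theorem rename_vandermondePoly {N : ℕ} (τ μ : Equiv.Perm (Fin N)) :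
    rename (Equiv.sumCongr τ μ) (vandermondePoly N) =
      ((Equiv.Perm.sign τ : ℤ) : MvPolynomial (Fin N ⊕ Fin N) ℂ) *
        ((Equiv.Perm.sign μ : ℤ) : MvPolynomial (Fin N ⊕ Fin N) ℂ) * vandermondePoly N := by
  have h1 := prod_Ioi_sub_comp_perm
    (fun j : Fin N => (X (Sum.inl j) : MvPolynomial (Fin N ⊕ Fin N) ℂ)) τ
  have h2 := prod_Ioi_sub_comp_perm
    (fun j : Fin N => (X (Sum.inr j) : MvPolynomial (Fin N ⊕ Fin N) ℂ)) μ
  simp only [vandermondePoly, map_mul, map_prod, map_sub, rename_X, Equiv.sumCongr_apply,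
    Sum.map_inl, Sum.map_inr]
  rw [h1, h2]
  ring

/-! ### The numerator polynomial of the determinant -/

/-- `(1 - ξ_j ζ_k) (ξ_j + ζ_k - 2Δ ξ_j ζ_k)` as a polynomial. -/
def pairPoly {N : ℕ} (Δ : ℝ) (j k : Fin N) : MvPolynomial (Fin N ⊕ Fin N) ℂ :=
  (1 - X (Sum.inl j) * X (Sum.inr k)) *
    (X (Sum.inl j) + X (Sum.inr k) - C (2 * (Δ : ℂ)) * X (Sum.inl j) * X (Sum.inr k))

/-- `∏_{j,k} (1 - ξ_j ζ_k) (ξ_j + ζ_k - 2Δ ξ_j ζ_k) D_N(ξ,ζ)` as a polynomial. -/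
def numerPoly (N : ℕ) (Δ : ℝ) : MvPolynomial (Fin N ⊕ Fin N) ℂ := permProd (pairPoly Δ)

theorem rename_numerPoly {N : ℕ} (Δ : ℝ) (τ μ : Equiv.Perm (Fin N)) :
    rename (Equiv.sumCongr τ μ) (numerPoly N Δ) =
      ((Equiv.Perm.sign τ : ℤ) : MvPolynomial (Fin N ⊕ Fin N) ℂ) *
        ((Equiv.Perm.sign μ : ℤ) : MvPolynomial (Fin N ⊕ Fin N) ℂ) * numerPoly N Δ := by
  rw [numerPoly, ← permProd_comp_perm]
  refine (map_permProd (rename (R := ℂ) (Equiv.sumCongr τ μ)).toRingHom _).trans ?_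
  congr 1
  ext1 j
  ext1 k
  simp [pairPoly]

/-- Exchanging the two groups transposes the array `pairPoly`. This transfers the degree in `ξ_i` to
`ζ_i`. -/
theorem rename_swap_numerPoly {N : ℕ} (Δ : ℝ) :
    rename (Equiv.sumComm (Fin N) (Fin N)) (numerPoly N Δ) = numerPoly N Δ := by
  rw [numerPoly]
  refine (map_permProd (rename (R := ℂ) (Equiv.sumComm (Fin N) (Fin N))).toRingHom _).trans ?_
  rw [← permProd_transpose]
  congr 1
  ext1 j
  ext1 k
  simp only [pairPoly, AlgHom.toRingHom_eq_coe, RingHom.coe_coe, map_mul, map_sub, map_add,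
    map_one, rename_X, rename_C, Equiv.sumComm_apply, Sum.swap_inl, Sum.swap_inr]
  ring

theorem vandermondePoly_dvd_numerPoly (N : ℕ) (Δ : ℝ) : vandermondePoly N ∣ numerPoly N Δ := by
  refine vandermondePoly_dvd (fun i j h => ?_) fun i j h => ?_
  · have h1 := rename_numerPoly Δ (Equiv.swap i j) 1
    rw [Equiv.Perm.sign_swap h] at h1
    simpa using h1
  · have h1 := rename_numerPoly Δ 1 (Equiv.swap i j)
    rw [Equiv.Perm.sign_swap h] at h1
    simpa using h1

theorem eval_numerPoly {N : ℕ} (Δ : ℝ) {ξ ζ : Fin N → ℂ} (ha : ∀ j k, 1 - ξ j * ζ k ≠ 0)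
    (hb : ∀ j k, ξ j + ζ k - 2 * Δ * ξ j * ζ k ≠ 0) :
    eval (Sum.elim ξ ζ) (numerPoly N Δ) =
      cauchyDenom ξ ζ * (mixedProd Δ ξ ζ * detD Δ ξ ζ) := by
  have h1 : eval (Sum.elim ξ ζ) (numerPoly N Δ) = permProd fun j k =>
      (1 - ξ j * ζ k) * (ξ j + ζ k - 2 * Δ * ξ j * ζ k) := by
    refine (map_permProd (eval (Sum.elim ξ ζ)) _).trans ?_
    simp [pairPoly]
  rw [h1, permProd_eq_mul_det fun j k => mul_ne_zero (ha j k) (hb j k), ← mul_assoc]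
  simp only [Finset.prod_mul_distrib]
  rfl

/-! ### Degrees -/

open Classical in
/-- Specialization of all variables but `v`. -/
def specialize {ι : Type*} (v : ι) (s : ι → ℂ) : MvPolynomial ι ℂ →ₐ[ℂ] Polynomial ℂ :=
  aeval fun w => if w = v then Polynomial.X else Polynomial.C (s w)

theorem specialize_X_self {ι : Type*} (v : ι) (s : ι → ℂ) :
    specialize v s (X v) = Polynomial.X := by
  simp [specialize]

theorem specialize_X_of_ne {ι : Type*} {v w : ι} (s : ι → ℂ) (h : w ≠ v) :
    specialize v s (X w) = Polynomial.C (s w) := by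
  simp [specialize, h]

theorem specialize_C {ι : Type*} (v : ι) (s : ι → ℂ) (a : ℂ) :
    specialize v s (C a) = Polynomial.C a := by
  simp [specialize, Polynomial.algebraMap_eq]

/-- Used to bound `degreeOf` from below by one-variable specializations. -/
theorem natDegree_specialize_le {ι : Type*} (v : ι) (s : ι → ℂ) (p : MvPolynomial ι ℂ) :
    (specialize v s p).natDegree ≤ p.degreeOf v := by
  classical
  rw [specialize, aeval_def, eval₂_eq]
  refine Polynomial.natDegree_sum_le_of_forall_le _ _ fun m hm => ?_
  refine Polynomial.natDegree_mul_le.trans ?_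
  rw [Polynomial.algebraMap_eq, Polynomial.natDegree_C, zero_add]
  refine (Polynomial.natDegree_prod_le _ _).trans ?_
  calc _ ≤ ∑ i ∈ m.support, if i = v then m v else 0 := by
        refine Finset.sum_le_sum fun i _ => Polynomial.natDegree_pow_le.trans ?_
        split_ifs with h
        · simp [h]
        · simp
    _ ≤ m v := by
        rw [Finset.sum_ite_eq']
        split_ifs <;> simp
    _ ≤ _ := monomial_le_degreeOf v hm

theorem degreeOf_X_sub_X {ι : Type*} [DecidableEq ι] {a b : ι} (h : a ≠ b) (v : ι) :
    degreeOf v (X b - X a : MvPolynomial ι ℂ) =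
      (if v = a then 1 else 0) + if v = b then 1 else 0 := by
  refine le_antisymm ((degreeOf_sub_le _ _ _).trans ?_) ?_
  · rw [degreeOf_X, degreeOf_X, max_le_iff]
    constructor <;> split_ifs <;> simp
  · by_cases h1 : v = a
    · subst h1
      rw [if_pos rfl, if_neg h]
      refine le_trans (le_of_eq ?_) (natDegree_specialize_le v 0 _)
      rw [map_sub, specialize_X_self, specialize_X_of_ne _ h.symm]
      simp
    · rw [if_neg h1]
      by_cases h2 : v = b
      · subst h2
        rw [if_pos rfl]
        refine le_trans (le_of_eq ?_) (natDegree_specialize_le v 0 _)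
        rw [map_sub, specialize_X_self, specialize_X_of_ne _ h]
        simp
      · simp [h2]

/-- The degree counts the pairs containing `v`: `N - 1 - i` with `v` as the smaller and `i` with `v`
as the larger element. -/
theorem degreeOf_vandermondePoly {N : ℕ} (v : Fin N ⊕ Fin N) :
    degreeOf v (vandermondePoly N) = N - 1 := by
  classical
  have h0 : degreeOf v (vandermondePoly N) = ∑ u : Fin N ⊕ Fin N, ∑ w : Fin N ⊕ Fin N,
      if u < w then (if v = u then 1 else 0) + (if v = w then 1 else 0) else 0 := by
    rw [vandermondePoly_eq, degreeOf_prod_eq _ _ fun p hp =>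
      (irreducible_X_sub_X (show p.1 < p.2 by simpa using hp).ne).ne_zero,
      ← Fintype.sum_prod_type', ← Finset.sum_filter]
    refine Finset.sum_congr (by ext; simp) fun p hp => ?_
    exact degreeOf_X_sub_X (show p.1 < p.2 by simpa using hp).ne v
  have h1 : degreeOf v (vandermondePoly N) = (∑ w : Fin N ⊕ Fin N, if v < w then 1 else 0) +
      ∑ u : Fin N ⊕ Fin N, if u < v then 1 else 0 := by
    rw [h0]
    have h2 : ∀ u w : Fin N ⊕ Fin N,
        (if u < w then (if v = u then 1 else 0) + (if v = w then 1 else 0) else 0) =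
        (if v = u then if u < w then 1 else 0 else 0) +
          (if v = w then if u < w then 1 else 0 else 0) := fun u w => by
      split_ifs <;> rfl
    simp only [h2, Finset.sum_add_distrib]
    rw [Finset.sum_comm]
    simp
  rw [h1]
  have hI : ∀ i : Fin N, (∑ k, if i < k then 1 else 0) = N - 1 - i := fun i => by
    rw [← Finset.card_filter, Finset.filter_lt_eq_Ioi, Fin.card_Ioi]
  have hJ : ∀ i : Fin N, (∑ k, if k < i then 1 else 0) = (i : ℕ) := fun i => by
    rw [← Finset.card_filter, Finset.filter_gt_eq_Iio, Fin.card_Iio]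
  rcases v with i | i
  · simp only [Fintype.sum_sum_type, Sum.inl_lt_inl_iff, Sum.not_inl_lt_inr, Sum.not_inr_lt_inl,
      if_false, Finset.sum_const_zero, add_zero, hI, hJ]
    omega
  · simp only [Fintype.sum_sum_type, Sum.inr_lt_inr_iff, Sum.not_inl_lt_inr, Sum.not_inr_lt_inl,
      if_false, Finset.sum_const_zero, zero_add, hI, hJ]
    omega

theorem degreeOf_pairPoly_le {N : ℕ} (Δ : ℝ) (i j k : Fin N) :
    degreeOf (Sum.inl i) (pairPoly Δ j k) ≤ if j = i then 2 else 0 := by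
  classical
  have hX : degreeOf (Sum.inl i) (X (Sum.inl j) : MvPolynomial (Fin N ⊕ Fin N) ℂ) ≤
      if j = i then 1 else 0 := by
    rw [degreeOf_X]
    simp only [Sum.inl.injEq, eq_comm (a := i)]
    exact le_rfl
  have hZ : degreeOf (Sum.inl i) (X (Sum.inr k) : MvPolynomial (Fin N ⊕ Fin N) ℂ) = 0 := by
    rw [degreeOf_X]
    simp
  have h1 : degreeOf (Sum.inl i)
      (1 - X (Sum.inl j) * X (Sum.inr k) : MvPolynomial (Fin N ⊕ Fin N) ℂ) ≤
      if j = i then 1 else 0 := by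
    refine (degreeOf_sub_le _ _ _).trans (max_le (by simp) ((degreeOf_mul_le _ _ _).trans ?_))
    omega
  have h2 : degreeOf (Sum.inl i) (X (Sum.inl j) + X (Sum.inr k) -
      C (2 * (Δ : ℂ)) * X (Sum.inl j) * X (Sum.inr k) : MvPolynomial (Fin N ⊕ Fin N) ℂ) ≤
      if j = i then 1 else 0 := by
    refine (degreeOf_sub_le _ _ _).trans (max_le ((degreeOf_add_le _ _ _).trans
      (max_le hX (by omega))) ((degreeOf_mul_le _ _ _).trans ?_))
    have h3 := degreeOf_C_mul_le (X (Sum.inl j) : MvPolynomial (Fin N ⊕ Fin N) ℂ) (Sum.inl i)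
      (2 * (Δ : ℂ))
    omega
  refine (degreeOf_mul_le _ _ _).trans ((add_le_add h1 h2).trans ?_)
  split_ifs <;> simp

/-- In each summand only the `N - 1` factors with `j = i` and `k ≠ σ(i)` involve `ξ_i`, each with
degree at most `2`. -/
theorem degreeOf_numerPoly_le {N : ℕ} (Δ : ℝ) (i : Fin N) :
    degreeOf (Sum.inl i) (numerPoly N Δ) ≤ 2 * (N - 1) := by
  refine (degreeOf_sum_le _ _ _).trans (Finset.sup_le fun σ _ => ?_)
  refine (degreeOf_mul_le _ _ _).trans ?_
  rw [← map_intCast (C (σ := Fin N ⊕ Fin N) (R := ℂ)), degreeOf_C, zero_add]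
  refine (degreeOf_prod_le _ _ _).trans ?_
  calc _ ≤ ∑ j : Fin N, if j = i then 2 * (N - 1) else 0 := by
        refine Finset.sum_le_sum fun j _ => (degreeOf_prod_le _ _ _).trans ?_
        calc _ ≤ ∑ k : Fin N, if k = σ j then 0 else if j = i then 2 else 0 := by
              refine Finset.sum_le_sum fun k _ => ?_
              by_cases h : k = σ j
              · simp [h]
              · simpa only [if_neg h] using degreeOf_pairPoly_le Δ i j k
          _ ≤ _ := by
              rw [← Finset.add_sum_erase _ _ (Finset.mem_univ (σ j)), if_pos rfl, zero_add,
                Finset.sum_congr rfl fun k hk => if_neg (Finset.ne_of_mem_erase hk),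
                Finset.sum_const, Finset.card_erase_of_mem (Finset.mem_univ _), Finset.card_univ,
                Fintype.card_fin]
              split_ifs
              · simp [mul_comm]
              · simp
    _ = _ := by simp

/-- A permutation other than the identity moves some `j ≠ i`, and its product then retains the
factor `c j j = 0`. -/
theorem permProd_eq_prod_of_diag {n : ℕ} {A : Type*} [CommRing A] {c : Fin n → Fin n → A}
    {i : Fin n} (h : ∀ j, j ≠ i → c j j = 0) :
    permProd c = ∏ j, ∏ k, if k = j then 1 else c j k := by
  rw [permProd, Finset.sum_eq_single 1 (fun σ _ hσ => ?_) (by simp)]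
  · simp only [Equiv.Perm.sign_one, Units.val_one, Int.cast_one, one_mul, Equiv.Perm.one_apply]
    rfl
  · obtain ⟨j, hji, hj⟩ : ∃ j, j ≠ i ∧ σ j ≠ j := by
      by_contra! hcon
      refine hσ (Equiv.ext fun j => ?_)
      by_cases hji : j = i
      · subst hji
        by_contra hj
        exact hj (σ.injective (hcon _ hj))
      · exact hcon j hji
    rw [Finset.prod_eq_zero (Finset.mem_univ j), mul_zero]
    exact Finset.prod_eq_zero (Finset.mem_univ j) (by rw [if_neg hj.symm, h j hji])

/-- Specializing `ζ_i = 0` and `ζ_j = 1/ξ_j` for `j ≠ i` leaves one term of the numerator, of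
degree `2(N-1)` in `ξ_i`. -/
theorem exists_natDegree_specialize_numerPoly {N : ℕ} (Δ : ℝ) (i : Fin N) :
    ∃ s, specialize (Sum.inl i) s (numerPoly N Δ) ≠ 0 ∧
      (specialize (Sum.inl i) s (numerPoly N Δ)).natDegree = 2 * (N - 1) := by
  -- Distinct positive numbers above `2Δ`. With `ζ_j = a_j⁻¹` the diagonal factors `1 - ξ_j ζ_j`, `j
  -- ≠ i`, vanish, while the off-diagonal entries stay nonzero and those of row `i` have degree
  -- exactly `2`.
  set a : Fin N → ℝ := fun j => 2 * |Δ| + 1 + (j : ℕ) with ha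
  set b : Fin N → ℝ := fun k => if k = i then 0 else (a k)⁻¹ with hb
  have ha0 : ∀ j, 0 < a j := fun j => by positivity
  have haΔ : ∀ j, 0 < a j - 2 * Δ := fun j => by
    have h1 := le_abs_self Δ
    have h2 : (0 : ℝ) ≤ (j : ℕ) := Nat.cast_nonneg _
    simp only [ha]
    linarith
  set s : Fin N ⊕ Fin N → ℂ := Sum.elim (fun j => (a j : ℂ)) fun k => (b k : ℂ) with hs
  have hc : ∀ j k, specialize (Sum.inl i) s (pairPoly Δ j k) = if j = i then
      (Polynomial.C (-(b k : ℂ)) * Polynomial.X + Polynomial.C 1) *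
        (Polynomial.C (1 - 2 * (Δ : ℂ) * b k) * Polynomial.X + Polynomial.C (b k : ℂ))
      else Polynomial.C ((((1 - a j * b k) * (a j + b k - 2 * Δ * a j * b k) : ℝ)) : ℂ) := by
    intro j k
    have hk : specialize (Sum.inl i) s (X (Sum.inr k)) = Polynomial.C (b k : ℂ) :=
      specialize_X_of_ne s (by simp)
    split_ifs with hj
    · subst hj
      simp only [pairPoly, map_mul, map_sub, map_add, map_one, specialize_X_self, hk, specialize_C,
        map_neg]
      ring
    · have hj' : specialize (Sum.inl i) s (X (Sum.inl j)) = Polynomial.C (a j : ℂ) :=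
        specialize_X_of_ne s (by simpa using hj)
      simp only [pairPoly, map_mul, map_sub, map_add, map_one, hj', hk, specialize_C]
      push_cast
      simp only [map_mul, map_sub, map_add, map_one]
  have hdiag : ∀ j, j ≠ i → specialize (Sum.inl i) s (pairPoly Δ j j) = 0 := fun j hj => by
    rw [hc, if_neg hj]
    simp only [hb, if_neg hj]
    rw [mul_inv_cancel₀ (ha0 j).ne']
    simp
  have hP : specialize (Sum.inl i) s (numerPoly N Δ) =
      ∏ j, ∏ k, if k = j then 1 else specialize (Sum.inl i) s (pairPoly Δ j k) :=
    (map_permProd (specialize (Sum.inl i) s).toRingHom _).trans (permProd_eq_prod_of_diag hdiag)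
  have hfac : ∀ j k, (if k = j then 1 else specialize (Sum.inl i) s (pairPoly Δ j k)) ≠ 0 ∧
      (if k = j then 1 else specialize (Sum.inl i) s (pairPoly Δ j k)).natDegree =
        if j = i then if k = j then 0 else 2 else 0 := by
    intro j k
    by_cases hkj : k = j
    · simp [hkj]
    simp only [if_neg hkj, hc]
    by_cases hji : j = i
    · subst hji
      have h1 : -(b k : ℂ) ≠ 0 := by
        simp only [hb, if_neg hkj]
        simpa using (ha0 k).ne'
      have h2 : 1 - 2 * (Δ : ℂ) * b k ≠ 0 := by
        have h3 : 1 - 2 * Δ * b k ≠ 0 := by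
          simp only [hb, if_neg hkj]
          have h4 : 1 - 2 * Δ * (a k)⁻¹ = (a k - 2 * Δ) * (a k)⁻¹ := by
            rw [sub_mul, mul_inv_cancel₀ (ha0 k).ne']
          rw [h4]
          exact mul_ne_zero (haΔ k).ne' (inv_ne_zero (ha0 k).ne')
        exact_mod_cast h3
      have h5 := Polynomial.natDegree_linear (a := -(b k : ℂ)) (b := 1) h1
      have h6 := Polynomial.natDegree_linear (b := (b k : ℂ)) h2
      have h7 := Polynomial.ne_zero_of_natDegree_gt (h5.symm ▸ Nat.zero_lt_one)
      have h8 := Polynomial.ne_zero_of_natDegree_gt (h6.symm ▸ Nat.zero_lt_one)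
      simp only [if_true]
      exact ⟨mul_ne_zero h7 h8, by rw [Polynomial.natDegree_mul h7 h8, h5, h6]⟩
    · simp only [if_neg hji]
      refine ⟨?_, Polynomial.natDegree_C _⟩
      rw [Ne, Polynomial.C_eq_zero, Complex.ofReal_eq_zero]
      by_cases hki : k = i
      · simp [hb, hki, (ha0 j).ne']
      · simp only [hb, if_neg hki]
        have hak := (ha0 k).ne'
        have h1 : 1 - a j * (a k)⁻¹ ≠ 0 := fun h => by
          have h2 : a k = a j := by
            field_simp at h
            linarith
          simp only [ha, add_right_inj, Nat.cast_inj] at h2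
          exact hkj (Fin.ext h2)
        have h3 : a j + (a k)⁻¹ - 2 * Δ * a j * (a k)⁻¹ =
            (a j * (a k - 2 * Δ) + 1) * (a k)⁻¹ := by
          field_simp
          ring
        rw [h3]
        refine mul_ne_zero h1 (mul_ne_zero (ne_of_gt ?_) (inv_ne_zero hak))
        have := mul_pos (ha0 j) (haΔ k)
        linarith
  refine ⟨s, ?_, ?_⟩
  · rw [hP]
    exact Finset.prod_ne_zero_iff.2 fun j _ => Finset.prod_ne_zero_iff.2 fun k _ => (hfac j k).1
  · rw [hP, Polynomial.natDegree_prod _ _ fun j _ => Finset.prod_ne_zero_iff.2 fun k _ =>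
      (hfac j k).1, Finset.sum_congr rfl fun j _ => Polynomial.natDegree_prod _ _ fun k _ =>
      (hfac j k).1]
    simp only [(hfac _ _).2]
    rw [Finset.sum_eq_single i (fun j _ hj => by simp [hj]) (by simp)]
    simp only [if_true]
    rw [← Finset.add_sum_erase _ _ (Finset.mem_univ i), if_pos rfl, zero_add,
      Finset.sum_congr rfl fun k hk => if_neg (Finset.ne_of_mem_erase hk), Finset.sum_const,
      Finset.card_erase_of_mem (Finset.mem_univ _), Finset.card_univ, Fintype.card_fin,
      smul_eq_mul, mul_comm]

theorem degreeOf_numerPoly {N : ℕ} (Δ : ℝ) (v : Fin N ⊕ Fin N) :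
    degreeOf v (numerPoly N Δ) = 2 * (N - 1) := by
  have h1 : ∀ i : Fin N, degreeOf (Sum.inl i) (numerPoly N Δ) = 2 * (N - 1) := fun i => by
    obtain ⟨s, -, hs⟩ := exists_natDegree_specialize_numerPoly Δ i
    exact le_antisymm (degreeOf_numerPoly_le Δ i) (hs ▸ natDegree_specialize_le _ s _)
  rcases v with i | i
  · exact h1 i
  · rw [← h1 i, ← degreeOf_rename_of_injective (Equiv.sumComm (Fin N) (Fin N)).injective,
      rename_swap_numerPoly]
    rfl

/-- `Q` is the quotient of the numerator by the Vandermonde polynomial. Degrees add in a domain, so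
its degree is `2(N - 1) - (N - 1)`, and a quotient of polynomials with the same antisymmetry is
symmetric. -/
theorem exists_isQ (N : ℕ) (Δ : ℝ) : ∃ Q : MvPolynomial (Fin N ⊕ Fin N) ℂ, IsQ Δ Q := by
  obtain ⟨Q, hQ⟩ := vandermondePoly_dvd_numerPoly N Δ
  have hV := vandermondePoly_ne_zero N
  refine ⟨Q, ⟨fun ξ ζ ha hb => ?_, fun v => ?_, fun τ μ => ?_⟩⟩
  · have h1 := eval_numerPoly Δ ha hb
    have h2 : cauchyDenom ξ ζ ≠ 0 :=
      Finset.prod_ne_zero_iff.2 fun j _ => Finset.prod_ne_zero_iff.2 fun k _ => ha j k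
    rw [hQ, map_mul, eval_vandermondePoly] at h1
    rw [evalQ, div_mul_eq_mul_div, eq_div_iff h2, h1]
    ring
  · have hP : numerPoly N Δ ≠ 0 := by
      have i : Fin N := v.elim id id
      obtain ⟨s, hs, -⟩ := exists_natDegree_specialize_numerPoly Δ i
      exact fun h => hs (by rw [h, map_zero])
    have hQ0 : Q ≠ 0 := fun h => hP (by rw [hQ, h, mul_zero])
    have h1 := degreeOf_numerPoly Δ v
    rw [hQ, degreeOf_mul_eq hV hQ0, degreeOf_vandermondePoly] at h1
    omega
  · have h1 := rename_numerPoly Δ τ μ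
    rw [hQ, map_mul, rename_vandermondePoly, ← mul_assoc] at h1
    refine mul_left_cancel₀ (mul_ne_zero (mul_ne_zero ?_ ?_) hV) h1
    · rcases Int.units_eq_one_or (Equiv.Perm.sign τ) with h | h <;> simp [h]
    · rcases Int.units_eq_one_or (Equiv.Perm.sign μ) with h | h <;> simp [h]

/-! ### Comparison of the two integrands -/

theorem continuousOn_timeFactor {N : ℕ} (Δ : ℝ) (Y : Config N) (x : ℤ) (t : ℝ) :
    ContinuousOn (fun p : (Fin N → ℂ) × (Fin N → ℂ) => timeFactor Δ Y x t p.1 p.2)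
      {p | (∀ j, p.1 j ≠ 0) ∧ ∀ j, p.2 j ≠ 0} := by
  unfold timeFactor energy
  refine continuousOn_finsetProd _ fun j _ => ContinuousOn.mul ?_ (ContinuousOn.cexp ?_)
  · exact ContinuousOn.zpow₀ (by fun_prop) _ fun p hp => Or.inl (mul_ne_zero (hp.1 j) (hp.2 j))
  · have h1 : ContinuousOn (fun p : (Fin N → ℂ) × (Fin N → ℂ) => p.1 j)
        {p | (∀ j, p.1 j ≠ 0) ∧ ∀ j, p.2 j ≠ 0} := by fun_prop
    have h2 : ContinuousOn (fun p : (Fin N → ℂ) × (Fin N → ℂ) => p.2 j)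
        {p | (∀ j, p.1 j ≠ 0) ∧ ∀ j, p.2 j ≠ 0} := by fun_prop
    exact (continuousOn_const.mul (((h1.add (h1.inv₀ fun p hp => hp.1 j)).sub
      continuousOn_const).sub ((h2.add (h2.inv₀ fun p hp => hp.2 j)).sub continuousOn_const))).neg

theorem one_sub_mul_ne_zero_of_norm {a b : ℂ} {R r : ℝ} (ha : ‖a‖ = R) (hb : ‖b‖ = r)
    (hRr : R * r < 1) : 1 - a * b ≠ 0 := fun h => by
  have h1 : ‖a * b‖ = 1 := by rw [← sub_eq_zero.1 h, norm_one]
  rw [norm_mul, ha, hb] at h1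
  exact hRr.ne h1

/-- No denominator vanishes on the compact product of tori: `|ξ_j ζ_k| = R r < 1`, and the radii
exclude the zeros of `betheDenom`. So the integrand is continuous there. -/
theorem integrable_integrandQ {N : ℕ} {Δ R r : ℝ} (hR : OrthoRadius N Δ R)
    (hr : OrthoRadius N Δ r) (hRr : R * r < 1) (Q : MvPolynomial (Fin N ⊕ Fin N) ℂ)
    (Y : Config N) (x : ℤ) (t : ℝ) :
    Integrable (fun p : (Fin N → ℂ) × (Fin N → ℂ) => integrandQ Δ Q Y x t p.1 p.2)
      ((torus fun _ => R).prod (torus fun _ => r)) := by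
  refine integrable_of_continuousOn_compact
    ((isCompact_torusSet fun _ : Fin N => R).prod (isCompact_torusSet fun _ : Fin N => r))
    (ae_prod_torus hR.pos hr.pos) ?_
  unfold integrandQ
  refine ContinuousOn.mul (ContinuousOn.mul (ContinuousOn.div ?_ ?_ ?_)
    (ContinuousOn.div ?_ ?_ ?_)) ?_
  · unfold vandermonde
    exact Continuous.continuousOn (by fun_prop)
  · exact (((continuous_betheDenom Δ).comp continuous_fst).mul
      ((continuous_betheDenom Δ).comp continuous_snd)).continuousOn
  · exact fun p hp => mul_ne_zero (hR.betheDenom_ne_zero _ hp.1) (hr.betheDenom_ne_zero _ hp.2)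
  · unfold evalQ
    refine (Q.continuous_eval.comp (continuous_pi fun v => ?_)).continuousOn
    rcases v with j | j
    · exact (continuous_apply j).comp continuous_fst
    · exact (continuous_apply j).comp continuous_snd
  · unfold cauchyDenom
    exact Continuous.continuousOn (by fun_prop)
  · exact fun p hp => Finset.prod_ne_zero_iff.2 fun j _ => Finset.prod_ne_zero_iff.2 fun k _ =>
      one_sub_mul_ne_zero_of_norm (hp.1 j) (hp.2 k) hRr
  · exact (continuousOn_timeFactor Δ Y x t).mono fun p hp =>
      ⟨hR.ne_zero hp.1, hr.ne_zero hp.2⟩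

theorem IsQ.integrandD_eq {N : ℕ} {Δ : ℝ} {Q : MvPolynomial (Fin N ⊕ Fin N) ℂ} (hQ : IsQ Δ Q)
    (Y : Config N) (x : ℤ) (t : ℝ) {ξ ζ : Fin N → ℂ} (ha : ∀ j k, 1 - ξ j * ζ k ≠ 0)
    (hb : ∀ j k, ξ j + ζ k - 2 * Δ * ξ j * ζ k ≠ 0) :
    integrandD Δ Y x t ξ ζ = integrandQ Δ Q Y x t ξ ζ := by
  have h := hQ.identity ξ ζ ha hb
  rw [integrandD, integrandQ]
  linear_combination (timeFactor Δ Y x t ξ ζ / (betheDenom Δ ξ * betheDenom Δ ζ)) * h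

theorem IsQ.integrandD_ae_eq {N : ℕ} {Δ R r : ℝ} {Q : MvPolynomial (Fin N ⊕ Fin N) ℂ}
    (hQ : IsQ Δ Q) (hR : 0 < R) (hr : 0 < r) (hRr : R * r < 1) (Y : Config N) (x : ℤ) (t : ℝ) :
    ∀ᵐ p ∂(torus fun _ : Fin N => R).prod (torus fun _ : Fin N => r),
      integrandD Δ Y x t p.1 p.2 = integrandQ Δ Q Y x t p.1 p.2 :=
  ((ae_prod_torus hR hr).and (ae_mixed_ne_zero Δ hR hr)).mono fun _ hp =>
    hQ.integrandD_eq Y x t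
      (fun j k => one_sub_mul_ne_zero_of_norm (hp.1.1 j) (hp.1.2 k) hRr) hp.2

end XXZ

end

theorem theorem2 (N : ℕ) (hN : 0 < N) (Δ : ℝ) :
    ∃ Q : MvPolynomial (Fin N ⊕ Fin N) ℂ, XXZ.IsQ Δ Q ∧
      ∀ (Y : XXZ.Config N) (x : ℤ) (t r R : ℝ),
        XXZ.SmallRadius N Δ r → XXZ.LargeRadius N Δ R → R * r < 1 →
          XXZ.ContourIntegrable R r (XXZ.integrandD Δ Y x t) ∧
          ((XXZ.probFirstGE hN Δ Y x t : ℝ) : ℂ) =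
            XXZ.contourIntegral R r (XXZ.integrandD Δ Y x t) ∧
          XXZ.ContourIntegrable R r (XXZ.integrandQ Δ Q Y x t) ∧
          XXZ.contourIntegral R r (XXZ.integrandD Δ Y x t) =
            XXZ.contourIntegral R r (XXZ.integrandQ Δ Q Y x t) := by
  obtain ⟨Q, hQ⟩ := XXZ.exists_isQ N Δ
  refine ⟨Q, hQ, fun Y x t r R hr hR hRr => ?_⟩
  have hae := hQ.integrandD_ae_eq hR.1 hr.1 hRr Y x t
  have hQi := XXZ.integrable_integrandQ hR.orthoRadius hr.orthoRadius hRr Q Y x t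
  -- The integrand with `D_N` divides by zero on a null set; its integrability is inherited from the
  -- one with `Q`.
  have hDi := hQi.congr (hae.mono fun _ h => h.symm)
  obtain ⟨hQ1, hQ2⟩ := XXZ.contourIntegrable_and_contourIntegral_eq hQi
  obtain ⟨hD1, hD2⟩ := XXZ.contourIntegrable_and_contourIntegral_eq hDi
  refine ⟨hD1, ?_, hQ1, ?_⟩
  · rw [hD2, XXZ.probFirstGE_eq_integral hN hR.orthoRadius hr.orthoRadius hRr]
  · rw [hD2, hQ2]
    exact MeasureTheory.integral_congr_ae (hae.mono fun p hp => by simp only [hp])
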